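/- Consider a limit order book in which unit-size bids and asks arrive according to two independent Poisson processes, each of rate $1$. The prices of the bids (respectively asks) are i.i.d. real random variables with an absolutely continuous distribution with cumulative distribution function $F_b$ (respectively $F_a$), and the two arrival-time processes and the two price sequences are mutually independent. When an ask arrives at price $p$: if the highest bid in the book has price at least $p$, then one bid at that highest price is executed and leaves, and the arriving ask leaves too; otherwise the ask joins the book at price $p$. Symmetrically, when a bid arrives at price $p$: if the lowest ask in the book has price at most $p$, then one ask at that lowest price leaves together with the arriving bid; otherwise the bid joins the book at price $p$. There are no other departures. Theorem. Let $x<y$ be real numbers such that $$F_b(y)<F_b(x)+F_a(x)\qquad\text{and}\qquad F_a(y)<F_a(x)+\bigl(1-F_b(y)\bigr).$$ Start the book from any state, occupying finitely many price levels, that has infinitely many bids at $x$, infinitely many asks at $y$ and finitely many orders in $(x,y)$, and in which every bid is at a lower price than every ask. Let $X_t$ be the configuration (with multiplicities) of the bids and asks of the book lying in $(x,y)$ at time $t\ge 0$. The state space is the set of all finite configurations of bids and asks in $(x,y)$ in which every bid is lower than every ask, with the $\sigma$-algebra generated by the numbers of bids and of asks in Borel sets. Then $(X_t)_{t\ge0}$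 is a positive Harris recurrent continuous-time Markov chain. That is: 1. there is a semigroup $(P_t)_{t\ge0}$ of Markov kernels on the state space such that, from every such initial book (and every element of the state space arises as $X_0$ for one of them), $(X_t)$ is a Markov process with transition semigroup $(P_t)$; 2. there is a nonzero $\sigma$-finite measure $\varphi$ on the state space such that, for every measurable set $A$ with $\varphi(A)>0$ and every such initial book, almost surely $\int_0^\infty \mathbf 1_{\{X_t\in A\}}\,dt=\infty$; 3. there is a probability measure $\pi$ on the state space with $\pi P_t=\pi$ for all $t\ge 0$. -/

import Mathlib

open MeasureTheory ProbabilityTheory Set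
open scoped ENNReal NNReal

noncomputable section

namespace LimitOrderBook

/-! ### Orders and books -/

/-- The two types of orders. -/
inductive Side where
  | bid : Side
  | ask : Side

/-- A limit order book: for each price, the number (possibly infinite) of bids and the number of
asks present at that price. -/
@[ext]
structure Book where
  bids : ℝ →₀ ℕ∞
  asks : ℝ →₀ ℕ∞

/-- The counting measure of a collection of orders. -/
def countingMeasure (m : ℝ →₀ ℕ∞) : Measure ℝ :=
  ∑ p ∈ m.support, ((m p : ℕ∞) : ℝ≥0∞) • Measure.dirac p

/-- The σ-algebra generated by the numbers of bids and of asks in Borel sets of prices. -/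
instance : MeasurableSpace Book :=
  MeasurableSpace.comap
    (fun L : Book => (countingMeasure L.bids, countingMeasure L.asks)) inferInstance

namespace Book

/-- The price `β` of the highest bid, `⊥` (that is `-∞`) if there are no bids. -/
def highestBid (L : Book) : WithBot ℝ := L.bids.support.max

/-- The price `α` of the lowest ask, `⊤` (that is `+∞`) if there are no asks. -/
def lowestAsk (L : Book) : WithTop ℝ := L.asks.support.min

/-- Remove one order at price `q`. Infinitely many orders remain infinitely many, as
`⊤ - 1 = ⊤` in `ℕ∞`. -/
def removeOne (m : ℝ →₀ ℕ∞) (q : ℝ) : ℝ →₀ ℕ∞ := m.update q (m q - 1)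

open Classical in
/-- The new state of the book when an order of the given type arrives at price `p`. An arriving
bid executes the lowest ask if it is at or below `p`, and otherwise joins the book; an arriving
ask executes the highest bid if it is at or above `p`, and otherwise joins the book.
(For absolutely continuous price distributions equality of prices has probability zero.) -/
def step (L : Book) : Side → ℝ → Book
  | .bid, p =>
      if L.lowestAsk ≤ (p : WithTop ℝ) then
        { bids := L.bids, asks := removeOne L.asks (L.lowestAsk.untopD 0) }
      else
        { bids := L.bids + Finsupp.single p 1, asks := L.asks }
  | .ask, p =>
      if (p : WithBot ℝ) ≤ L.highestBid then
        { bids := removeOne L.bids (L.highestBid.unbotD 0), asks := L.asks }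
      else
        { bids := L.bids, asks := L.asks + Finsupp.single p 1 }

open Classical in
/-- The orders of the book at prices in `(x, y)`. -/
def trace (x y : ℝ) (L : Book) : Book where
  bids := L.bids.filter (fun p => p ∈ Ioo x y)
  asks := L.asks.filter (fun p => p ∈ Ioo x y)

/-- All bids are lower than all asks. -/
def Uncrossed (L : Book) : Prop :=
  ∀ p q, L.bids p ≠ 0 → L.asks q ≠ 0 → p < q

/-- There are only finitely many orders in `(x, y)`. -/
def FiniteOn (x y : ℝ) (L : Book) : Prop :=
  ∀ p ∈ Ioo x y, L.bids p ≠ ⊤ ∧ L.asks p ≠ ⊤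

/-- A book with infinitely many bids at `x`, infinitely many asks at `y`, finitely many orders
between `x` and `y`, and all bids lower than all asks. Orders outside `[x, y]` are not
restricted otherwise. -/
structure Anchored (x y : ℝ) (L : Book) : Prop where
  uncrossed : L.Uncrossed
  bids_left : L.bids x = ⊤
  asks_right : L.asks y = ⊤
  finiteOn : L.FiniteOn x y

/-- A possible configuration of bids and asks in `(x, y)`. -/
structure IsInterior (x y : ℝ) (L : Book) : Prop where
  uncrossed : L.Uncrossed
  finiteOn : L.FiniteOn x y
  supported : ∀ p, p ∉ Ioo x y → L.bids p = 0 ∧ L.asks p = 0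

lemma removeOne_ne_zero {m : ℝ →₀ ℕ∞} {q r : ℝ} (h : removeOne m q r ≠ 0) : m r ≠ 0 := by
  classical
  intro h0
  apply h
  by_cases hr : r = q
  · subst hr; simp [removeOne, h0]
  · simp [removeOne, Function.update, hr, h0]

lemma removeOne_eq_top {m : ℝ →₀ ℕ∞} {q r : ℝ} : removeOne m q r = ⊤ ↔ m r = ⊤ := by
  classical
  by_cases hr : r = q
  · subst hr; simp [removeOne, ENat.sub_eq_top_iff]
  · simp [removeOne, Function.update, hr]

lemma add_single_eq_top {m : ℝ →₀ ℕ∞} {q r : ℝ} :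
    (m + Finsupp.single q (1 : ℕ∞) : ℝ →₀ ℕ∞) r = ⊤ ↔ m r = ⊤ := by
  classical
  by_cases hr : q = r <;> simp [hr]

lemma add_single_ne_zero {m : ℝ →₀ ℕ∞} {q r : ℝ} (h : (m + Finsupp.single q (1 : ℕ∞) : ℝ →₀ ℕ∞) r ≠ 0) :
    m r ≠ 0 ∨ r = q := by
  classical
  by_contra hc
  push Not at hc
  apply h
  simp [hc.1, Ne.symm hc.2]

lemma Anchored.step {x y : ℝ} {L : Book} (h : L.Anchored x y) (s : Side) (p : ℝ) :
    (L.step s p).Anchored x y := by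
  obtain ⟨hu, hx, hy, hf⟩ := h
  cases s with
  | bid =>
    simp only [Book.step]
    split_ifs with hc
    · exact ⟨fun a b ha hb => hu a b ha (removeOne_ne_zero hb), hx, removeOne_eq_top.2 hy,
        fun a ha => ⟨(hf a ha).1, fun hb => (hf a ha).2 (removeOne_eq_top.1 hb)⟩⟩
    · refine ⟨fun a b ha hb => ?_, add_single_eq_top.2 hx, hy,
        fun a ha => ⟨fun hb => (hf a ha).1 (add_single_eq_top.1 hb), (hf a ha).2⟩⟩
      rcases add_single_ne_zero ha with ha | rfl
      · exact hu a b ha hb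
      · have h1 : L.lowestAsk ≤ (b : WithTop ℝ) :=
          Finset.min_le (Finsupp.mem_support_iff.2 hb)
        exact WithTop.coe_lt_coe.1 (lt_of_lt_of_le (not_le.1 hc) h1)
  | ask =>
    simp only [Book.step]
    split_ifs with hc
    · exact ⟨fun a b ha hb => hu a b (removeOne_ne_zero ha) hb, removeOne_eq_top.2 hx, hy,
        fun a ha => ⟨fun hb => (hf a ha).1 (removeOne_eq_top.1 hb), (hf a ha).2⟩⟩
    · refine ⟨fun a b ha hb => ?_, hx, add_single_eq_top.2 hy,
        fun a ha => ⟨(hf a ha).1, fun hb => (hf a ha).2 (add_single_eq_top.1 hb)⟩⟩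
      rcases add_single_ne_zero hb with hb | rfl
      · exact hu a b ha hb
      · have h1 : (a : WithBot ℝ) ≤ L.highestBid :=
          Finset.le_max (Finsupp.mem_support_iff.2 ha)
        exact WithBot.coe_lt_coe.1 (lt_of_le_of_lt h1 (not_le.1 hc))

lemma Anchored.trace {x y : ℝ} {L : Book} (h : L.Anchored x y) :
    (L.trace x y).IsInterior x y := by
  classical
  refine ⟨fun p q hp hq => h.uncrossed p q ?_ ?_, fun p hp => ?_, fun p hp => ?_⟩
  · intro h0; apply hp; simp [Book.trace, Finsupp.filter_apply, h0]
  · intro h0; apply hq; simp [Book.trace, Finsupp.filter_apply, h0]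
  · have := h.finiteOn p hp
    simpa [Book.trace, Finsupp.filter_apply, hp.1, hp.2] using this
  · constructor <;> exact Finsupp.filter_apply_neg _ _ hp

end Book

/-- The initial books: infinitely many bids at `x` and infinitely many asks at `y`. -/
abbrev AnchoredBook (x y : ℝ) : Type := {L : Book // L.Anchored x y}

/-- The state space: finite configurations of bids and asks in `(x, y)`. -/
abbrev State (x y : ℝ) : Type := {L : Book // L.IsInterior x y}

/-- The state of an anchored book: its orders in `(x, y)`. -/
def AnchoredBook.state {x y : ℝ} (L : AnchoredBook x y) : State x y :=
  ⟨L.1.trace x y, L.2.trace⟩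

/-! ### Driving the book by two streams of arrivals -/

/-- A realisation of the arrivals: `a s n = (gap, price)` gives the time elapsed between the
arrival of the previous order of type `s` (time `0` if `n = 0`) and that of the `n`-th order of
type `s`, and the price of the latter. -/
abbrev Arrivals : Type := Side → ℕ → ℝ × ℝ

/-- The arrival time of the `n`-th order of type `s`. -/
def arrivalTime (a : Arrivals) (s : Side) (n : ℕ) : ℝ :=
  ∑ k ∈ Finset.range (n + 1), (a s k).1

open Classical in
/-- After `i` bids and `j` asks have arrived, the type of the next order. -/
def nextSide (a : Arrivals) (i j : ℕ) : Side :=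
  if arrivalTime a .bid i ≤ arrivalTime a .ask j then .bid else .ask

/-- The numbers of bids and of asks among the first `k` arrivals. -/
def counts (a : Arrivals) : ℕ → ℕ × ℕ
  | 0 => (0, 0)
  | k + 1 =>
      match nextSide a (counts a k).1 (counts a k).2 with
      | .bid => ((counts a k).1 + 1, (counts a k).2)
      | .ask => ((counts a k).1, (counts a k).2 + 1)

/-- The type of the `k`-th order to arrive (bids and asks together). -/
def orderSide (a : Arrivals) (k : ℕ) : Side :=
  nextSide a (counts a k).1 (counts a k).2

/-- The time at which the `k`-th order arrives. -/
def orderTime (a : Arrivals) (k : ℕ) : ℝ :=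
  match orderSide a k with
  | .bid => arrivalTime a .bid (counts a k).1
  | .ask => arrivalTime a .ask (counts a k).2

/-- The price of the `k`-th order. -/
def orderPrice (a : Arrivals) (k : ℕ) : ℝ :=
  match orderSide a k with
  | .bid => (a .bid (counts a k).1).2
  | .ask => (a .ask (counts a k).2).2

/-- The number of orders that have arrived by time `t`. -/
def numOrders (a : Arrivals) (t : ℝ≥0) : ℕ := {k : ℕ | orderTime a k ≤ (t : ℝ)}.ncard

/-- The book after `k` arrivals, started from the anchored book `L₀`. -/
def bookAfter {x y : ℝ} (a : Arrivals) (L₀ : AnchoredBook x y) : ℕ → AnchoredBook x y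
  | 0 => L₀
  | k + 1 => ⟨(bookAfter a L₀ k).1.step (orderSide a k) (orderPrice a k),
      (bookAfter a L₀ k).2.step _ _⟩

/-- The book at time `t`. -/
def bookAt {x y : ℝ} (a : Arrivals) (L₀ : AnchoredBook x y) (t : ℝ≥0) : AnchoredBook x y :=
  bookAfter a L₀ (numOrders a t)

/-- Bids and asks arrive according to two independent Poisson processes of rate `1` in time, and
the prices of the bids (asks) are independent with law `νb` (`νa`), independent of the arrival
times. -/
structure IsPoissonArrivals {Ω : Type*} [MeasurableSpace Ω] (μ : Measure Ω)
    (νb νa : Measure ℝ) (a : Ω → Arrivals) : Prop where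
  measurable : ∀ s n, Measurable (fun ω => a ω s n)
  indep : iIndepFun (fun (i : Side × ℕ) ω => a ω i.1 i.2) μ
  law_bid : ∀ n, μ.map (fun ω => a ω .bid n) = (expMeasure 1).prod νb
  law_ask : ∀ n, μ.map (fun ω => a ω .ask n) = (expMeasure 1).prod νa

/-! ### Positive Harris recurrence -/

section Harris

variable {Ω S I : Type*} [MeasurableSpace Ω] [MeasurableSpace S]

/-- A semigroup of Markov transition kernels on `S`. -/
structure IsTransitionSemigroup (P : ℝ≥0 → Kernel S S) : Prop where
  markov : ∀ t, IsMarkovKernel (P t)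
  zero : P 0 = Kernel.id
  add : ∀ t u, P (t + u) = P u ∘ₖ P t

/-- The σ-algebra generated by the process up to time `t`. -/
abbrev past (X : ℝ≥0 → Ω → S) (t : ℝ≥0) : MeasurableSpace Ω :=
  ⨆ r : {r : ℝ≥0 // r ≤ t}, MeasurableSpace.comap (X r.1) inferInstance

/-- `X` is a (time-homogeneous) Markov process with transition semigroup `P` started at `x₀`. -/
structure IsMarkovProcess (μ : Measure Ω) (P : ℝ≥0 → Kernel S S) (x₀ : S)
    (X : ℝ≥0 → Ω → S) : Prop where
  measurable : ∀ t, Measurable (X t)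
  start : ∀ᵐ ω ∂μ, X 0 ω = x₀
  markov : ∀ (t u : ℝ≥0) (A : Set S), MeasurableSet A →
    μ⟦X (t + u) ⁻¹' A | past X t⟧ =ᵐ[μ] fun ω => (P u (X t ω)).real A

/-- A family of processes `X i`, started at `init i`, is a positive Harris recurrent
continuous-time Markov chain on `S`: every state is an initial state of some member of the family;
the processes are Markov with a common transition semigroup; for some nonzero σ-finite measure
`φ`, every set of positive `φ`-measure is almost surely occupied for an infinite amount of time,
from every initial state; and there is an invariant probability measure. -/
def IsPositiveHarrisRecurrent (μ : Measure Ω) (init : I → S) (X : I → ℝ≥0 → Ω → S) : Prop :=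
  Function.Surjective init ∧
  ∃ P : ℝ≥0 → Kernel S S,
    IsTransitionSemigroup P ∧
    (∀ i, IsMarkovProcess μ P (init i) (X i)) ∧
    (∃ φ : Measure S, SigmaFinite φ ∧ φ ≠ 0 ∧
      ∀ A : Set S, MeasurableSet A → 0 < φ A →
        ∀ i, ∀ᵐ ω ∂μ, volume ((fun t : ℝ≥0 => (t : ℝ)) '' {t | X i t ω ∈ A}) = ⊤) ∧
    (∃ π : Measure S, IsProbabilityMeasure π ∧ ∀ t, (P t).Invariant π)

end Harris

end LimitOrderBook

end

/-!
The orders in `(x, y)` form a Markov chain by themselves: bids at or below `x` never matter there,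
since infinitely many bids wait at `x`, and likewise for asks at or above `y`
(`Book.Anchored.trace_step`). The chain is positive Harris recurrent because the state without orders
in `(x, y)` is an atom to which it returns quickly.

*Driving sequence.* The two Poisson streams merge into one sequence of independent triples (waiting
time, type, price), with waiting times exponential of rate `2` and the two types equally likely
(`IsPoissonArrivals.map_merged`). All probabilities are computed under the law `seqLaw` of an
independent identically distributed sequence, by splitting off its first term
(`lintegral_seqLaw`). As the exponential law is memoryless, the sequence seen from a fixed time is
a fresh copy of it, independent of the past (`lintegral_between_shift`). This gives the transition
semigroup and the Markov property (`isMarkovProcess_process`).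

*Bounding walk.* The numbers of bids and of asks in `(x, y)` are bounded by the two components of a
walk on `ℕ × ℕ` reflected at the axes (`Book.Dominated.innerStep`). The first component goes up when
a bid arrives in `(x, y)` and down when an ask arrives at or below `x`, as such an ask removes a bid
of `(x, y)` if there is one; the second component is the mirror image. The two hypotheses on the
distribution functions say that both components have negative drift. Although the components are
not independent, they never move simultaneously, and a product of geometric weights is stationary
(`tsum_weight_walkStep`).

*Invariant measure.* Stationarity of the weights, which have finite total mass, bounds the mean
return time of the walk to `(0, 0)` (`tsum_survival_walkStep_le`), hence that of the book to the
empty state. The normalised occupation measure of an excursion from the empty state is invariant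
for the jump chain (`exists_invariantStep`) and, since the jump rate is constant, for the
continuous-time process (`InvariantStep.invariant_transition`).

*Recurrence.* Stationarity also bounds from below the probability that the walk started at `(0, 0)`
is there after `n` steps and stays for a time greater than `1`, so with positive probability this
happens for infinitely many `n`. Walks from different starting points merge almost surely
(`ae_mem_recurs_iff`), so this event is not affected by changing the first terms of the driving
sequence and has probability `1` (`ae_mem_recurs`). The book is empty whenever the walk is at
`(0, 0)`, so it spends an infinite amount of time in the empty state, and the Dirac mass there serves
as the measure `φ`.
-/

namespace LimitOrderBook

/-! ### Sequences of independent identically distributed variables -/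

section Sequences

variable {E : Type*}

/-- The sequence with first term `e`, followed by the terms of `w`. -/
def cons (e : E) (w : ℕ → E) : ℕ → E
  | 0 => e
  | n + 1 => w n

@[simp] lemma cons_zero (e : E) (w : ℕ → E) : cons e w 0 = e := rfl

@[simp] lemma cons_succ (e : E) (w : ℕ → E) (n : ℕ) : cons e w (n + 1) = w n := rfl

/-- The sequences whose first `k` terms lie in prescribed sets. -/
def initialBox (k : ℕ) (t : ℕ → Set E) : Set (ℕ → E) := {w | ∀ i < k, w i ∈ t i}

lemma cons_mem_initialBox {k : ℕ} {t : ℕ → Set E} {e : E} {w : ℕ → E} :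
    cons e w ∈ initialBox (k + 1) t ↔ e ∈ t 0 ∧ w ∈ initialBox k fun i => t (i + 1) := by
  constructor
  · intro h
    exact ⟨h 0 (by omega), fun i hi => h (i + 1) (by omega)⟩
  · rintro ⟨h0, h⟩ i hi
    cases i with
    | zero => exact h0
    | succ i => exact h i (by omega)

variable [MeasurableSpace E]

lemma measurable_cons : Measurable fun z : E × (ℕ → E) => cons z.1 z.2 := by
  refine measurable_pi_lambda _ fun n => ?_
  cases n with
  | zero => exact measurable_fst
  | succ n => exact (measurable_pi_apply n).comp measurable_snd

@[fun_prop]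
lemma _root_.Measurable.seqCons {α : Type*} [MeasurableSpace α] {f : α → E} {g : α → ℕ → E}
    (hf : Measurable f) (hg : Measurable g) : Measurable fun z => cons (f z) (g z) :=
  measurable_cons.comp (hf.prodMk hg)

lemma measurableSet_initialBox (k : ℕ) {t : ℕ → Set E} (ht : ∀ i, MeasurableSet (t i)) :
    MeasurableSet (initialBox k t) := by
  have : initialBox k t = ⋂ i, ⋂ (_ : i < k), (fun w : ℕ → E => w i) ⁻¹' t i := by
    ext w; simp [initialBox]
  rw [this]
  exact MeasurableSet.iInter fun i => MeasurableSet.iInter fun _ => measurable_pi_apply i (ht i)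

/-- The law of a sequence of independent variables with common law `lam`. -/
noncomputable def seqLaw (lam : Measure E) : Measure (ℕ → E) := Measure.infinitePi fun _ : ℕ => lam

variable (lam : Measure E) [IsProbabilityMeasure lam]

instance : IsProbabilityMeasure (seqLaw lam) := by unfold seqLaw; infer_instance

lemma seqLaw_initialBox (k : ℕ) {t : ℕ → Set E} (ht : ∀ i, MeasurableSet (t i)) :
    seqLaw lam (initialBox k t) = ∏ i ∈ Finset.range k, lam (t i) := by
  have h := Measure.infinitePi_pi (fun _ : ℕ => lam) (s := Finset.range k) (t := t)
    (fun i _ => ht i)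
  rw [← h, seqLaw]
  congr 1
  ext w
  simp [initialBox, Set.mem_pi]

variable {lam}

lemma eq_seqLaw {ν : Measure (ℕ → E)}
    (h : ∀ k (t : ℕ → Set E), (∀ i, MeasurableSet (t i)) →
      ν (initialBox k t) = ∏ i ∈ Finset.range k, lam (t i)) : ν = seqLaw lam := by
  classical
  refine Measure.eq_infinitePi _ fun s t ht => ?_
  have h1 := h (s.sup id + 1) (fun i => if i ∈ s then t i else univ)
    (fun i => by split_ifs <;> simp [ht])
  have hs : ∀ i ∈ s, i < s.sup id + 1 := fun i hi => Nat.lt_succ_of_le (Finset.le_sup (f := id) hi)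
  have h2 : Set.pi (s : Set ℕ) t
      = initialBox (s.sup id + 1) (fun i => if i ∈ s then t i else univ) := by
    ext w
    simp only [Set.mem_pi, initialBox, mem_ofPred_eq, Finset.mem_coe]
    constructor
    · intro hw i _
      split_ifs with hi
      · exact hw i hi
      · trivial
    · intro hw i hi
      simpa [hi] using hw i (hs i hi)
  rw [h2, h1, ← Finset.prod_subset (s₁ := s)]
  · exact Finset.prod_congr rfl fun i hi => by simp [hi]
  · exact fun i hi => Finset.mem_range.2 (hs i hi)
  · intro i _ hi
    simp [hi]

variable (lam)

lemma map_cons_seqLaw : (lam.prod (seqLaw lam)).map (fun z => cons z.1 z.2) = seqLaw lam := by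
  refine eq_seqLaw fun k t ht => ?_
  rw [Measure.map_apply measurable_cons (measurableSet_initialBox k ht)]
  cases k with
  | zero =>
    have : (fun z : E × (ℕ → E) => cons z.1 z.2) ⁻¹' initialBox 0 t = univ := by
      ext z; simp [initialBox]
    simp [this]
  | succ k =>
    have : (fun z : E × (ℕ → E) => cons z.1 z.2) ⁻¹' initialBox (k + 1) t
        = t 0 ×ˢ initialBox k fun i => t (i + 1) := by
      ext z; simp [cons_mem_initialBox]
    rw [this, Measure.prod_prod, seqLaw_initialBox lam k fun i => ht (i + 1),
      Finset.prod_range_succ', mul_comm]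

variable {lam}

/-- Conditioning on the first term. -/
lemma lintegral_seqLaw {f : (ℕ → E) → ℝ≥0∞} (hf : Measurable f) :
    ∫⁻ w, f w ∂seqLaw lam = ∫⁻ e, ∫⁻ w, f (cons e w) ∂seqLaw lam ∂lam := by
  conv_lhs => rw [← map_cons_seqLaw lam]
  rw [lintegral_map hf measurable_cons, lintegral_prod _ (by fun_prop)]

lemma seqLaw_apply_eq_lintegral {s : Set (ℕ → E)} (hs : MeasurableSet s) :
    seqLaw lam s = ∫⁻ e, seqLaw lam {w | cons e w ∈ s} ∂lam := by
  rw [← lintegral_indicator_one hs, lintegral_seqLaw (measurable_one.indicator hs)]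
  refine lintegral_congr fun e => ?_
  have : MeasurableSet {w | cons e w ∈ s} := (measurable_const.seqCons measurable_id) hs
  rw [← lintegral_indicator_one this]
  rfl

lemma measurePreserving_eval_seqLaw (i : ℕ) :
    MeasurePreserving (fun w : ℕ → E => w i) (seqLaw lam) lam :=
  measurePreserving_eval_infinitePi (fun _ : ℕ => lam) i

end Sequences

/-! ### Exponential waiting times -/

section Exponential

lemma lintegral_expMeasure {r : ℝ} {f : ℝ → ℝ≥0∞} (hf : Measurable f) :
    ∫⁻ g, f g ∂expMeasure r
      = ∫⁻ g, (Ici 0).indicator (fun g => ENNReal.ofReal (r * Real.exp (-(r * g))) * f g) g := by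
  have h : expMeasure r = volume.withDensity (exponentialPDF r) := rfl
  have hm : Measurable (exponentialPDF r) :=
    (measurable_exponentialPDFReal r).ennreal_ofReal
  rw [h, lintegral_withDensity_eq_lintegral_mul _ hm hf]
  refine lintegral_congr fun g => ?_
  by_cases hg : 0 ≤ g
  · simp [exponentialPDF_of_nonneg hg, hg]
  · simp [exponentialPDF_of_neg (not_le.1 hg), hg]

/-- The exponential distribution has no memory: after a wait of length `t`, the remaining waiting
time has the original law. -/
lemma lintegral_expMeasure_shift {r t : ℝ} (ht : 0 ≤ t) {f : ℝ → ℝ≥0∞} (hf : Measurable f) :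
    ∫⁻ g, (Ici t).indicator (fun g => f (g - t)) g ∂expMeasure r
      = ENNReal.ofReal (Real.exp (-(r * t))) * ∫⁻ g, f g ∂expMeasure r := by
  rw [lintegral_expMeasure hf, lintegral_expMeasure
    ((by fun_prop : Measurable fun g => f (g - t)).indicator measurableSet_Ici),
    ← lintegral_const_mul _ (by
      refine Measurable.indicator ?_ measurableSet_Ici
      fun_prop),
    ← lintegral_add_right_eq_self _ t]
  refine lintegral_congr fun g => ?_
  by_cases hg : 0 ≤ g
  · have h1 : 0 ≤ g + t := by positivity
    simp only [indicator, mem_Ici, h1, hg, if_true, le_add_iff_nonneg_left, add_sub_cancel_right]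
    rw [← mul_assoc, ← ENNReal.ofReal_mul (Real.exp_pos _).le]
    congr 2
    rw [mul_left_comm, ← Real.exp_add]
    ring_nf
  · by_cases h1 : 0 ≤ g + t <;> simp [indicator, h1, hg]

lemma expMeasure_singleton (r t : ℝ) : expMeasure r {t} = 0 := by
  have h : expMeasure r = volume.withDensity (exponentialPDF r) := rfl
  rw [h]
  exact withDensity_absolutelyContinuous _ _ (by simp)

lemma expMeasure_Iic_zero (r : ℝ) : expMeasure r (Iic 0) = 0 := by
  rw [← lintegral_indicator_one measurableSet_Iic, lintegral_expMeasure
    (measurable_one.indicator measurableSet_Iic), lintegral_eq_zero_iff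
    (Measurable.indicator (by
      refine Measurable.mul (by fun_prop) (measurable_one.indicator measurableSet_Iic))
      measurableSet_Ici)]
  have : ∀ᵐ g : ℝ, g ≠ 0 := by simp [ae_iff]
  filter_upwards [this] with g hg
  rcases lt_or_gt_of_ne hg with h | h
  · simp [indicator, h]
  · simp [indicator, h]

lemma ae_expMeasure_pos (r : ℝ) : ∀ᵐ g ∂expMeasure r, 0 < g := by
  have := expMeasure_Iic_zero r
  rw [ae_iff]
  convert this using 2
  ext g; simp

lemma lintegral_expMeasure_shift' {r t : ℝ} (ht : 0 ≤ t) {f : ℝ → ℝ≥0∞} (hf : Measurable f) :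
    ∫⁻ g, (Ioi t).indicator (fun g => f (g - t)) g ∂expMeasure r
      = ENNReal.ofReal (Real.exp (-(r * t))) * ∫⁻ g, f g ∂expMeasure r := by
  rw [← lintegral_expMeasure_shift ht hf]
  refine lintegral_congr_ae ?_
  have : ∀ᵐ g ∂expMeasure r, g ≠ t := by
    rw [ae_iff]; simpa using expMeasure_singleton r t
  filter_upwards [this] with g hg
  by_cases h : t < g
  · simp [indicator, h, h.le]
  · have : ¬ t ≤ g := fun h' => h (lt_of_le_of_ne h' (Ne.symm hg))
    simp [indicator, h, this]

lemma expMeasure_Ioi {r t : ℝ} (hr : 0 < r) (ht : 0 ≤ t) :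
    expMeasure r (Ioi t) = ENNReal.ofReal (Real.exp (-(r * t))) := by
  have := isProbabilityMeasure_expMeasure hr
  have h := lintegral_expMeasure_shift' (r := r) ht (f := 1) measurable_one
  simpa [← lintegral_indicator_one measurableSet_Ioi, indicator] using h

/-- Of two independent unit exponential clocks, the one that rings first does so at an
exponential time of rate `2`; it is either clock with probability `1 / 2`, and the residual waiting
time of the other clock is again unit exponential and independent. -/
lemma lintegral_race {F : ℝ → ℝ → ℝ≥0∞} (hF : Measurable (Function.uncurry F)) :
    ∫⁻ s, ∫⁻ g, (Ici s).indicator (fun g => F s (g - s)) g ∂expMeasure 1 ∂expMeasure 1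
      = 2⁻¹ * ∫⁻ s, ∫⁻ g, F s g ∂expMeasure 1 ∂expMeasure 2 := by
  have := isProbabilityMeasure_expMeasure (r := 1) one_pos
  have hG : Measurable fun s => ∫⁻ g, F s g ∂expMeasure 1 := Measurable.lintegral_prod_right' hF
  have h1 : ∫⁻ s, ∫⁻ g, (Ici s).indicator (fun g => F s (g - s)) g ∂expMeasure 1 ∂expMeasure 1
      = ∫⁻ s, ENNReal.ofReal (Real.exp (-(1 * s))) * ∫⁻ g, F s g ∂expMeasure 1 ∂expMeasure 1 := by
    refine lintegral_congr_ae ?_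
    filter_upwards [ae_expMeasure_pos 1] with s hs
    exact lintegral_expMeasure_shift hs.le (hF.comp measurable_prodMk_left)
  rw [h1, lintegral_expMeasure (by fun_prop), lintegral_expMeasure hG, ← lintegral_const_mul _ (by
      refine Measurable.indicator ?_ measurableSet_Ici
      fun_prop)]
  refine lintegral_congr fun s => ?_
  by_cases hs : 0 ≤ s
  · simp only [indicator, mem_Ici, hs, if_true]
    rw [← mul_assoc, ← mul_assoc, ← ENNReal.ofReal_mul (by positivity)]
    congr 1
    have : (2⁻¹ : ℝ≥0∞) = ENNReal.ofReal 2⁻¹ := by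
      rw [ENNReal.ofReal_inv_of_pos two_pos]; simp
    rw [this, ← ENNReal.ofReal_mul (by positivity)]
    congr 1
    rw [one_mul, one_mul, ← Real.exp_add, ← mul_assoc]
    ring_nf
  · simp [indicator, hs]

lemma lintegral_race' {F : ℝ → ℝ → ℝ≥0∞} (hF : Measurable (Function.uncurry F)) :
    ∫⁻ s, ∫⁻ g, (Ioi s).indicator (fun g => F s (g - s)) g ∂expMeasure 1 ∂expMeasure 1
      = 2⁻¹ * ∫⁻ s, ∫⁻ g, F s g ∂expMeasure 1 ∂expMeasure 2 := by
  rw [← lintegral_race hF]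
  refine lintegral_congr_ae ?_
  filter_upwards [ae_expMeasure_pos 1] with s hs
  have hs' : Measurable (F s) := hF.comp measurable_prodMk_left
  rw [lintegral_expMeasure_shift hs.le hs', lintegral_expMeasure_shift' hs.le hs']

end Exponential

/-! ### The first of two independent streams -/

section Race

variable {νw νl : Measure ℝ} [IsProbabilityMeasure νw] [IsProbabilityMeasure νl]

instance : IsProbabilityMeasure (expMeasure 1) := isProbabilityMeasure_expMeasure one_pos

instance : IsProbabilityMeasure (expMeasure 2) := isProbabilityMeasure_expMeasure two_pos

/-- The relation `R` decides a race of two independent unit exponential clocks in favour of the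
first one. Both `≤` and `<` do. -/
structure DecidesRace (R : ℝ → ℝ → Prop) : Prop where
  measurableSet : MeasurableSet {z : ℝ × ℝ | R z.1 z.2}
  lintegral_eq : ∀ F : ℝ → ℝ → ℝ≥0∞, Measurable (Function.uncurry F) →
    ∫⁻ s, ∫⁻ g, {z : ℝ × ℝ | R z.1 z.2}.indicator (fun z => F z.1 (z.2 - z.1)) (s, g)
      ∂expMeasure 1 ∂expMeasure 1 = 2⁻¹ * ∫⁻ s, ∫⁻ g, F s g ∂expMeasure 1 ∂expMeasure 2

lemma decidesRace_le : DecidesRace (· ≤ ·) where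
  measurableSet := measurableSet_le measurable_fst measurable_snd
  lintegral_eq F hF := by rw [← lintegral_race hF]; rfl

lemma decidesRace_lt : DecidesRace (· < ·) where
  measurableSet := measurableSet_lt measurable_fst measurable_snd
  lintegral_eq F hF := by rw [← lintegral_race' hF]; rfl

lemma DecidesRace.lintegral_marked {R : ℝ → ℝ → Prop} (hR : DecidesRace R)
    {k : ℝ × ℝ → ℝ × ℝ → ℝ≥0∞} (hk : Measurable (Function.uncurry k)) :
    ∫⁻ zw, ∫⁻ zl, {z : ℝ × ℝ | R z.1 z.2}.indicator (fun _ => k zw (zl.1 - zw.1, zl.2))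
        (zw.1, zl.1) ∂((expMeasure 1).prod νl) ∂((expMeasure 1).prod νw)
      = 2⁻¹ * ∫⁻ s, ∫⁻ p, ∫⁻ zl, k (s, p) zl ∂((expMeasure 1).prod νl) ∂νw ∂expMeasure 2 := by
  have hk' : ∀ {α : Type} [MeasurableSpace α] {f g : α → ℝ × ℝ}, Measurable f → Measurable g →
      Measurable fun z => k (f z) (g z) := fun hf hg => hk.comp (hf.prodMk hg)
  have hind : ∀ {α : Type} [MeasurableSpace α] {f g : α → ℝ} {h : α → ℝ≥0∞}, Measurable f →
      Measurable g → Measurable h →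
      Measurable fun z => {z : ℝ × ℝ | R z.1 z.2}.indicator (fun _ => h z) (f z, g z) := by
    intro α _ f g h hf hg hh
    exact Measurable.indicator (s := {z | R (f z) (g z)}) hh ((hf.prodMk hg) hR.measurableSet)
  let F : ℝ → ℝ → ℝ≥0∞ := fun s g => ∫⁻ pw, ∫⁻ pl, k (s, pw) (g, pl) ∂νl ∂νw
  have hF : Measurable (Function.uncurry F) := by
    refine Measurable.lintegral_prod_right' (f := fun z : (ℝ × ℝ) × ℝ =>
      ∫⁻ pl, k (z.1.1, z.2) (z.1.2, pl) ∂νl) ?_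
    refine Measurable.lintegral_prod_right' (f := fun z : ((ℝ × ℝ) × ℝ) × ℝ =>
      k (z.1.1.1, z.1.2) (z.1.1.2, z.2)) (hk' (by fun_prop) (by fun_prop))
  have h1 : ∀ sw pw, ∫⁻ zl, {z : ℝ × ℝ | R z.1 z.2}.indicator
      (fun _ => k (sw, pw) (zl.1 - sw, zl.2)) (sw, zl.1) ∂((expMeasure 1).prod νl)
      = ∫⁻ sl, {z : ℝ × ℝ | R z.1 z.2}.indicator (fun _ =>
        ∫⁻ pl, k (sw, pw) (sl - sw, pl) ∂νl) (sw, sl) ∂expMeasure 1 := by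
    intro sw pw
    rw [lintegral_prod _ (hind (by fun_prop) (by fun_prop)
      (hk' (by fun_prop) (by fun_prop))).aemeasurable]
    refine lintegral_congr fun sl => ?_
    by_cases h : R sw sl <;> simp [indicator, h]
  have h2 : ∀ s, ∫⁻ p, ∫⁻ zl, k (s, p) zl ∂((expMeasure 1).prod νl) ∂νw
      = ∫⁻ g, F s g ∂expMeasure 1 := by
    intro s
    have : ∀ p, ∫⁻ zl, k (s, p) zl ∂((expMeasure 1).prod νl)
        = ∫⁻ g, ∫⁻ pl, k (s, p) (g, pl) ∂νl ∂expMeasure 1 := fun p =>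
      lintegral_prod _ (hk' (by fun_prop) (by fun_prop)).aemeasurable
    simp only [this, F]
    rw [lintegral_lintegral_swap]
    refine Measurable.aemeasurable ?_
    refine Measurable.lintegral_prod_right' (f := fun z : (ℝ × ℝ) × ℝ =>
      k (s, z.1.1) (z.1.2, z.2)) (hk' (by fun_prop) (by fun_prop))
  simp only [h2]
  rw [← hR.lintegral_eq F hF, lintegral_prod]
  · refine lintegral_congr fun sw => ?_
    simp only [h1]
    rw [lintegral_lintegral_swap]
    · refine lintegral_congr fun sl => ?_
      by_cases h : R sw sl <;> simp [indicator, h, F]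
    · refine (hind (by fun_prop) (by fun_prop) ?_).aemeasurable
      exact Measurable.lintegral_prod_right' (f := fun z : (ℝ × ℝ) × ℝ =>
        k (sw, z.1.1) (z.1.2 - sw, z.2)) (hk' (by fun_prop) (by fun_prop))
  · refine Measurable.aemeasurable ?_
    refine Measurable.lintegral_prod_right' (f := fun z : (ℝ × ℝ) × (ℝ × ℝ) =>
      {z : ℝ × ℝ | R z.1 z.2}.indicator (fun _ => k z.1 (z.2.1 - z.1.1, z.2.2)) (z.1.1, z.2.1)) ?_
    exact hind (by fun_prop) (by fun_prop) (hk' (by fun_prop) (by fun_prop))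

/-- A race between two independent marked Poisson streams: the winning order, the remainder of the
winning stream and the remainder of the other stream are independent. -/
lemma DecidesRace.lintegral_streams {R : ℝ → ℝ → Prop} (hR : DecidesRace R)
    {f : ℝ → ℝ → (ℕ → ℝ × ℝ) → (ℕ → ℝ × ℝ) → ℝ≥0∞}
    (hf : Measurable fun z : ((ℝ × ℝ) × (ℕ → ℝ × ℝ)) × (ℕ → ℝ × ℝ) => f z.1.1.1 z.1.1.2 z.1.2 z.2) :
    ∫⁻ u, ∫⁻ v, {z : ℝ × ℝ | R z.1 z.2}.indicator (fun _ => f (u 0).1 (u 0).2 (fun n => u (n + 1))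
        (cons ((v 0).1 - (u 0).1, (v 0).2) fun n => v (n + 1))) ((u 0).1, (v 0).1)
        ∂seqLaw ((expMeasure 1).prod νl) ∂seqLaw ((expMeasure 1).prod νw)
      = 2⁻¹ * ∫⁻ s, ∫⁻ p, ∫⁻ u, ∫⁻ v, f s p u v ∂seqLaw ((expMeasure 1).prod νl)
        ∂seqLaw ((expMeasure 1).prod νw) ∂νw ∂expMeasure 2 := by
  have hf' : ∀ {α : Type} [MeasurableSpace α] {a b : α → ℝ} {u v : α → ℕ → ℝ × ℝ}, Measurable a →
      Measurable b → Measurable u → Measurable v → Measurable fun z => f (a z) (b z) (u z) (v z) :=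
    fun ha hb hu hv => hf.comp (((ha.prodMk hb).prodMk hu).prodMk hv)
  have hind : ∀ {α : Type} [MeasurableSpace α] {f g : α → ℝ} {h : α → ℝ≥0∞}, Measurable f →
      Measurable g → Measurable h →
      Measurable fun z => {z : ℝ × ℝ | R z.1 z.2}.indicator (fun _ => h z) (f z, g z) := by
    intro α _ f g h hf hg hh
    exact Measurable.indicator (s := {z | R (f z) (g z)}) hh ((hf.prodMk hg) hR.measurableSet)
  let k : ℝ × ℝ → ℝ × ℝ → ℝ≥0∞ := fun zw zl => ∫⁻ u, ∫⁻ v, f zw.1 zw.2 u (cons zl v)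
    ∂seqLaw ((expMeasure 1).prod νl) ∂seqLaw ((expMeasure 1).prod νw)
  have hk : Measurable (Function.uncurry k) := by
    refine Measurable.lintegral_prod_right' (f := fun z : ((ℝ × ℝ) × (ℝ × ℝ)) × (ℕ → ℝ × ℝ) =>
      ∫⁻ v, f z.1.1.1 z.1.1.2 z.2 (cons z.1.2 v) ∂seqLaw ((expMeasure 1).prod νl)) ?_
    exact Measurable.lintegral_prod_right' (f :=
      fun z : (((ℝ × ℝ) × (ℝ × ℝ)) × (ℕ → ℝ × ℝ)) × (ℕ → ℝ × ℝ) =>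
      f z.1.1.1.1 z.1.1.1.2 z.1.2 (cons z.1.1.2 z.2))
      (hf' (by fun_prop) (by fun_prop) (by fun_prop) (by fun_prop))
  have h1 : ∀ s p, ∫⁻ u, ∫⁻ v, f s p u v ∂seqLaw ((expMeasure 1).prod νl)
        ∂seqLaw ((expMeasure 1).prod νw) = ∫⁻ zl, k (s, p) zl ∂((expMeasure 1).prod νl) := by
    intro s p
    have : ∀ u, ∫⁻ v, f s p u v ∂seqLaw ((expMeasure 1).prod νl)
        = ∫⁻ zl, ∫⁻ v, f s p u (cons zl v) ∂seqLaw ((expMeasure 1).prod νl)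
          ∂((expMeasure 1).prod νl) := fun u =>
      lintegral_seqLaw (hf' (by fun_prop) (by fun_prop) (by fun_prop) (by fun_prop))
    simp only [this, k]
    rw [lintegral_lintegral_swap]
    refine Measurable.aemeasurable ?_
    exact Measurable.lintegral_prod_right' (f :=
      fun z : ((ℕ → ℝ × ℝ) × (ℝ × ℝ)) × (ℕ → ℝ × ℝ) => f s p z.1.1 (cons z.1.2 z.2))
      (hf' (by fun_prop) (by fun_prop) (by fun_prop) (by fun_prop))
  simp only [h1]
  rw [← hR.lintegral_marked hk, lintegral_seqLaw]
  · refine lintegral_congr fun zw => ?_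
    have : ∀ u, ∫⁻ v, {z : ℝ × ℝ | R z.1 z.2}.indicator
        (fun _ => f (cons zw u 0).1 (cons zw u 0).2 (fun n => cons zw u (n + 1))
          (cons ((v 0).1 - (cons zw u 0).1, (v 0).2) fun n => v (n + 1))) ((cons zw u 0).1, (v 0).1)
        ∂seqLaw ((expMeasure 1).prod νl)
        = ∫⁻ zl, {z : ℝ × ℝ | R z.1 z.2}.indicator (fun _ => ∫⁻ v, f zw.1 zw.2 u
          (cons (zl.1 - zw.1, zl.2) v) ∂seqLaw ((expMeasure 1).prod νl)) (zw.1, zl.1)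
          ∂((expMeasure 1).prod νl) := by
      intro u
      rw [lintegral_seqLaw]
      · refine lintegral_congr fun zl => ?_
        by_cases h : R zw.1 zl.1 <;> simp [indicator, h]
      · exact hind (by fun_prop) (by fun_prop)
          (hf' (by fun_prop) (by fun_prop) (by fun_prop) (by fun_prop))
    simp only [this]
    rw [lintegral_lintegral_swap]
    · refine lintegral_congr fun zl => ?_
      by_cases h : R zw.1 zl.1 <;> simp [indicator, h, k]
    · refine (hind (by fun_prop) (by fun_prop) ?_).aemeasurable
      exact Measurable.lintegral_prod_right' (f :=
        fun z : ((ℕ → ℝ × ℝ) × (ℝ × ℝ)) × (ℕ → ℝ × ℝ) =>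
          f zw.1 zw.2 z.1.1 (cons (z.1.2.1 - zw.1, z.1.2.2) z.2))
        (hf' (by fun_prop) (by fun_prop) (by fun_prop) (by fun_prop))
  · refine Measurable.lintegral_prod_right' (f := fun z : (ℕ → ℝ × ℝ) × (ℕ → ℝ × ℝ) =>
      {z : ℝ × ℝ | R z.1 z.2}.indicator (fun _ => f (z.1 0).1 (z.1 0).2 (fun n => z.1 (n + 1))
        (cons ((z.2 0).1 - (z.1 0).1, (z.2 0).2) fun n => z.2 (n + 1))) ((z.1 0).1, (z.2 0).1)) ?_
    exact hind (by fun_prop) (by fun_prop)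
      (hf' (by fun_prop) (by fun_prop) (by fun_prop) (by fun_prop))

end Race

/-! ### Merging the two streams of arrivals -/

section Merging

instance : MeasurableSpace Side := ⊤

instance : DiscreteMeasurableSpace Side := ⟨fun _ => trivial⟩

instance : Finite Side :=
  Finite.of_injective (fun s : Side => match s with | .bid => true | .ask => false) (by
    intro s t h; cases s <;> cases t <;> simp_all)

/-- The arrivals with given streams of bids and asks. -/
def ofStreams (u v : ℕ → ℝ × ℝ) : Arrivals
  | .bid => u
  | .ask => v

@[simp] lemma ofStreams_bid (u v : ℕ → ℝ × ℝ) : ofStreams u v .bid = u := rfl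

@[simp] lemma ofStreams_ask (u v : ℕ → ℝ × ℝ) : ofStreams u v .ask = v := rfl

@[fun_prop]
lemma _root_.Measurable.ofStreams {α : Type*} [MeasurableSpace α] {u v : α → ℕ → ℝ × ℝ}
    (hu : Measurable u) (hv : Measurable v) : Measurable fun z => ofStreams (u z) (v z) := by
  refine measurable_pi_lambda _ fun s => ?_
  cases s
  exacts [hu, hv]

lemma ofStreams_eta (a : Arrivals) : ofStreams (a .bid) (a .ask) = a := by
  funext s; cases s <;> rfl

/-- The law of the type and the price of an arriving order. -/
noncomputable def markLaw (νb νa : Measure ℝ) : Measure (Side × ℝ) :=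
  (2⁻¹ : ℝ≥0∞) • νb.map (Prod.mk Side.bid) + (2⁻¹ : ℝ≥0∞) • νa.map (Prod.mk Side.ask)

/-- The law of an order of the merged stream: the time elapsed since the previous order, the type
and the price. -/
noncomputable def orderLaw (νb νa : Measure ℝ) : Measure (ℝ × Side × ℝ) :=
  (expMeasure 2).prod (markLaw νb νa)

lemma lintegral_markLaw {νb νa : Measure ℝ} {f : Side × ℝ → ℝ≥0∞} (hf : Measurable f) :
    ∫⁻ m, f m ∂markLaw νb νa
      = 2⁻¹ * ∫⁻ p, f (.bid, p) ∂νb + 2⁻¹ * ∫⁻ p, f (.ask, p) ∂νa := by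
  rw [markLaw, lintegral_add_measure, lintegral_smul_measure, lintegral_smul_measure,
    lintegral_map hf measurable_prodMk_left, lintegral_map hf measurable_prodMk_left]
  rfl

variable {νb νa : Measure ℝ} [IsProbabilityMeasure νb] [IsProbabilityMeasure νa]

instance : IsProbabilityMeasure (markLaw νb νa) where
  measure_univ := by
    have h := lintegral_markLaw (νb := νb) (νa := νa) (f := fun _ => 1) measurable_const
    simpa [ENNReal.inv_two_add_inv_two] using h

instance : IsProbabilityMeasure (orderLaw νb νa) := by unfold orderLaw; infer_instance

omit [IsProbabilityMeasure νb] [IsProbabilityMeasure νa] in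
lemma lintegral_orderLaw [SFinite (markLaw νb νa)] {f : ℝ × Side × ℝ → ℝ≥0∞} (hf : Measurable f) :
    ∫⁻ e, f e ∂orderLaw νb νa = ∫⁻ g, ∫⁻ m, f (g, m) ∂markLaw νb νa ∂expMeasure 2 :=
  lintegral_prod _ hf.aemeasurable

/-- The `k`-th order of the merged stream: the time elapsed since the previous order, the type and
the price. -/
noncomputable def merged (a : Arrivals) (k : ℕ) : ℝ × Side × ℝ :=
  (match k with
    | 0 => orderTime a 0
    | k + 1 => orderTime a (k + 1) - orderTime a k, orderSide a k, orderPrice a k)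

/-- The arrivals as seen from the time of the first order, which is dropped. -/
noncomputable def residual (a : Arrivals) : Arrivals :=
  match nextSide a 0 0 with
  | .bid => ofStreams (fun n => a .bid (n + 1))
      (cons ((a .ask 0).1 - (a .bid 0).1, (a .ask 0).2) fun n => a .ask (n + 1))
  | .ask => ofStreams (cons ((a .bid 0).1 - (a .ask 0).1, (a .bid 0).2) fun n => a .bid (n + 1))
      (fun n => a .ask (n + 1))

lemma sum_range_fst_tail (f : ℕ → ℝ × ℝ) (n : ℕ) :
    ∑ k ∈ Finset.range (n + 1), (f (k + 1)).1
      = ∑ k ∈ Finset.range (n + 2), (f k).1 - (f 0).1 := by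
  rw [Finset.sum_range_succ' _ (n + 1)]; ring

lemma sum_range_fst_cons (f : ℕ → ℝ × ℝ) (g : ℝ) (n : ℕ) :
    ∑ k ∈ Finset.range (n + 1), (cons ((f 0).1 - g, (f 0).2) (fun n => f (n + 1)) k).1
      = ∑ k ∈ Finset.range (n + 1), (f k).1 - g := by
  rw [Finset.sum_range_succ', Finset.sum_range_succ' (fun k => (f k).1)]
  simp; ring

lemma orderTime_zero (a : Arrivals) :
    orderTime a 0 = match nextSide a 0 0 with
      | .bid => (a .bid 0).1
      | .ask => (a .ask 0).1 := by
  simp only [orderTime, orderSide, counts]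
  cases nextSide a 0 0 <;> simp [arrivalTime]

lemma nextSide_residual_bid {a : Arrivals} (h : nextSide a 0 0 = .bid) (i j : ℕ) :
    nextSide (residual a) i j = nextSide a (i + 1) j := by
  have h1 : arrivalTime (residual a) .bid i = arrivalTime a .bid (i + 1) - (a .bid 0).1 := by
    simp only [residual, h]; exact sum_range_fst_tail _ _
  have h2 : arrivalTime (residual a) .ask j = arrivalTime a .ask j - (a .bid 0).1 := by
    simp only [residual, h]; exact sum_range_fst_cons _ _ _
  simp [nextSide, h1, h2]

lemma nextSide_residual_ask {a : Arrivals} (h : nextSide a 0 0 = .ask) (i j : ℕ) :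
    nextSide (residual a) i j = nextSide a i (j + 1) := by
  have h1 : arrivalTime (residual a) .ask j = arrivalTime a .ask (j + 1) - (a .ask 0).1 := by
    simp only [residual, h]; exact sum_range_fst_tail _ _
  have h2 : arrivalTime (residual a) .bid i = arrivalTime a .bid i - (a .ask 0).1 := by
    simp only [residual, h]; exact sum_range_fst_cons _ _ _
  simp [nextSide, h1, h2]

lemma counts_succ_bid {a : Arrivals} (h : nextSide a 0 0 = .bid) (k : ℕ) :
    counts a (k + 1) = ((counts (residual a) k).1 + 1, (counts (residual a) k).2) := by
  induction k with
  | zero => simp [counts, h]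
  | succ k ih =>
    rw [counts, ih, counts]
    simp only
    rw [← nextSide_residual_bid h]
    cases nextSide (residual a) (counts (residual a) k).1 (counts (residual a) k).2 <;> rfl

lemma counts_succ_ask {a : Arrivals} (h : nextSide a 0 0 = .ask) (k : ℕ) :
    counts a (k + 1) = ((counts (residual a) k).1, (counts (residual a) k).2 + 1) := by
  induction k with
  | zero => simp [counts, h]
  | succ k ih =>
    rw [counts, ih, counts]
    simp only
    rw [← nextSide_residual_ask h]
    cases nextSide (residual a) (counts (residual a) k).1 (counts (residual a) k).2 <;> rfl

lemma orderSide_succ (a : Arrivals) (k : ℕ) : orderSide a (k + 1) = orderSide (residual a) k := by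
  cases h : nextSide a 0 0
  · simp only [orderSide, counts_succ_bid h, nextSide_residual_bid h]
  · simp only [orderSide, counts_succ_ask h, nextSide_residual_ask h]

lemma orderPrice_succ (a : Arrivals) (k : ℕ) :
    orderPrice a (k + 1) = orderPrice (residual a) k := by
  simp only [orderPrice, orderSide_succ]
  cases h : nextSide a 0 0
  · simp only [counts_succ_bid h]
    cases orderSide (residual a) k
    · simp [residual, h]
    · have : residual a .ask = cons ((a .ask 0).1 - (a .bid 0).1, (a .ask 0).2)
          fun n => a .ask (n + 1) := by simp [residual, h]
      rw [this]
      cases (counts (residual a) k).2 <;> rfl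
  · simp only [counts_succ_ask h]
    cases orderSide (residual a) k
    · have : residual a .bid = cons ((a .bid 0).1 - (a .ask 0).1, (a .bid 0).2)
          fun n => a .bid (n + 1) := by simp [residual, h]
      rw [this]
      cases (counts (residual a) k).1 <;> rfl
    · simp [residual, h]

lemma orderTime_succ (a : Arrivals) (k : ℕ) :
    orderTime a (k + 1) = orderTime (residual a) k + orderTime a 0 := by
  rw [orderTime_zero]
  simp only [orderTime, orderSide_succ]
  cases h : nextSide a 0 0
  · simp only [counts_succ_bid h]
    cases orderSide (residual a) k
    · simp only [arrivalTime, residual, h, ofStreams_bid]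
      rw [sum_range_fst_tail (a .bid)]; ring
    · simp only [arrivalTime, residual, h, ofStreams_ask]
      rw [sum_range_fst_cons (a .ask)]; ring
  · simp only [counts_succ_ask h]
    cases orderSide (residual a) k
    · simp only [arrivalTime, residual, h, ofStreams_bid]
      rw [sum_range_fst_cons (a .bid)]; ring
    · simp only [arrivalTime, residual, h, ofStreams_ask]
      rw [sum_range_fst_tail (a .ask)]; ring

lemma merged_succ (a : Arrivals) (k : ℕ) : merged a (k + 1) = merged (residual a) k := by
  simp only [merged, orderSide_succ, orderPrice_succ]
  cases k with
  | zero => simp [orderTime_succ a 0]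
  | succ k => simp [orderTime_succ a (k + 1), orderTime_succ a k]

lemma orderTime_eq_sum (a : Arrivals) (k : ℕ) :
    orderTime a k = ∑ i ∈ Finset.range (k + 1), (merged a i).1 := by
  induction k with
  | zero => simp [merged]
  | succ k ih => rw [Finset.sum_range_succ, ← ih]; simp [merged]

lemma measurableSet_nextSide_bid (i j : ℕ) :
    MeasurableSet {a : Arrivals | nextSide a i j = .bid} := by
  have : {a : Arrivals | nextSide a i j = .bid}
      = {a | arrivalTime a .bid i ≤ arrivalTime a .ask j} := by
    ext a; simp [nextSide]
  rw [this]
  unfold arrivalTime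
  exact measurableSet_le (by fun_prop) (by fun_prop)

lemma measurable_nextSide (i j : ℕ) : Measurable fun a : Arrivals => nextSide a i j := by
  refine measurable_to_countable' fun s => ?_
  cases s
  · exact measurableSet_nextSide_bid i j
  · have : (fun a : Arrivals => nextSide a i j) ⁻¹' {Side.ask}
        = {a : Arrivals | nextSide a i j = .bid}ᶜ := by
      ext a; simp only [mem_preimage, mem_singleton_iff, mem_compl_iff, mem_ofPred_eq]
      cases nextSide a i j <;> simp
    rw [this]
    exact (measurableSet_nextSide_bid i j).compl

lemma measurable_side_match {α β : Type*} [MeasurableSpace α] [MeasurableSpace β] {s : α → Side}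
    {f g : α → β} (hs : Measurable s) (hf : Measurable f) (hg : Measurable g) :
    Measurable fun z => match s z with | .bid => f z | .ask => g z := by
  classical
  have h : MeasurableSet {z | s z = .bid} := hs (measurableSet_singleton _)
  have heq : (fun z => match s z with | .bid => f z | .ask => g z)
      = fun z => if s z = .bid then f z else g z := by
    funext z
    split <;> simp_all
  rw [heq]
  exact Measurable.ite h hf hg

lemma measurable_residual : Measurable residual := by
  unfold residual
  exact measurable_side_match (measurable_nextSide 0 0) (by fun_prop) (by fun_prop)

lemma measurable_merged_zero : Measurable fun a => merged a 0 := by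
  have h : ∀ a, merged a 0 = match nextSide a 0 0 with
      | .bid => ((a .bid 0).1, .bid, (a .bid 0).2)
      | .ask => ((a .ask 0).1, .ask, (a .ask 0).2) := by
    intro a
    simp only [merged, orderTime_zero, orderPrice, orderSide, counts]
    cases nextSide a 0 0 <;> rfl
  simp only [h]
  exact measurable_side_match (measurable_nextSide 0 0) (by fun_prop) (by fun_prop)

lemma measurable_merged : Measurable merged := by
  refine measurable_pi_lambda _ fun k => ?_
  induction k with
  | zero => exact measurable_merged_zero
  | succ k ih =>
    simp only [merged_succ]
    exact ih.comp measurable_residual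

variable (νb νa) in
/-- The first order of the merged stream is independent of the residual arrivals, which are
distributed like the original ones. -/
lemma lintegral_merged_residual {f : ℝ × Side × ℝ → Arrivals → ℝ≥0∞}
    (hf : Measurable (Function.uncurry f)) :
    ∫⁻ u, ∫⁻ v, f (merged (ofStreams u v) 0) (residual (ofStreams u v))
        ∂seqLaw ((expMeasure 1).prod νa) ∂seqLaw ((expMeasure 1).prod νb)
      = ∫⁻ e, ∫⁻ u, ∫⁻ v, f e (ofStreams u v) ∂seqLaw ((expMeasure 1).prod νa)
        ∂seqLaw ((expMeasure 1).prod νb) ∂orderLaw νb νa := by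
  have hf' : ∀ {α : Type} [MeasurableSpace α] {a : α → ℝ × Side × ℝ} {b : α → Arrivals},
      Measurable a → Measurable b → Measurable fun z => f (a z) (b z) :=
    fun ha hb => hf.comp (ha.prodMk hb)
  let fb : ℝ → ℝ → (ℕ → ℝ × ℝ) → (ℕ → ℝ × ℝ) → ℝ≥0∞ :=
    fun s p u v => f (s, .bid, p) (ofStreams u v)
  let fa : ℝ → ℝ → (ℕ → ℝ × ℝ) → (ℕ → ℝ × ℝ) → ℝ≥0∞ :=
    fun s p v u => f (s, .ask, p) (ofStreams u v)
  have hb := decidesRace_le.lintegral_streams (νw := νb) (νl := νa) (f := fb)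
    (hf' (by fun_prop) (by fun_prop))
  have ha := decidesRace_lt.lintegral_streams (νw := νa) (νl := νb) (f := fa)
    (hf' (by fun_prop) (by fun_prop))
  let Gb : (ℕ → ℝ × ℝ) → (ℕ → ℝ × ℝ) → ℝ≥0∞ := fun u v =>
    {z : ℝ × ℝ | z.1 ≤ z.2}.indicator (fun _ => fb (u 0).1 (u 0).2 (fun n => u (n + 1))
        (cons ((v 0).1 - (u 0).1, (v 0).2) fun n => v (n + 1))) ((u 0).1, (v 0).1)
  let Ga : (ℕ → ℝ × ℝ) → (ℕ → ℝ × ℝ) → ℝ≥0∞ := fun v u =>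
    {z : ℝ × ℝ | z.1 < z.2}.indicator (fun _ => fa (v 0).1 (v 0).2 (fun n => v (n + 1))
        (cons ((u 0).1 - (v 0).1, (u 0).2) fun n => u (n + 1))) ((v 0).1, (u 0).1)
  have hGb : Measurable fun z : (ℕ → ℝ × ℝ) × (ℕ → ℝ × ℝ) => Gb z.1 z.2 :=
    Measurable.indicator
      (s := {z : (ℕ → ℝ × ℝ) × (ℕ → ℝ × ℝ) | (z.1 0).1 ≤ (z.2 0).1})
      (hf' (by fun_prop) (by fun_prop)) (measurableSet_le (by fun_prop) (by fun_prop))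
  have hGa : Measurable fun z : (ℕ → ℝ × ℝ) × (ℕ → ℝ × ℝ) => Ga z.2 z.1 :=
    Measurable.indicator
      (s := {z : (ℕ → ℝ × ℝ) × (ℕ → ℝ × ℝ) | (z.2 0).1 < (z.1 0).1})
      (hf' (by fun_prop) (by fun_prop)) (measurableSet_lt (by fun_prop) (by fun_prop))
  have key : ∀ u v, f (merged (ofStreams u v) 0) (residual (ofStreams u v)) = Gb u v + Ga v u := by
    intro u v
    by_cases h : (u 0).1 ≤ (v 0).1
    · have hn : nextSide (ofStreams u v) 0 0 = .bid := by simp [nextSide, arrivalTime, h]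
      simp [Gb, Ga, indicator, h, not_lt.2 h, residual, hn, merged, orderTime_zero, orderPrice,
        orderSide, counts, fb]
    · have hn : nextSide (ofStreams u v) 0 0 = .ask := by simp [nextSide, arrivalTime, h]
      simp [Gb, Ga, indicator, h, not_le.1 h, residual, hn, merged, orderTime_zero, orderPrice,
        orderSide, counts, fa]
  have hGb' : ∀ u, Measurable (Gb u) := fun u => hGb.comp measurable_prodMk_left
  have hGbi : Measurable fun u => ∫⁻ v, Gb u v ∂seqLaw ((expMeasure 1).prod νa) :=
    Measurable.lintegral_prod_right' hGb
  simp only [key]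
  simp_rw [lintegral_add_left (hGb' _)]
  rw [lintegral_add_left hGbi, lintegral_lintegral_swap (f := fun u v => Ga v u) hGa.aemeasurable]
  have hout : Measurable fun e : ℝ × Side × ℝ => ∫⁻ u, ∫⁻ v, f e (ofStreams u v)
      ∂seqLaw ((expMeasure 1).prod νa) ∂seqLaw ((expMeasure 1).prod νb) := by
    refine Measurable.lintegral_prod_right' (f := fun z : (ℝ × Side × ℝ) × (ℕ → ℝ × ℝ) =>
      ∫⁻ v, f z.1 (ofStreams z.2 v) ∂seqLaw ((expMeasure 1).prod νa)) ?_
    exact Measurable.lintegral_prod_right' (f :=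
      fun z : ((ℝ × Side × ℝ) × (ℕ → ℝ × ℝ)) × (ℕ → ℝ × ℝ) => f z.1.1 (ofStreams z.1.2 z.2))
      (hf' (by fun_prop) (by fun_prop))
  rw [lintegral_orderLaw hout]
  have hm : ∀ g : ℝ, ∫⁻ m, ∫⁻ u, ∫⁻ v, f (g, m) (ofStreams u v)
        ∂seqLaw ((expMeasure 1).prod νa) ∂seqLaw ((expMeasure 1).prod νb) ∂markLaw νb νa
      = 2⁻¹ * (∫⁻ p, ∫⁻ u, ∫⁻ v, fb g p u v
        ∂seqLaw ((expMeasure 1).prod νa) ∂seqLaw ((expMeasure 1).prod νb) ∂νb)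
      + 2⁻¹ * (∫⁻ p, ∫⁻ v, ∫⁻ u, fa g p v u
        ∂seqLaw ((expMeasure 1).prod νb) ∂seqLaw ((expMeasure 1).prod νa) ∂νa) := by
    intro g
    have hg : Measurable fun m : Side × ℝ => ∫⁻ u, ∫⁻ v, f (g, m) (ofStreams u v)
        ∂seqLaw ((expMeasure 1).prod νa) ∂seqLaw ((expMeasure 1).prod νb) :=
      hout.comp measurable_prodMk_left
    rw [lintegral_markLaw hg]
    congr 2
    refine lintegral_congr fun p => ?_
    rw [lintegral_lintegral_swap]
    exact (hf' (by fun_prop) (by fun_prop)).aemeasurable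
  simp only [hm]
  have hb' : Measurable fun g : ℝ => ∫⁻ p, ∫⁻ u, ∫⁻ v, fb g p u v
      ∂seqLaw ((expMeasure 1).prod νa) ∂seqLaw ((expMeasure 1).prod νb) ∂νb :=
    Measurable.lintegral_prod_right' (f := fun z : ℝ × ℝ => ∫⁻ u, ∫⁻ v, fb z.1 z.2 u v
      ∂seqLaw ((expMeasure 1).prod νa) ∂seqLaw ((expMeasure 1).prod νb))
      (hout.comp (by fun_prop : Measurable fun z : ℝ × ℝ => (z.1, Side.bid, z.2)))
  have ha' : Measurable fun g : ℝ => ∫⁻ p, ∫⁻ v, ∫⁻ u, fa g p v u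
      ∂seqLaw ((expMeasure 1).prod νb) ∂seqLaw ((expMeasure 1).prod νa) ∂νa := by
    refine Measurable.lintegral_prod_right' (f := fun z : ℝ × ℝ => ∫⁻ v, ∫⁻ u, fa z.1 z.2 v u
      ∂seqLaw ((expMeasure 1).prod νb) ∂seqLaw ((expMeasure 1).prod νa)) ?_
    refine Measurable.lintegral_prod_right' (f := fun z : (ℝ × ℝ) × (ℕ → ℝ × ℝ) =>
      ∫⁻ u, fa z.1.1 z.1.2 z.2 u ∂seqLaw ((expMeasure 1).prod νb)) ?_
    exact Measurable.lintegral_prod_right' (f :=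
      fun z : ((ℝ × ℝ) × (ℕ → ℝ × ℝ)) × (ℕ → ℝ × ℝ) => fa z.1.1.1 z.1.1.2 z.1.2 z.2)
      (hf' (by fun_prop) (by fun_prop))
  rw [lintegral_add_left (hb'.const_mul _), lintegral_const_mul _ hb', lintegral_const_mul _ ha']
  exact congrArg₂ (· + ·) hb ha

variable (νb νa) in
/-- The orders of the merged stream are independent and identically distributed. -/
lemma map_merged : ((seqLaw ((expMeasure 1).prod νb)).prod (seqLaw ((expMeasure 1).prod νa))).map
    (fun z => merged (ofStreams z.1 z.2)) = seqLaw (orderLaw νb νa) := by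
  have hmeas : Measurable fun z : (ℕ → ℝ × ℝ) × (ℕ → ℝ × ℝ) => merged (ofStreams z.1 z.2) :=
    measurable_merged.comp (by fun_prop)
  refine eq_seqLaw fun k t ht => ?_
  rw [← lintegral_indicator_one (measurableSet_initialBox k ht),
    lintegral_map (measurable_one.indicator (measurableSet_initialBox k ht)) hmeas,
    lintegral_prod (fun z : (ℕ → ℝ × ℝ) × (ℕ → ℝ × ℝ) =>
      (initialBox k t).indicator 1 (merged (ofStreams z.1 z.2))) ((measurable_one.indicator
      (measurableSet_initialBox k ht)).comp hmeas).aemeasurable]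
  simp only
  induction k generalizing t with
  | zero => simp [initialBox]
  | succ k ih =>
    let f : ℝ × Side × ℝ → Arrivals → ℝ≥0∞ := fun e a => (t 0).indicator 1 e *
      (initialBox k fun i => t (i + 1)).indicator 1 (merged a)
    have hk := measurableSet_initialBox k (t := fun i => t (i + 1)) fun i => ht (i + 1)
    have hf : Measurable (Function.uncurry f) := by
      refine Measurable.mul ?_ ?_
      · exact (measurable_one.indicator (ht 0)).comp measurable_fst
      · exact (measurable_one.indicator hk).comp (measurable_merged.comp measurable_snd)
    have h1 : ∀ a : Arrivals, (initialBox (k + 1) t).indicator 1 (merged a)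
        = f (merged a 0) (residual a) := by
      intro a
      have : merged a = cons (merged a 0) (merged (residual a)) := by
        funext n; cases n
        · rfl
        · exact merged_succ a _
      have hmem : merged a ∈ initialBox (k + 1) t ↔ merged a 0 ∈ t 0 ∧
          merged (residual a) ∈ initialBox k fun i => t (i + 1) := by
        conv_lhs => rw [this]
        exact cons_mem_initialBox
      by_cases h0 : merged a 0 ∈ t 0 <;>
        by_cases h : merged (residual a) ∈ initialBox k fun i => t (i + 1) <;>
        simp [f, indicator, hmem, h0, h]
    simp only [h1]
    rw [lintegral_merged_residual νb νa hf]
    have h2 : ∀ e, ∫⁻ u, ∫⁻ v, f e (ofStreams u v) ∂seqLaw ((expMeasure 1).prod νa)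
        ∂seqLaw ((expMeasure 1).prod νb) = (t 0).indicator 1 e *
          ∏ i ∈ Finset.range k, orderLaw νb νa (t (i + 1)) := by
      intro e
      rw [← ih (fun i => t (i + 1)) fun i => ht (i + 1)]
      by_cases h0 : e ∈ t 0 <;> simp [f, h0]
    simp only [h2]
    rw [lintegral_mul_const _ (measurable_one.indicator (ht 0)), lintegral_indicator_one (ht 0),
      Finset.prod_range_succ', mul_comm]

section Transfer

variable {Ω : Type*} [MeasurableSpace Ω] {μ : Measure Ω} [IsProbabilityMeasure μ] {a : Ω → Arrivals}

omit [IsProbabilityMeasure νb] [IsProbabilityMeasure νa] in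
lemma IsPoissonArrivals.map_streams (ha : IsPoissonArrivals μ νb νa a) :
    μ.map (fun ω => (a ω .bid, a ω .ask))
      = (seqLaw ((expMeasure 1).prod νb)).prod (seqLaw ((expMeasure 1).prod νa)) := by
  have hm : ∀ s, Measurable fun ω => a ω s := fun s =>
    measurable_pi_lambda _ fun n => ha.measurable s n
  have hlaw : ∀ s ν, (∀ n, μ.map (fun ω => a ω s n) = (expMeasure 1).prod ν) →
      μ.map (fun ω => a ω s) = seqLaw ((expMeasure 1).prod ν) := by
    intro s ν hν
    have h := ha.indep.precomp (g := fun n : ℕ => (s, n)) (fun i j hij => by simpa using hij)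
    have h2 := h.map_fun_eq_infinitePi_map (fun n => ha.measurable s n)
    simp only [hν] at h2
    exact h2
  have hind : IndepFun (fun ω => a ω .bid) (fun ω => a ω .ask) μ := by
    have h := indep_iSup_of_disjoint
      (m := fun i : Side × ℕ => MeasurableSpace.comap (fun ω => a ω i.1 i.2) inferInstance)
      (fun i => (ha.measurable i.1 i.2).comap_le) ha.indep.iIndep
      (S := {i | i.1 = .bid}) (T := {i | i.1 = .ask}) (by
        rw [Set.disjoint_left]; rintro ⟨s, n⟩ h1 h2
        simp only [mem_ofPred_eq] at h1 h2
        rw [h1] at h2; cases h2)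
    have hle : ∀ s : Side, MeasurableSpace.comap (fun ω => a ω s) inferInstance
        ≤ ⨆ i ∈ {i : Side × ℕ | i.1 = s},
          MeasurableSpace.comap (fun ω => a ω i.1 i.2) inferInstance := by
      intro s
      simp only [MeasurableSpace.pi, MeasurableSpace.comap_iSup, MeasurableSpace.comap_comp,
        Function.comp_def]
      refine iSup_le fun n => ?_
      exact le_iSup₂ (f := fun (i : Side × ℕ) (_ : i ∈ {i : Side × ℕ | i.1 = s}) =>
        MeasurableSpace.comap (fun ω => a ω i.1 i.2) inferInstance) (s, n) rfl
    rw [IndepFun_iff_Indep]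
    exact indep_of_indep_of_le_left (indep_of_indep_of_le_right h (hle .ask)) (hle .bid)
  rw [(indepFun_iff_map_prod_eq_prod_map_map (hm _).aemeasurable (hm _).aemeasurable).1 hind,
    hlaw _ _ ha.law_bid, hlaw _ _ ha.law_ask]

omit [IsProbabilityMeasure νb] [IsProbabilityMeasure νa] [IsProbabilityMeasure μ] in
lemma IsPoissonArrivals.measurable_merged (ha : IsPoissonArrivals μ νb νa a) :
    Measurable fun ω => merged (a ω) :=
  LimitOrderBook.measurable_merged.comp
    (measurable_pi_lambda _ fun s => measurable_pi_lambda _ fun n => ha.measurable s n)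

lemma IsPoissonArrivals.map_merged (ha : IsPoissonArrivals μ νb νa a) :
    μ.map (fun ω => merged (a ω)) = seqLaw (orderLaw νb νa) := by
  have hm : ∀ s, Measurable fun ω => a ω s := fun s =>
    measurable_pi_lambda _ fun n => ha.measurable s n
  rw [← LimitOrderBook.map_merged, ← ha.map_streams, Measure.map_map]
  · simp only [Function.comp_def, ofStreams_eta]
  · exact LimitOrderBook.measurable_merged.comp (by fun_prop)
  · exact (hm _).prodMk (hm _)

end Transfer

end Merging

/-! ### The dynamics of the orders between the two anchors -/

section InnerDynamics

namespace Book

/-- The price of the lowest ask, `y` if there are no asks. -/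
noncomputable def askLevel (y : ℝ) (L : Book) : ℝ := L.lowestAsk.untopD y

/-- The price of the highest bid, `x` if there are no bids. -/
noncomputable def bidLevel (x : ℝ) (L : Book) : ℝ := L.highestBid.unbotD x

open Classical in
/-- The effect of an arriving order on the orders in `(x, y)`, if infinitely many bids at `x` and
infinitely many asks at `y` are always available. -/
noncomputable def innerStep (x y : ℝ) (L : Book) (m : Side × ℝ) : Book :=
  match m.1 with
  | .bid =>
      if L.askLevel y ≤ m.2 then { bids := L.bids, asks := removeOne L.asks (L.askLevel y) }
      else if x < m.2 then { bids := L.bids + Finsupp.single m.2 1, asks := L.asks } else L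
  | .ask =>
      if m.2 ≤ L.bidLevel x then { bids := removeOne L.bids (L.bidLevel x), asks := L.asks }
      else if m.2 < y then { bids := L.bids, asks := L.asks + Finsupp.single m.2 1 } else L

lemma askLevel_of_asks_eq_zero {y : ℝ} {L : Book} (h : L.asks = 0) : L.askLevel y = y := by
  simp [askLevel, lowestAsk, h]

lemma bidLevel_of_bids_eq_zero {x : ℝ} {L : Book} (h : L.bids = 0) : L.bidLevel x = x := by
  simp [bidLevel, highestBid, h]

lemma askLevel_mem {y : ℝ} {L : Book} (h : L.asks ≠ 0) : L.asks (L.askLevel y) ≠ 0 := by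
  obtain ⟨b, hb⟩ := Finset.min_of_nonempty (Finsupp.support_nonempty_iff.2 h)
  have h1 : L.askLevel y = b := by
    rw [askLevel, lowestAsk, hb]; rfl
  rw [h1]
  exact Finsupp.mem_support_iff.1 (Finset.mem_of_min hb)

lemma bidLevel_mem {x : ℝ} {L : Book} (h : L.bids ≠ 0) : L.bids (L.bidLevel x) ≠ 0 := by
  obtain ⟨b, hb⟩ := Finset.max_of_nonempty (Finsupp.support_nonempty_iff.2 h)
  have h1 : L.bidLevel x = b := by
    rw [bidLevel, highestBid, hb]; rfl
  rw [h1]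
  exact Finsupp.mem_support_iff.1 (Finset.mem_of_max hb)

lemma askLevel_le {y q : ℝ} {L : Book} (h : L.asks q ≠ 0) : L.askLevel y ≤ q := by
  have h0 : L.asks ≠ 0 := by rintro h0; simp [h0] at h
  obtain ⟨b, hb⟩ := Finset.min_of_nonempty (Finsupp.support_nonempty_iff.2 h0)
  have h1 : L.askLevel y = b := by
    rw [askLevel, lowestAsk, hb]; rfl
  rw [h1]
  exact Finset.min_le_of_eq (Finsupp.mem_support_iff.2 h) hb

lemma le_bidLevel {x q : ℝ} {L : Book} (h : L.bids q ≠ 0) : q ≤ L.bidLevel x := by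
  have h0 : L.bids ≠ 0 := by rintro h0; simp [h0] at h
  obtain ⟨b, hb⟩ := Finset.max_of_nonempty (Finsupp.support_nonempty_iff.2 h0)
  have h1 : L.bidLevel x = b := by
    rw [bidLevel, highestBid, hb]; rfl
  rw [h1]
  exact Finset.le_max_of_eq (Finsupp.mem_support_iff.2 h) hb

lemma IsInterior.asks_mem {x y q : ℝ} {L : Book} (hL : L.IsInterior x y) (h : L.asks q ≠ 0) :
    q ∈ Ioo x y := by
  by_contra hq
  exact h (hL.supported q hq).2

lemma IsInterior.bids_mem {x y q : ℝ} {L : Book} (hL : L.IsInterior x y) (h : L.bids q ≠ 0) :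
    q ∈ Ioo x y := by
  by_contra hq
  exact h (hL.supported q hq).1

variable {x y : ℝ}

lemma IsInterior.askLevel_mem_Ioc {L : Book} (hL : L.IsInterior x y) (hxy : x < y) :
    L.askLevel y ∈ Ioc x y := by
  by_cases h : L.asks = 0
  · simp [askLevel_of_asks_eq_zero h, hxy]
  · exact Ioo_subset_Ioc_self (hL.asks_mem (askLevel_mem h))

lemma IsInterior.bidLevel_mem_Ico {L : Book} (hL : L.IsInterior x y) (hxy : x < y) :
    L.bidLevel x ∈ Ico x y := by
  by_cases h : L.bids = 0
  · simp [bidLevel_of_bids_eq_zero h, hxy]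
  · exact Ioo_subset_Ico_self (hL.bids_mem (bidLevel_mem h))

lemma trace_bids_apply (L : Book) (p : ℝ) [Decidable (p ∈ Ioo x y)] :
    (L.trace x y).bids p = if p ∈ Ioo x y then L.bids p else 0 := by
  classical
  simp only [trace, Finsupp.filter_apply]
  congr

lemma trace_asks_apply (L : Book) (p : ℝ) [Decidable (p ∈ Ioo x y)] :
    (L.trace x y).asks p = if p ∈ Ioo x y then L.asks p else 0 := by
  classical
  simp only [trace, Finsupp.filter_apply]
  congr

lemma Anchored.lt_of_asks {L : Book} (hL : L.Anchored x y) {q : ℝ} (hq : L.asks q ≠ 0) : x < q :=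
  hL.uncrossed x q (by simp [hL.bids_left]) hq

lemma Anchored.lt_of_bids {L : Book} (hL : L.Anchored x y) {q : ℝ} (hq : L.bids q ≠ 0) : q < y :=
  hL.uncrossed q y hq (by simp [hL.asks_right])

lemma Anchored.lt {L : Book} (hL : L.Anchored x y) : x < y :=
  hL.lt_of_asks (by simp [hL.asks_right])

lemma Anchored.lowestAsk_eq {L : Book} (hL : L.Anchored x y) :
    L.lowestAsk = ((L.trace x y).askLevel y : ℝ) := by
  classical
  have hlev := hL.trace.askLevel_mem_Ioc hL.lt
  refine le_antisymm ?_ ?_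
  · refine Finset.min_le (Finsupp.mem_support_iff.2 ?_)
    by_cases h : (L.trace x y).asks = 0
    · rw [askLevel_of_asks_eq_zero h, hL.asks_right]; simp
    · have := askLevel_mem (y := y) h
      rw [trace_asks_apply] at this
      split_ifs at this
      · exact this
      · exact absurd rfl this
  · refine Finset.le_min fun q hq => WithTop.coe_le_coe.2 ?_
    rw [Finsupp.mem_support_iff] at hq
    by_cases hqy : q < y
    · refine askLevel_le ?_
      rwa [trace_asks_apply, if_pos ⟨hL.lt_of_asks hq, hqy⟩]
    · exact hlev.2.trans (not_lt.1 hqy)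

lemma Anchored.highestBid_eq {L : Book} (hL : L.Anchored x y) :
    L.highestBid = ((L.trace x y).bidLevel x : ℝ) := by
  classical
  have hlev := hL.trace.bidLevel_mem_Ico hL.lt
  refine le_antisymm ?_ ?_
  · refine Finset.max_le fun q hq => WithBot.coe_le_coe.2 ?_
    rw [Finsupp.mem_support_iff] at hq
    by_cases hqx : x < q
    · refine le_bidLevel ?_
      rwa [trace_bids_apply, if_pos ⟨hqx, hL.lt_of_bids hq⟩]
    · exact (not_lt.1 hqx).trans hlev.1
  · refine Finset.le_max (Finsupp.mem_support_iff.2 ?_)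
    by_cases h : (L.trace x y).bids = 0
    · rw [bidLevel_of_bids_eq_zero h, hL.bids_left]; simp
    · have := bidLevel_mem (x := x) h
      rw [trace_bids_apply] at this
      split_ifs at this
      · exact this
      · exact absurd rfl this

lemma removeOne_apply (m : ℝ →₀ ℕ∞) (q r : ℝ) [Decidable (r = q)] :
    removeOne m q r = if r = q then m q - 1 else m r := by
  classical
  simp [removeOne, Function.update_apply]

/-- The orders in `(x, y)` evolve autonomously: they do not depend on the rest of the book. -/
lemma Anchored.trace_step {L : Book} (hL : L.Anchored x y) (s : Side) (p : ℝ) :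
    (L.step s p).trace x y = (L.trace x y).innerStep x y (s, p) := by
  classical
  cases s with
  | bid =>
    have hlev := hL.trace.askLevel_mem_Ioc hL.lt
    simp only [Book.step, Book.innerStep, hL.lowestAsk_eq, WithTop.coe_le_coe, WithTop.untopD_coe]
    split_ifs with h1 h2
    · ext r
      · simp [trace_bids_apply]
      · simp only [trace_asks_apply, removeOne_apply]
        split_ifs <;> simp_all
    · have hp : p ∈ Ioo x y := ⟨h2, (not_le.1 h1).trans_le hlev.2⟩
      ext r
      · simp only [trace_bids_apply, Finsupp.add_apply, Finsupp.single_apply]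
        split_ifs with h3 h4 h4 <;> simp_all
      · simp [trace_asks_apply]
    · ext r
      · simp only [trace_bids_apply, Finsupp.add_apply, Finsupp.single_apply]
        split_ifs with h3 h4
        · exact absurd (h4 ▸ h3.1) h2
        · simp
        · rfl
      · simp [trace_asks_apply]
  | ask =>
    have hlev := hL.trace.bidLevel_mem_Ico hL.lt
    simp only [Book.step, Book.innerStep, hL.highestBid_eq, WithBot.coe_le_coe, WithBot.unbotD_coe]
    split_ifs with h1 h2
    · ext r
      · simp only [trace_bids_apply, removeOne_apply]
        split_ifs <;> simp_all
      · simp [trace_asks_apply]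
    · have hp : p ∈ Ioo x y := ⟨hlev.1.trans_lt (not_le.1 h1), h2⟩
      ext r
      · simp [trace_bids_apply]
      · simp only [trace_asks_apply, Finsupp.add_apply, Finsupp.single_apply]
        split_ifs with h3 h4 h4 <;> simp_all
    · ext r
      · simp [trace_bids_apply]
      · simp only [trace_asks_apply, Finsupp.add_apply, Finsupp.single_apply]
        split_ifs with h3 h4
        · exact absurd (h4 ▸ h3.2) h2
        · simp
        · rfl

open Classical in
/-- The book with given orders in `(x, y)`, infinitely many bids at `x`, infinitely many asks at `y`
and no other orders. -/
noncomputable def complete (x y : ℝ) (L : Book) : Book where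
  bids := L.bids.update x ⊤
  asks := L.asks.update y ⊤

lemma IsInterior.complete {L : Book} (hL : L.IsInterior x y) (hxy : x < y) :
    (L.complete x y).Anchored x y where
  uncrossed p q hp hq := by
    classical
    simp only [Book.complete, Finsupp.coe_update, Function.update_apply] at hp hq
    split_ifs at hp hq with h1 h2 h2
    · rw [h1, h2]; exact hxy
    · rw [h1]; exact (hL.asks_mem hq).1
    · rw [h2]; exact (hL.bids_mem hp).2
    · exact hL.uncrossed p q hp hq
  bids_left := by simp [Book.complete]
  asks_right := by simp [Book.complete]
  finiteOn p hp := by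
    classical
    simpa [Book.complete, Function.update_apply, hp.1.ne', hp.2.ne] using hL.finiteOn p hp

lemma IsInterior.trace_complete {L : Book} (hL : L.IsInterior x y) :
    (L.complete x y).trace x y = L := by
  classical
  ext r
  · rw [trace_bids_apply]
    split_ifs with h
    · simp [Book.complete, h.1.ne']
    · exact ((hL.supported r h).1).symm
  · rw [trace_asks_apply]
    split_ifs with h
    · simp [Book.complete, h.2.ne]
    · exact ((hL.supported r h).2).symm

lemma IsInterior.innerStep {L : Book} (hL : L.IsInterior x y) (hxy : x < y) (m : Side × ℝ) :
    (L.innerStep x y m).IsInterior x y := by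
  have h := (hL.complete hxy).trace_step m.1 m.2
  rw [hL.trace_complete] at h
  rw [← Prod.mk.eta (p := m), ← h]
  exact ((hL.complete hxy).step _ _).trace

/-- The number of bids. -/
noncomputable def numBids (L : Book) : ℕ∞ := L.bids.sum fun _ k => k

/-- The number of asks. -/
noncomputable def numAsks (L : Book) : ℕ∞ := L.asks.sum fun _ k => k

lemma sum_add_single (m : ℝ →₀ ℕ∞) (q : ℝ) :
    ((m + Finsupp.single q 1).sum fun _ k => k) = (m.sum fun _ k => k) + 1 := by
  rw [Finsupp.sum_add_index' (fun _ => rfl) (fun _ _ _ => rfl), Finsupp.sum_single_index rfl]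

lemma removeOne_add_single {m : ℝ →₀ ℕ∞} {q : ℝ} (h : m q ≠ 0) :
    removeOne m q + Finsupp.single q 1 = m := by
  classical
  ext r
  rw [Finsupp.add_apply, removeOne_apply, Finsupp.single_apply]
  by_cases hr : r = q
  · subst hr
    simp only [if_true]
    exact tsub_add_cancel_of_le (Order.one_le_iff_ne_zero.2 h)
  · simp [hr, Ne.symm hr]

lemma removeOne_of_eq_zero {m : ℝ →₀ ℕ∞} {q : ℝ} (h : m q = 0) : removeOne m q = m := by
  classical
  ext r
  rw [removeOne_apply]
  split_ifs with hr
  · subst hr; simp [h]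
  · rfl

lemma sum_removeOne_add_one {m : ℝ →₀ ℕ∞} {q : ℝ} (h : m q ≠ 0) :
    ((removeOne m q).sum fun _ k => k) + 1 = m.sum fun _ k => k := by
  rw [← sum_add_single, removeOne_add_single h]

lemma sum_removeOne_le (m : ℝ →₀ ℕ∞) (q : ℝ) :
    ((removeOne m q).sum fun _ k => k) ≤ m.sum fun _ k => k := by
  by_cases h : m q = 0
  · rw [removeOne_of_eq_zero h]
  · rw [← sum_removeOne_add_one h]; exact le_self_add

end Book

/-- A pair of random walks reflected at `0` which bounds the numbers of bids and of asks in
`(x, y)`. The first component counts a bid in `(x, y)` as a step up and an ask at or below `x` as a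
step down, the second one an ask in `(x, y)` as a step up and a bid at or above `y` as a step
down. -/
noncomputable def walkStep (x y : ℝ) (q : ℕ × ℕ) (m : Side × ℝ) : ℕ × ℕ :=
  match m.1 with
  | .bid => if y ≤ m.2 then (q.1, q.2 - 1) else if x < m.2 then (q.1 + 1, q.2) else q
  | .ask => if m.2 ≤ x then (q.1 - 1, q.2) else if m.2 < y then (q.1, q.2 + 1) else q

/-- `q` bounds the numbers of bids and of asks. -/
def Book.Dominated (L : Book) (q : ℕ × ℕ) : Prop := L.numBids ≤ q.1 ∧ L.numAsks ≤ q.2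

lemma Book.Dominated.innerStep {x y : ℝ} {L : Book} (hL : L.IsInterior x y) (hxy : x < y)
    {q : ℕ × ℕ} (h : L.Dominated q) (m : Side × ℝ) :
    (L.innerStep x y m).Dominated (walkStep x y q m) := by
  obtain ⟨s, p⟩ := m
  have hα := hL.askLevel_mem_Ioc hxy
  have hβ := hL.bidLevel_mem_Ico hxy
  have key : ∀ {m : ℝ →₀ ℕ∞} {r : ℝ} {n : ℕ}, (m ≠ 0 → m r ≠ 0) →
      (m.sum fun _ k => k) ≤ (n : ℕ∞) →
      ((removeOne m r).sum fun _ k => k) ≤ ((n - 1 : ℕ) : ℕ∞) := by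
    intro m r n hr hn
    by_cases h0 : m = 0
    · subst h0
      rw [removeOne_of_eq_zero (by simp)]
      simp
    · rw [← sum_removeOne_add_one (hr h0)] at hn
      rw [ENat.natCast_sub]
      exact ENat.le_sub_of_add_le_right (by simp) hn
  obtain ⟨h1, h2⟩ := h
  cases s with
  | bid =>
    simp only [Book.innerStep, walkStep]
    split_ifs with c1 c2 c3 c4 c5 c6
    · exact ⟨h1, key Book.askLevel_mem h2⟩
    · exact ⟨h1.trans (by simp), (sum_removeOne_le _ _).trans h2⟩
    · exact ⟨h1, (sum_removeOne_le _ _).trans h2⟩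
    · exact absurd (hα.2.trans c5) c1
    · refine ⟨?_, h2⟩
      change ((L.bids + Finsupp.single p 1).sum fun _ k => k) ≤ _
      rw [sum_add_single]
      push_cast
      gcongr
      exact h1
    · exact absurd (hα.2.trans ‹_›) c1
    · exact ⟨h1, h2⟩
  | ask =>
    simp only [Book.innerStep, walkStep]
    split_ifs with c1 c2 c3 c4 c5 c6
    · exact ⟨key Book.bidLevel_mem h1, h2⟩
    · exact ⟨(sum_removeOne_le _ _).trans h1, h2.trans (by simp)⟩
    · exact ⟨(sum_removeOne_le _ _).trans h1, h2⟩
    · exact absurd (c5.trans hβ.1) c1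
    · refine ⟨h1, ?_⟩
      change ((L.asks + Finsupp.single p 1).sum fun _ k => k) ≤ _
      rw [sum_add_single]
      push_cast
      gcongr
      exact h2
    · exact absurd (LE.le.trans ‹_› hβ.1) c1
    · exact ⟨h1, h2⟩

lemma eq_zero_of_sum_le_zero {m : ℝ →₀ ℕ∞} (h : (m.sum fun _ k => k) ≤ 0) : m = 0 := by
  have h0 : (m.sum fun _ k => k) = 0 := le_antisymm h bot_le
  rw [Finsupp.sum, Finset.sum_eq_zero_iff] at h0
  ext r
  by_cases hr : r ∈ m.support
  · simp [h0 r hr]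
  · simpa using hr

lemma exists_sum_le {m : ℝ →₀ ℕ∞} (h : ∀ p, m p ≠ ⊤) : ∃ n : ℕ, (m.sum fun _ k => k) ≤ n := by
  refine ⟨∑ p ∈ m.support, (m p).toNat, ?_⟩
  rw [Finsupp.sum, Nat.cast_sum]
  exact Finset.sum_le_sum fun p _ => (ENat.natCast_toNat (h p)).ge

section State

variable {x y : ℝ}

/-- The effect of an arriving order on the orders in `(x, y)`. -/
noncomputable def State.step (hxy : x < y) (s : State x y) (m : Side × ℝ) : State x y :=
  ⟨s.1.innerStep x y m, s.2.innerStep hxy m⟩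

/-- The state without orders in `(x, y)`. -/
def State.empty (x y : ℝ) : State x y :=
  ⟨⟨0, 0⟩, ⟨fun p q hp => absurd rfl hp, fun p _ => ⟨by simp, by simp⟩, fun p _ => ⟨rfl, rfl⟩⟩⟩

lemma State.eq_empty_of_dominated {s : State x y} (h : s.1.Dominated (0, 0)) :
    s = State.empty x y := by
  obtain ⟨h1, h2⟩ := h
  refine Subtype.ext (Book.ext ?_ ?_)
  · exact eq_zero_of_sum_le_zero (by simpa [Book.numBids] using h1)
  · exact eq_zero_of_sum_le_zero (by simpa [Book.numAsks] using h2)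

lemma State.exists_dominated (s : State x y) : ∃ q, s.1.Dominated q := by
  have hfin : ∀ p, s.1.bids p ≠ ⊤ ∧ s.1.asks p ≠ ⊤ := by
    intro p
    by_cases hp : p ∈ Ioo x y
    · exact s.2.finiteOn p hp
    · simp [s.2.supported p hp]
  obtain ⟨i, hi⟩ := exists_sum_le fun p => (hfin p).1
  obtain ⟨j, hj⟩ := exists_sum_le fun p => (hfin p).2
  exact ⟨(i, j), hi, hj⟩

lemma State.empty_dominated (q : ℕ × ℕ) : (State.empty x y).1.Dominated q := by
  constructor <;> simp [State.empty, Book.numBids, Book.numAsks]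

lemma AnchoredBook.state_surjective (hxy : x < y) :
    Function.Surjective fun L : AnchoredBook x y => L.state := fun s =>
  ⟨⟨s.1.complete x y, s.2.complete hxy⟩, Subtype.ext s.2.trace_complete⟩

lemma bookAfter_succ_state (hxy : x < y) (a : Arrivals) (L : AnchoredBook x y) (k : ℕ) :
    (bookAfter a L (k + 1)).state
      = (bookAfter a L k).state.step hxy (orderSide a k, orderPrice a k) :=
  Subtype.ext ((bookAfter a L k).2.trace_step _ _)

/-! ### Measurability of the dynamics -/

lemma countingMeasure_eq_sum (m : ℝ →₀ ℕ∞) :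
    countingMeasure m = m.sum fun p k => ((k : ℕ∞) : ℝ≥0∞) • Measure.dirac p := rfl

lemma countingMeasure_add_single (m : ℝ →₀ ℕ∞) (q : ℝ) :
    countingMeasure (m + Finsupp.single q 1) = countingMeasure m + Measure.dirac q := by
  simp only [countingMeasure_eq_sum]
  rw [Finsupp.sum_add_index' (by simp) (by simp [add_smul]), Finsupp.sum_single_index (by simp)]
  simp

lemma countingMeasure_removeOne {m : ℝ →₀ ℕ∞} {q : ℝ} (h : m q ≠ 0) (B : Set ℝ) :
    countingMeasure (Book.removeOne m q) B = countingMeasure m B - Measure.dirac q B := by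
  have h1 : countingMeasure m B = countingMeasure (Book.removeOne m q) B + Measure.dirac q B := by
    conv_lhs => rw [← Book.removeOne_add_single h, countingMeasure_add_single]
    rfl
  rw [h1, ENNReal.add_sub_cancel_right (measure_ne_top _ _)]

lemma countingMeasure_eq_zero_iff {m : ℝ →₀ ℕ∞} {B : Set ℝ} (hB : MeasurableSet B) :
    countingMeasure m B = 0 ↔ ∀ p ∈ B, m p = 0 := by
  simp only [countingMeasure, Measure.coe_finsetSum, Finset.sum_apply, Measure.smul_apply,
    Measure.dirac_apply' _ hB, smul_eq_mul, Finset.sum_eq_zero_iff]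
  constructor
  · intro h p hp
    by_contra h0
    have := h p (Finsupp.mem_support_iff.2 h0)
    simp [hp, h0] at this
  · intro h p _
    by_cases hp : p ∈ B
    · simp [h p hp]
    · simp [hp]

lemma measurable_book_iff {α : Type*} [MeasurableSpace α] {f : α → Book} :
    Measurable f ↔ ∀ B, MeasurableSet B → (Measurable fun z => countingMeasure (f z).bids B) ∧
      Measurable fun z => countingMeasure (f z).asks B := by
  have h : Measurable f ↔ Measurable fun z =>
      (countingMeasure (f z).bids, countingMeasure (f z).asks) := by
    rw [measurable_iff_comap_le, measurable_iff_comap_le]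
    simp only [instMeasurableSpaceBook, MeasurableSpace.comap_comp]
    rfl
  rw [h]
  constructor
  · intro h B hB
    exact ⟨(Measure.measurable_coe hB).comp (measurable_fst.comp h),
      (Measure.measurable_coe hB).comp (measurable_snd.comp h)⟩
  · intro h
    exact (Measure.measurable_of_measurable_coe _ fun B hB => (h B hB).1).prodMk
      (Measure.measurable_of_measurable_coe _ fun B hB => (h B hB).2)

lemma measurable_countingMeasure_bids {B : Set ℝ} (hB : MeasurableSet B) :
    Measurable fun L : Book => countingMeasure L.bids B :=
  (measurable_book_iff.1 measurable_id B hB).1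

lemma measurable_countingMeasure_asks {B : Set ℝ} (hB : MeasurableSet B) :
    Measurable fun L : Book => countingMeasure L.asks B :=
  (measurable_book_iff.1 measurable_id B hB).2

lemma measurable_askLevel : Measurable fun s : State x y => s.1.askLevel y := by
  refine measurable_of_Iic fun c => ?_
  by_cases hc : y ≤ c
  · convert MeasurableSet.univ
    ext s
    simp only [mem_preimage, mem_Iic, mem_univ, iff_true]
    by_cases h : s.1.asks = 0
    · rwa [Book.askLevel_of_asks_eq_zero h]
    · exact (s.2.asks_mem (Book.askLevel_mem h)).2.le.trans hc
  · have : (fun s : State x y => s.1.askLevel y) ⁻¹' Iic c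
        = {s | countingMeasure s.1.asks (Iic c) = 0}ᶜ := by
      ext s
      simp only [mem_preimage, mem_Iic, mem_compl_iff, mem_ofPred_eq,
        countingMeasure_eq_zero_iff measurableSet_Iic]
      push Not
      constructor
      · intro h
        refine ⟨_, h, Book.askLevel_mem fun h0 => hc ?_⟩
        rwa [Book.askLevel_of_asks_eq_zero h0] at h
      · rintro ⟨q, hq, h⟩
        exact (Book.askLevel_le h).trans hq
    rw [this]
    exact (measurableSet_eq_fun ((measurable_countingMeasure_asks measurableSet_Iic).comp
      measurable_subtype_coe) measurable_const).compl

lemma measurable_bidLevel : Measurable fun s : State x y => s.1.bidLevel x := by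
  refine measurable_of_Ici fun c => ?_
  by_cases hc : c ≤ x
  · convert MeasurableSet.univ
    ext s
    simp only [mem_preimage, mem_Ici, mem_univ, iff_true]
    by_cases h : s.1.bids = 0
    · rwa [Book.bidLevel_of_bids_eq_zero h]
    · exact hc.trans (s.2.bids_mem (Book.bidLevel_mem h)).1.le
  · have : (fun s : State x y => s.1.bidLevel x) ⁻¹' Ici c
        = {s | countingMeasure s.1.bids (Ici c) = 0}ᶜ := by
      ext s
      simp only [mem_preimage, mem_Ici, mem_compl_iff, mem_ofPred_eq,
        countingMeasure_eq_zero_iff measurableSet_Ici]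
      push Not
      constructor
      · intro h
        refine ⟨_, h, Book.bidLevel_mem fun h0 => hc ?_⟩
        rwa [Book.bidLevel_of_bids_eq_zero h0] at h
      · rintro ⟨q, hq, h⟩
        exact le_trans hq (Book.le_bidLevel h)
    rw [this]
    exact (measurableSet_eq_fun ((measurable_countingMeasure_bids measurableSet_Ici).comp
      measurable_subtype_coe) measurable_const).compl

lemma measurableSet_empty_state : MeasurableSet {State.empty x y} := by
  have : {State.empty x y} = {s : State x y | countingMeasure s.1.bids univ = 0} ∩
      {s : State x y | countingMeasure s.1.asks univ = 0} := by
    ext s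
    simp only [mem_singleton_iff, mem_inter_iff, mem_ofPred_eq,
      countingMeasure_eq_zero_iff MeasurableSet.univ, mem_univ, true_implies]
    constructor
    · rintro rfl
      simp [State.empty]
    · rintro ⟨h1, h2⟩
      exact Subtype.ext (Book.ext (Finsupp.ext h1) (Finsupp.ext h2))
  rw [this]
  exact (measurableSet_eq_fun ((measurable_countingMeasure_bids .univ).comp
      measurable_subtype_coe) measurable_const).inter
    (measurableSet_eq_fun ((measurable_countingMeasure_asks .univ).comp
      measurable_subtype_coe) measurable_const)

lemma State.countingMeasure_removeOne_asks (s : State x y) (B : Set ℝ) :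
    countingMeasure (Book.removeOne s.1.asks (s.1.askLevel y)) B =
      if s.1.askLevel y < y then countingMeasure s.1.asks B - Measure.dirac (s.1.askLevel y) B
      else countingMeasure s.1.asks B := by
  split_ifs with h
  · refine countingMeasure_removeOne (Book.askLevel_mem fun h0 => ?_) B
    rw [Book.askLevel_of_asks_eq_zero h0] at h
    exact lt_irrefl _ h
  · rw [Book.removeOne_of_eq_zero (s.2.supported _ fun h' => h h'.2).2]

lemma State.countingMeasure_removeOne_bids (s : State x y) (B : Set ℝ) :
    countingMeasure (Book.removeOne s.1.bids (s.1.bidLevel x)) B =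
      if x < s.1.bidLevel x then countingMeasure s.1.bids B - Measure.dirac (s.1.bidLevel x) B
      else countingMeasure s.1.bids B := by
  split_ifs with h
  · refine countingMeasure_removeOne (Book.bidLevel_mem fun h0 => ?_) B
    rw [Book.bidLevel_of_bids_eq_zero h0] at h
    exact lt_irrefl _ h
  · rw [Book.removeOne_of_eq_zero (s.2.supported _ fun h' => h h'.1).1]

lemma State.measurable_step (hxy : x < y) :
    Measurable fun z : State x y × (Side × ℝ) => z.1.step hxy z.2 := by
  classical
  refine Measurable.subtype_mk (measurable_book_iff.2 fun B hB => ?_)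
  have hb : Measurable fun z : State x y × (Side × ℝ) => countingMeasure z.1.1.bids B :=
    (measurable_countingMeasure_bids hB).comp (measurable_subtype_coe.comp measurable_fst)
  have ha : Measurable fun z : State x y × (Side × ℝ) => countingMeasure z.1.1.asks B :=
    (measurable_countingMeasure_asks hB).comp (measurable_subtype_coe.comp measurable_fst)
  have hα : Measurable fun z : State x y × (Side × ℝ) => z.1.1.askLevel y :=
    measurable_askLevel.comp measurable_fst
  have hβ : Measurable fun z : State x y × (Side × ℝ) => z.1.1.bidLevel x :=
    measurable_bidLevel.comp measurable_fst
  have hp : Measurable fun z : State x y × (Side × ℝ) => z.2.2 := by fun_prop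
  have hs : Measurable fun z : State x y × (Side × ℝ) => z.2.1 := by fun_prop
  have hdir : ∀ {f : State x y × (Side × ℝ) → ℝ}, Measurable f →
      Measurable fun z => Measure.dirac (f z) B := by
    intro f hf
    simp only [Measure.dirac_apply' _ hB]
    exact (measurable_one.indicator hB).comp hf
  have mα := measurableSet_le hα hp
  have mβ := measurableSet_le hp hβ
  have mx := measurableSet_lt measurable_const hp (f := fun _ => x)
  have my := measurableSet_lt hp measurable_const (g := fun _ => y)
  constructor
  · have heq : (fun z : State x y × (Side × ℝ) => countingMeasure (z.1.1.innerStep x y z.2).bids B)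
        = fun z => match z.2.1 with
          | .bid => if z.1.1.askLevel y ≤ z.2.2 then countingMeasure z.1.1.bids B
              else if x < z.2.2 then countingMeasure z.1.1.bids B + Measure.dirac z.2.2 B
              else countingMeasure z.1.1.bids B
          | .ask => if z.2.2 ≤ z.1.1.bidLevel x then
                if x < z.1.1.bidLevel x then
                  countingMeasure z.1.1.bids B - Measure.dirac (z.1.1.bidLevel x) B
                else countingMeasure z.1.1.bids B
              else countingMeasure z.1.1.bids B := by
      funext ⟨s, sd, p⟩
      cases sd
      · simp only [Book.innerStep]
        split_ifs <;> simp [countingMeasure_add_single]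
      · simp only [Book.innerStep, ← State.countingMeasure_removeOne_bids]
        split_ifs <;> rfl
    rw [heq]
    exact measurable_side_match hs (.ite mα hb (.ite mx (hb.add (hdir hp)) hb))
      (.ite mβ (.ite (measurableSet_lt measurable_const hβ) (hb.sub (hdir hβ)) hb) hb)
  · have heq : (fun z : State x y × (Side × ℝ) => countingMeasure (z.1.1.innerStep x y z.2).asks B)
        = fun z => match z.2.1 with
          | .bid => if z.1.1.askLevel y ≤ z.2.2 then
                if z.1.1.askLevel y < y then
                  countingMeasure z.1.1.asks B - Measure.dirac (z.1.1.askLevel y) B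
                else countingMeasure z.1.1.asks B
              else countingMeasure z.1.1.asks B
          | .ask => if z.2.2 ≤ z.1.1.bidLevel x then countingMeasure z.1.1.asks B
              else if z.2.2 < y then countingMeasure z.1.1.asks B + Measure.dirac z.2.2 B
              else countingMeasure z.1.1.asks B := by
      funext ⟨s, sd, p⟩
      cases sd
      · simp only [Book.innerStep, ← State.countingMeasure_removeOne_asks]
        split_ifs <;> rfl
      · simp only [Book.innerStep]
        split_ifs <;> simp [countingMeasure_add_single]
    rw [heq]
    exact measurable_side_match hs
      (.ite mα (.ite (measurableSet_lt hα measurable_const) (ha.sub (hdir hα)) ha) ha)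
      (.ite mβ ha (.ite my (ha.add (hdir hp)) ha))

end State

end InnerDynamics

/-! ### Chains driven by a marked Poisson process -/

section MarkedPoisson

variable {S M : Type*}

/-- The state after `n` steps of a chain which starts at `s` and is driven by the marks `(w k).2`. -/
def chain (step : S → M → S) (s : S) (w : ℕ → ℝ × M) : ℕ → S
  | 0 => s
  | n + 1 => step (chain step s w n) (w n).2

/-- The time of the `n`-th jump, the jumps being counted from `1`, if `(w k).1` are the times
between consecutive jumps. -/
noncomputable def jumpTime (w : ℕ → ℝ × M) (n : ℕ) : ℝ := ∑ i ∈ Finset.range n, (w i).1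

/-- The number of jumps up to time `t` (the junk value `0` if there are infinitely many). -/
noncomputable def numJumps (w : ℕ → ℝ × M) (t : ℝ) : ℕ := {k : ℕ | jumpTime w (k + 1) ≤ t}.ncard

/-- The state at time `t`. -/
noncomputable def process (step : S → M → S) (s : S) (w : ℕ → ℝ × M) (t : ℝ) : S :=
  chain step s w (numJumps w t)

/-- There have been exactly `n` jumps up to time `t`. -/
def between (n : ℕ) (t : ℝ) : Set (ℕ → ℝ × M) := {w | jumpTime w n ≤ t ∧ t < jumpTime w (n + 1)}

/-- The waiting times and marks as seen from time `t`, if there have been `n` jumps up to then. -/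
noncomputable def shift (n : ℕ) (t : ℝ) (w : ℕ → ℝ × M) : ℕ → ℝ × M :=
  cons (jumpTime w (n + 1) - t, (w n).2) fun k => w (n + 1 + k)

/-- All waiting times are positive. -/
def Positive (w : ℕ → ℝ × M) : Prop := ∀ n, 0 < (w n).1

/-- All waiting times are positive, and infinitely many of them exceed `1`. -/
def Regular (w : ℕ → ℝ × M) : Prop := Positive w ∧ ∃ᶠ n in Filter.atTop, 1 < (w n).1

section Pathwise

variable {step : S → M → S} {s : S} {w : ℕ → ℝ × M} {n m : ℕ} {t u : ℝ}

lemma chain_cons (step : S → M → S) (s : S) (e : ℝ × M) (w : ℕ → ℝ × M) (n : ℕ) :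
    chain step s (cons e w) (n + 1) = chain step (step s e.2) w n := by
  induction n with
  | zero => rfl
  | succ n ih => rw [chain, ih]; rfl

lemma chain_congr {w' : ℕ → ℝ × M} (h : ∀ i < n, w i = w' i) :
    chain step s w n = chain step s w' n := by
  induction n with
  | zero => rfl
  | succ n ih => rw [chain, chain, ih fun i hi => h i (by omega), h n (by omega)]

@[simp] lemma jumpTime_zero (w : ℕ → ℝ × M) : jumpTime w 0 = 0 := rfl

lemma jumpTime_succ (w : ℕ → ℝ × M) (n : ℕ) : jumpTime w (n + 1) = jumpTime w n + (w n).1 :=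
  Finset.sum_range_succ _ _

lemma jumpTime_cons_succ (e : ℝ × M) (w : ℕ → ℝ × M) (n : ℕ) :
    jumpTime (cons e w) (n + 1) = e.1 + jumpTime w n := by
  rw [jumpTime, Finset.sum_range_succ', add_comm]; rfl

lemma jumpTime_congr {w' : ℕ → ℝ × M} (h : ∀ i < n, w i = w' i) : jumpTime w n = jumpTime w' n :=
  Finset.sum_congr rfl fun i hi => by rw [h i (Finset.mem_range.1 hi)]

lemma cons_mem_between_succ {e : ℝ × M} :
    cons e w ∈ between (n + 1) t ↔ w ∈ between n (t - e.1) := by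
  simp only [between, mem_ofPred_eq, jumpTime_cons_succ]
  constructor <;> rintro ⟨h1, h2⟩ <;> constructor <;> linarith

lemma mem_between_zero : w ∈ between 0 t ↔ 0 ≤ t ∧ t < (w 0).1 := by
  simp [between, jumpTime_succ]

lemma shift_cons_succ (n : ℕ) (t : ℝ) (e : ℝ × M) (w : ℕ → ℝ × M) :
    shift (n + 1) t (cons e w) = shift n (t - e.1) w := by
  have h1 : jumpTime (cons e w) (n + 1 + 1) - t = jumpTime w (n + 1) - (t - e.1) := by
    rw [jumpTime_cons_succ]; ring
  have h2 : ∀ k, cons e w (n + 1 + 1 + k) = w (n + 1 + k) := fun k => by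
    rw [show n + 1 + 1 + k = (n + 1 + k) + 1 by omega]; rfl
  simp only [shift, h1, h2, cons_succ]

lemma shift_zero_cons (t : ℝ) (e : ℝ × M) (w : ℕ → ℝ × M) :
    shift 0 t (cons e w) = cons (e.1 - t, e.2) w := by
  have h2 : ∀ k, cons e w (0 + 1 + k) = w k := fun k => by
    rw [show 0 + 1 + k = k + 1 by omega]; rfl
  simp [shift, jumpTime_succ, h2]

lemma Positive.strictMono_jumpTime (hw : Positive w) : StrictMono (jumpTime w) :=
  strictMono_nat_of_lt_succ fun n => by rw [jumpTime_succ]; linarith [hw n]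

lemma Positive.cons {e : ℝ × M} (he : 0 < e.1) (hw : Positive w) : Positive (cons e w) := by
  intro n
  cases n
  exacts [he, hw _]

lemma Positive.setOf_jumpTime_le (hw : Positive w) (h : w ∈ between n t) :
    {k : ℕ | jumpTime w (k + 1) ≤ t} = Iio n := by
  ext k
  simp only [mem_ofPred_eq, mem_Iio]
  constructor
  · intro hk
    have := hw.strictMono_jumpTime.lt_iff_lt.1 (hk.trans_lt h.2)
    omega
  · intro hk
    exact (hw.strictMono_jumpTime.monotone (by omega : k + 1 ≤ n)).trans h.1

lemma Positive.numJumps_eq (hw : Positive w) (h : w ∈ between n t) : numJumps w t = n := by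
  rw [numJumps, hw.setOf_jumpTime_le h, Set.ncard_eq_toFinset_card']
  simp

lemma Positive.eq_of_mem_between (hw : Positive w) (h : w ∈ between n t) (h' : w ∈ between m t) :
    n = m := by rw [← hw.numJumps_eq h, hw.numJumps_eq h']

lemma Positive.process_eq (hw : Positive w) (h : w ∈ between n t) :
    process step s w t = chain step s w n := by rw [process, hw.numJumps_eq h]

lemma Regular.exists_le_jumpTime (hw : Regular w) (c : ℕ) : ∃ n, (c : ℝ) ≤ jumpTime w n := by
  induction c with
  | zero => exact ⟨0, by simp⟩
  | succ c ih =>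
    obtain ⟨n, hn⟩ := ih
    obtain ⟨m, hm, h1⟩ := Filter.frequently_atTop.1 hw.2 n
    refine ⟨m + 1, ?_⟩
    rw [jumpTime_succ]
    push_cast
    linarith [hw.1.strictMono_jumpTime.monotone hm]

lemma Regular.exists_mem_between (hw : Regular w) (ht : 0 ≤ t) : ∃ n, w ∈ between n t := by
  classical
  obtain ⟨c, hc⟩ := exists_nat_gt t
  obtain ⟨n, hn⟩ := hw.exists_le_jumpTime c
  have hex : ∃ n, t < jumpTime w (n + 1) :=
    ⟨n, (hc.trans_le hn).trans (hw.1.strictMono_jumpTime (Nat.lt_succ_self n))⟩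
  refine ⟨Nat.find hex, ?_, Nat.find_spec hex⟩
  rcases Nat.eq_zero_or_pos (Nat.find hex) with h0 | h0
  · rw [h0]; simpa using ht
  · have := Nat.find_min hex (Nat.sub_lt h0 one_pos)
    rwa [not_lt, show Nat.find hex - 1 + 1 = Nat.find hex by omega] at this

lemma shift_snd (n k : ℕ) (t : ℝ) (w : ℕ → ℝ × M) : (shift n t w k).2 = (w (n + k)).2 := by
  cases k with
  | zero => rfl
  | succ k =>
    change (w (n + 1 + k)).2 = _
    rw [show n + 1 + k = n + (k + 1) by omega]

lemma shift_succ (n k : ℕ) (t : ℝ) (w : ℕ → ℝ × M) : shift n t w (k + 1) = w (n + (k + 1)) := by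
  change w (n + 1 + k) = _
  rw [show n + 1 + k = n + (k + 1) by omega]

lemma jumpTime_shift_succ (n j : ℕ) (t : ℝ) (w : ℕ → ℝ × M) :
    jumpTime (shift n t w) (j + 1) = jumpTime w (n + j + 1) - t := by
  induction j with
  | zero => simp [jumpTime, shift]
  | succ j ih =>
    rw [jumpTime_succ, ih, shift_succ, ← add_assoc, jumpTime_succ w (n + j + 1)]
    ring

lemma Positive.positive_shift (hw : Positive w) (h : w ∈ between n t) : Positive (shift n t w) := by
  intro k
  cases k with
  | zero => exact sub_pos.2 h.2
  | succ k => rw [shift_succ]; exact hw _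

lemma Regular.regular_shift (hw : Regular w) (h : w ∈ between n t) : Regular (shift n t w) := by
  refine ⟨hw.1.positive_shift h, Filter.frequently_atTop.2 fun N => ?_⟩
  obtain ⟨m, hm, h1⟩ := Filter.frequently_atTop.1 hw.2 (n + N + 1)
  refine ⟨m - n, by omega, ?_⟩
  obtain ⟨k, rfl⟩ : ∃ k, m = n + (k + 1) := ⟨m - n - 1, by omega⟩
  rw [Nat.add_sub_cancel_left, shift_succ]
  exact h1

lemma mem_between_add (h : w ∈ between n t) (hu : 0 ≤ u) (h' : shift n t w ∈ between m u) :
    w ∈ between (n + m) (t + u) := by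
  obtain ⟨h1, h2⟩ := h'
  rw [jumpTime_shift_succ] at h2
  refine ⟨?_, by linarith⟩
  cases m with
  | zero => exact h.1.trans (by linarith)
  | succ m =>
    rw [jumpTime_shift_succ] at h1
    rw [← add_assoc]
    linarith

lemma chain_add (step : S → M → S) (s : S) (w : ℕ → ℝ × M) (n m : ℕ) (t : ℝ) :
    chain step s w (n + m) = chain step (chain step s w n) (shift n t w) m := by
  induction m with
  | zero => rfl
  | succ m ih => rw [← add_assoc, chain, ih, chain, shift_snd]

lemma Regular.process_add (hw : Regular w) (h : w ∈ between n t) (hu : 0 ≤ u) :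
    process step s w (t + u) = process step (chain step s w n) (shift n t w) u := by
  obtain ⟨m, hm⟩ := (hw.regular_shift h).exists_mem_between hu
  rw [hw.1.process_eq (mem_between_add h hu hm), (hw.1.positive_shift h).process_eq hm]
  exact chain_add step s w n m t

end Pathwise

variable [MeasurableSpace M]

@[fun_prop]
lemma measurable_jumpTime (n : ℕ) : Measurable fun w : ℕ → ℝ × M => jumpTime w n := by
  unfold jumpTime
  fun_prop

lemma measurableSet_between (n : ℕ) (t : ℝ) : MeasurableSet (between n t : Set (ℕ → ℝ × M)) :=
  (measurableSet_le (measurable_jumpTime n) measurable_const).inter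
    (measurableSet_lt measurable_const (measurable_jumpTime (n + 1)))

lemma measurableSet_between_prod (n : ℕ) {α : Type*} [MeasurableSpace α] {t : α → ℝ}
    {w : α → ℕ → ℝ × M} (ht : Measurable t) (hw : Measurable w) :
    MeasurableSet {z | w z ∈ between n (t z)} :=
  (measurableSet_le ((measurable_jumpTime n).comp hw) ht).inter
    (measurableSet_lt ht ((measurable_jumpTime (n + 1)).comp hw))

@[fun_prop]
lemma measurable_shift (n : ℕ) (t : ℝ) :
    Measurable fun w : ℕ → ℝ × M => shift n t w := by
  unfold shift
  fun_prop

lemma measurable_numJumps (t : ℝ) : Measurable fun w : ℕ → ℝ × M => numJumps w t :=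
  measurable_ncard.comp (measurable_set_iff.2 fun k =>
    measurableSet_setOfPred.1 (measurableSet_le (measurable_jumpTime (k + 1)) measurable_const))

section Measurability

variable [MeasurableSpace S] {step : S → M → S}

lemma measurable_chain (hstep : Measurable (Function.uncurry step)) (n : ℕ) :
    Measurable fun z : S × (ℕ → ℝ × M) => chain step z.1 z.2 n := by
  induction n with
  | zero => exact measurable_fst
  | succ n ih => exact hstep.comp (ih.prodMk (by fun_prop))

lemma measurable_process (hstep : Measurable (Function.uncurry step)) (t : ℝ) :
    Measurable fun z : S × (ℕ → ℝ × M) => process step z.1 z.2 t := by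
  have h : Measurable fun z : (S × (ℕ → ℝ × M)) × ℕ => chain step z.1.1 z.1.2 z.2 :=
    measurable_from_prod_countable_left fun n => measurable_chain hstep n
  exact h.comp (measurable_id.prodMk ((measurable_numJumps t).comp measurable_snd))

end Measurability

section Law

variable {ρ : Measure M} [IsProbabilityMeasure ρ]

lemma lintegral_waiting {f : ℝ × M → ℝ≥0∞} (hf : Measurable f) :
    ∫⁻ e, f e ∂(expMeasure 2).prod ρ = ∫⁻ g, ∫⁻ m, f (g, m) ∂ρ ∂expMeasure 2 :=
  lintegral_prod _ hf.aemeasurable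

omit [IsProbabilityMeasure ρ] in
lemma ae_waiting_pos [SFinite ρ] : ∀ᵐ e ∂(expMeasure 2).prod ρ, 0 < e.1 :=
  Measure.quasiMeasurePreserving_fst.ae (ae_expMeasure_pos 2)

lemma ae_positive : ∀ᵐ w ∂seqLaw ((expMeasure 2).prod ρ), Positive w := by
  refine ae_all_iff.2 fun n => ?_
  exact (measurePreserving_eval_seqLaw n).quasiMeasurePreserving.ae
    (p := fun e : ℝ × M => 0 < e.1) ae_waiting_pos

lemma ae_frequently_one_lt :
    ∀ᵐ w ∂seqLaw ((expMeasure 2).prod ρ), ∃ᶠ n in Filter.atTop, 1 < (w n).1 := by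
  have hlt : (expMeasure 2).prod ρ {e | e.1 ≤ 1} < 1 := by
    have h1 : {e : ℝ × M | e.1 ≤ 1} = Iic 1 ×ˢ univ := by ext; simp
    have h2 : expMeasure 2 (Iic 1) = 1 - expMeasure 2 (Ioi 1) := by
      rw [← compl_Ioi, prob_compl_eq_one_sub measurableSet_Ioi]
    rw [h1, Measure.prod_prod, measure_univ, mul_one, h2, expMeasure_Ioi two_pos zero_le_one]
    refine ENNReal.sub_lt_self ENNReal.one_ne_top one_ne_zero ?_
    simp [Real.exp_pos]
  have hm : MeasurableSet {e : ℝ × M | e.1 ≤ 1} := measurableSet_le measurable_fst measurable_const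
  have hA : ∀ k, MeasurableSet {w : ℕ → ℝ × M | ∀ i, (w (k + i)).1 ≤ 1} := by
    intro k
    simp only [ofPred_forall]
    exact MeasurableSet.iInter fun i => measurableSet_le (by fun_prop) measurable_const
  have h0 : ∀ k, seqLaw ((expMeasure 2).prod ρ) {w | ∀ i, (w (k + i)).1 ≤ 1} = 0 := by
    intro k
    induction k with
    | zero =>
      have hle : ∀ n : ℕ, seqLaw ((expMeasure 2).prod ρ) {w | ∀ i, (w (0 + i)).1 ≤ 1}
          ≤ (expMeasure 2).prod ρ {e | e.1 ≤ 1} ^ n := by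
        intro n
        refine (measure_mono ?_).trans_eq ((seqLaw_initialBox _ n
          (t := fun _ => {e : ℝ × M | e.1 ≤ 1}) fun _ => hm).trans (by simp))
        intro w hw i _
        simpa using hw i
      exact le_antisymm (ge_of_tendsto' (ENNReal.tendsto_pow_atTop_nhds_zero_of_lt_one hlt) hle)
        bot_le
    | succ k ih =>
      rw [seqLaw_apply_eq_lintegral (hA _)]
      have : ∀ (e : ℝ × M) (w : ℕ → ℝ × M), cons e w ∈ {w | ∀ i, (w (k + 1 + i)).1 ≤ 1} ↔
          ∀ i, (w (k + i)).1 ≤ 1 := by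
        intro e w
        refine forall_congr' fun i => ?_
        rw [show k + 1 + i = (k + i) + 1 by omega]; rfl
      simp only [this, ih, lintegral_zero]
  have : ∀ᵐ w ∂seqLaw ((expMeasure 2).prod ρ), ∀ k, ¬ ∀ i, (w (k + i)).1 ≤ 1 :=
    ae_all_iff.2 fun k => by rw [ae_iff]; simpa using h0 k
  filter_upwards [this] with w hw
  refine Filter.frequently_atTop.2 fun k => ?_
  obtain ⟨i, hi⟩ := not_forall.1 (hw k)
  exact ⟨k + i, by omega, not_le.1 hi⟩

lemma ae_regular : ∀ᵐ w ∂seqLaw ((expMeasure 2).prod ρ), Regular w :=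
  ae_positive.and ae_frequently_one_lt

lemma lintegral_between_zero {t : ℝ} (ht : 0 ≤ t) {h : (ℕ → ℝ × M) → ℝ≥0∞} (hh : Measurable h) :
    ∫⁻ w, (between 0 t).indicator (fun w => h (shift 0 t w)) w ∂seqLaw ((expMeasure 2).prod ρ)
      = ENNReal.ofReal (Real.exp (-(2 * t))) * ∫⁻ w, h w ∂seqLaw ((expMeasure 2).prod ρ) := by
  let H : ℝ → ℝ≥0∞ := fun g => ∫⁻ m, ∫⁻ w, h (cons (g, m) w) ∂seqLaw ((expMeasure 2).prod ρ) ∂ρ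
  have hH1 : Measurable fun e : ℝ × M =>
      ∫⁻ w, h (cons e w) ∂seqLaw ((expMeasure 2).prod ρ) :=
    Measurable.lintegral_prod_right' (f := fun z : (ℝ × M) × (ℕ → ℝ × M) => h (cons z.1 z.2))
      (by fun_prop)
  have hH : Measurable H := Measurable.lintegral_prod_right' hH1
  have hcond : ∀ (g : ℝ) (m : M) (w : ℕ → ℝ × M), (between 0 t).indicator
      (fun w => h (shift 0 t w)) (cons (g, m) w)
      = (Ioi t).indicator (fun g => h (cons (g - t, m) w)) g := by
    intro g m w
    by_cases hg : t < g <;> simp [indicator, mem_between_zero, ht, hg, shift_zero_cons]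
  have hm : Measurable ((between 0 t).indicator fun w : ℕ → ℝ × M => h (shift 0 t w)) :=
    Measurable.indicator (by fun_prop) (measurableSet_between 0 t)
  rw [lintegral_seqLaw hm, lintegral_waiting (Measurable.lintegral_prod_right'
      (f := fun z : (ℝ × M) × (ℕ → ℝ × M) =>
        (between 0 t).indicator (fun w => h (shift 0 t w)) (cons z.1 z.2))
      (hm.comp (by fun_prop))), lintegral_seqLaw hh, lintegral_waiting hH1,
    ← lintegral_expMeasure_shift' ht hH]
  refine lintegral_congr fun g => ?_
  simp only [hcond]
  by_cases hg : t < g <;> simp [indicator, hg, H]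

/-- At time `t`, the future of a marked Poisson process is independent of its past and has the
original law. Here `f w` is the dependence on the past: it must not change if `w` is changed after
time `t`. -/
lemma lintegral_between_shift (n : ℕ) (t : ℝ) {f : (ℕ → ℝ × M) → (ℕ → ℝ × M) → ℝ≥0∞}
    (hf : Measurable (Function.uncurry f))
    (hpast : ∀ w w', Positive w → Positive w' → w ∈ between n t → w' ∈ between n t →
      (∀ i < n, w i = w' i) → f w = f w') :
    ∫⁻ w, (between n t).indicator (fun w => f w (shift n t w)) w ∂seqLaw ((expMeasure 2).prod ρ)
      = ∫⁻ w, (between n t).indicator (fun w => ∫⁻ w', f w w' ∂seqLaw ((expMeasure 2).prod ρ)) w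
        ∂seqLaw ((expMeasure 2).prod ρ) := by
  induction n generalizing t f with
  | zero =>
    by_cases ht : 0 ≤ t
    · obtain ⟨m⟩ : Nonempty M := ρ.nonempty_of_neZero
      -- any two sequences without jumps up to time `t` are equivalent, so one may be fixed
      let w₀ : ℕ → ℝ × M := fun _ => (t + 1, m)
      have hw₀ : Positive w₀ := fun _ => by simp only [w₀]; linarith
      have hw₀' : w₀ ∈ between 0 t := mem_between_zero.2 ⟨ht, by simp [w₀]⟩
      have h1 : ∀ᵐ w ∂seqLaw ((expMeasure 2).prod ρ), w ∈ between 0 t → f w = f w₀ := by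
        filter_upwards [ae_positive] with w hw hw'
        exact hpast w w₀ hw hw₀ hw' hw₀' fun i hi => absurd hi (Nat.not_lt_zero i)
      have hmeas : Measurable (f w₀) := hf.comp measurable_prodMk_left
      have hl := lintegral_between_zero (ρ := ρ) ht hmeas
      have hr := lintegral_between_zero (ρ := ρ) ht
        (measurable_const (a := ∫⁻ w', f w₀ w' ∂seqLaw ((expMeasure 2).prod ρ)))
      rw [lintegral_const, measure_univ, mul_one] at hr
      rw [lintegral_congr_ae (g := (between 0 t).indicator fun w => f w₀ (shift 0 t w)),
        hl, ← hr]
      · refine lintegral_congr_ae ?_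
        filter_upwards [h1] with w hw
        by_cases h : w ∈ between 0 t
        · simp [indicator, h, hw h]
        · simp [indicator, h]
      · filter_upwards [h1] with w hw
        by_cases h : w ∈ between 0 t
        · simp [indicator, h, hw h]
        · simp [indicator, h]
    · have : ∀ w : ℕ → ℝ × M, w ∉ between 0 t := fun w hw => ht (mem_between_zero.1 hw).1
      simp [indicator, this]
  | succ n ih =>
    have hfi : Measurable fun w => ∫⁻ w', f w w' ∂seqLaw ((expMeasure 2).prod ρ) :=
      Measurable.lintegral_prod_right' hf
    have hfs : Measurable fun w => f w (shift (n + 1) t w) :=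
      hf.comp (measurable_id.prodMk (measurable_shift _ _))
    rw [lintegral_seqLaw (hfs.indicator (measurableSet_between _ _)),
      lintegral_seqLaw (hfi.indicator (measurableSet_between _ _))]
    refine lintegral_congr_ae ?_
    filter_upwards [ae_waiting_pos] with e he
    have h := ih (t - e.1) (f := fun w w' => f (cons e w) w')
      (hf.comp ((by fun_prop : Measurable fun z : (ℕ → ℝ × M) × (ℕ → ℝ × M) =>
        (cons e z.1, z.2)))) (by
        intro w w' hw hw' hb hb' hi
        refine hpast _ _ (hw.cons he) (hw'.cons he) (cons_mem_between_succ.2 hb)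
          (cons_mem_between_succ.2 hb') fun i hi' => ?_
        cases i with
        | zero => rfl
        | succ i => exact hi i (by omega))
    have hind : ∀ (g : (ℕ → ℝ × M) → ℝ≥0∞) (w : ℕ → ℝ × M),
        (between (n + 1) t).indicator g (cons e w)
          = (between n (t - e.1)).indicator (fun w => g (cons e w)) w := by
      intro g w
      by_cases hw : w ∈ between n (t - e.1) <;> simp [indicator, cons_mem_between_succ, hw]
    simp only [hind, shift_cons_succ]
    exact h

end Law

end MarkedPoisson

/-! ### The transition semigroup and the Markov property -/

section Semigroup

variable {S M : Type*} [MeasurableSpace S] [MeasurableSpace M] {step : S → M → S}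

/-- The law of the state at time `u` of a chain driven by a Poisson process of rate `2` with marks
of law `ρ`, as a function of the initial state. -/
noncomputable def transition (ρ : Measure M) [IsProbabilityMeasure ρ]
    (hstep : Measurable (Function.uncurry step)) (u : ℝ) : Kernel S S where
  toFun s := (seqLaw ((expMeasure 2).prod ρ)).map fun w => process step s w u
  measurable' := by
    have hp := measurable_process hstep u
    refine Measure.measurable_of_measurable_coe _ fun A hA => ?_
    have h : ∀ s, (seqLaw ((expMeasure 2).prod ρ)).map (fun w => process step s w u) A
        = seqLaw ((expMeasure 2).prod ρ) {w | process step s w u ∈ A} := fun s =>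
      Measure.map_apply (hp.comp measurable_prodMk_left) hA
    simp only [h]
    exact measurable_measure_prodMk_left (hp hA)

variable {ρ : Measure M} [IsProbabilityMeasure ρ] (hstep : Measurable (Function.uncurry step))

lemma transition_apply (u : ℝ) (s : S) {A : Set S} (hA : MeasurableSet A) :
    transition ρ hstep u s A = seqLaw ((expMeasure 2).prod ρ) {w | process step s w u ∈ A} :=
  Measure.map_apply ((measurable_process hstep u).comp measurable_prodMk_left) hA

lemma lintegral_transition (u : ℝ) (s : S) {f : S → ℝ≥0∞} (hf : Measurable f) :
    ∫⁻ s', f s' ∂transition ρ hstep u s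
      = ∫⁻ w, f (process step s w u) ∂seqLaw ((expMeasure 2).prod ρ) :=
  lintegral_map hf ((measurable_process hstep u).comp measurable_prodMk_left)

/-- Whether a driving sequence belongs to `F` is decided by what happens up to time `t`: two sequences
with positive waiting times and the same jumps up to time `t` belong to `F` together. -/
def DeterminedBy (t : ℝ) (F : Set (ℕ → ℝ × M)) : Prop :=
  ∀ n w w', Positive w → Positive w' → w ∈ between n t → w' ∈ between n t →
    (∀ i < n, w i = w' i) → (w ∈ F ↔ w' ∈ F)

omit [MeasurableSpace M] in
lemma tsum_between_indicator {t : ℝ} (ht : 0 ≤ t) {w : ℕ → ℝ × M} (hw : Regular w)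
    (G : (ℕ → ℝ × M) → ℝ≥0∞) : ∑' n, (between n t).indicator G w = G w := by
  obtain ⟨n, hn⟩ := hw.exists_mem_between ht
  rw [tsum_eq_single n, indicator_of_mem hn]
  intro m hm
  exact indicator_of_notMem (fun hm' => hm (hw.1.eq_of_mem_between hm' hn)) _

lemma lintegral_eq_tsum_between {t : ℝ} (ht : 0 ≤ t) {G : (ℕ → ℝ × M) → ℝ≥0∞}
    (hG : Measurable G) : ∫⁻ w, G w ∂seqLaw ((expMeasure 2).prod ρ)
      = ∑' n, ∫⁻ w, (between n t).indicator G w ∂seqLaw ((expMeasure 2).prod ρ) := by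
  rw [← lintegral_tsum fun n => (hG.indicator (measurableSet_between n t)).aemeasurable]
  refine lintegral_congr_ae ?_
  filter_upwards [ae_regular] with w hw
  exact (tsum_between_indicator ht hw G).symm

/-- The Markov property at time `t`. -/
lemma measure_inter_process (s : S) {t u : ℝ} (ht : 0 ≤ t) (hu : 0 ≤ u) {F : Set (ℕ → ℝ × M)}
    (hF : MeasurableSet F) (hFt : DeterminedBy t F) {A : Set S} (hA : MeasurableSet A) :
    seqLaw ((expMeasure 2).prod ρ) (F ∩ {w | process step s w (t + u) ∈ A})
      = ∫⁻ w in F, transition ρ hstep u (process step s w t) A ∂seqLaw ((expMeasure 2).prod ρ) := by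
  have hproc : ∀ v, Measurable fun w : ℕ → ℝ × M => process step s w v := fun v =>
    (measurable_process hstep v).comp measurable_prodMk_left
  have hchain : ∀ n, Measurable fun w : ℕ → ℝ × M => chain step s w n := fun n =>
    (measurable_chain hstep n).comp measurable_prodMk_left
  have hset : MeasurableSet (F ∩ {w | process step s w (t + u) ∈ A}) := hF.inter (hproc _ hA)
  have htr : Measurable fun w : ℕ → ℝ × M => transition ρ hstep u (process step s w t) A :=
    ((transition ρ hstep u).measurable_coe hA).comp (hproc t)
  rw [← lintegral_indicator_one hset, ← lintegral_indicator hF,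
    lintegral_eq_tsum_between ht (measurable_one.indicator hset),
    lintegral_eq_tsum_between ht (htr.indicator hF)]
  refine tsum_congr fun n => ?_
  let f : (ℕ → ℝ × M) → (ℕ → ℝ × M) → ℝ≥0∞ := fun w w' =>
    F.indicator 1 w * A.indicator 1 (process step (chain step s w n) w' u)
  have hf : Measurable (Function.uncurry f) := by
    refine Measurable.mul ((measurable_one.indicator hF).comp measurable_fst) ?_
    exact (measurable_one.indicator hA).comp ((measurable_process hstep u).comp
      (((hchain n).comp measurable_fst).prodMk measurable_snd))
  have key := lintegral_between_shift (ρ := ρ) n t hf (by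
    intro w w' hw hw' hb hb' hi
    have h1 := hFt n w w' hw hw' hb hb' hi
    funext v
    simp only [f, chain_congr hi]
    congr 1
    by_cases h : w' ∈ F
    · simp [h, h1.2 h]
    · simp [h, mt h1.1 h])
  refine Eq.trans ?_ (key.trans ?_)
  · refine lintegral_congr_ae ?_
    filter_upwards [ae_regular] with w hw
    by_cases hb : w ∈ between n t
    · rw [indicator_of_mem hb, indicator_of_mem hb]
      have h0 := hw.process_add (step := step) (s := s) hb hu
      by_cases h1 : w ∈ F <;>
        by_cases h2 : process step (chain step s w n) (shift n t w) u ∈ A <;>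
        simp [f, indicator, h0, h1, h2]
    · simp [indicator, hb]
  · refine lintegral_congr_ae ?_
    filter_upwards [ae_regular] with w hw
    by_cases hb : w ∈ between n t
    · rw [indicator_of_mem hb, indicator_of_mem hb]
      have h2 : Measurable fun w' : ℕ → ℝ × M => process step (chain step s w n) w' u :=
        (measurable_process hstep u).comp measurable_prodMk_left
      have h3 : ∫⁻ w', A.indicator 1 (process step (chain step s w n) w' u)
          ∂seqLaw ((expMeasure 2).prod ρ) = transition ρ hstep u (process step s w t) A := by
        have h4 : MeasurableSet {w' : ℕ → ℝ × M | process step (chain step s w n) w' u ∈ A} :=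
          h2 hA
        rw [transition_apply hstep u _ hA, hw.1.process_eq hb, ← lintegral_indicator_one h4]
        rfl
      have h5 : Measurable fun w' : ℕ → ℝ × M =>
          A.indicator (1 : S → ℝ≥0∞) (process step (chain step s w n) w' u) :=
        (measurable_one.indicator hA).comp h2
      simp only [f]
      rw [lintegral_const_mul _ h5, h3]
      by_cases h1 : w ∈ F <;> simp [h1]
    · simp [indicator, hb]

lemma isTransitionSemigroup_transition :
    IsTransitionSemigroup fun t : ℝ≥0 => transition ρ hstep t where
  markov t := ⟨fun s => Measure.isProbabilityMeasure_map
    ((measurable_process hstep t).comp measurable_prodMk_left).aemeasurable⟩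
  zero := by
    refine Kernel.ext fun s => ?_
    have h : (fun w => process step s w ((0 : ℝ≥0) : ℝ))
        =ᵐ[seqLaw ((expMeasure 2).prod ρ)] fun _ => s := by
      filter_upwards [ae_positive] with w hw
      rw [NNReal.coe_zero, hw.process_eq (n := 0) (mem_between_zero.2 ⟨le_rfl, hw 0⟩)]
      rfl
    change (seqLaw ((expMeasure 2).prod ρ)).map (fun w => process step s w ((0 : ℝ≥0) : ℝ)) = _
    rw [Measure.map_congr h, Measure.map_const, measure_univ, one_smul, Kernel.id_apply]
  add t u := by
    ext s A hA
    rw [transition_apply hstep _ _ hA, Kernel.comp_apply' _ _ _ hA,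
      lintegral_transition hstep _ _ ((transition ρ hstep u).measurable_coe hA)]
    have h := measure_inter_process (ρ := ρ) hstep s t.coe_nonneg u.coe_nonneg MeasurableSet.univ
      (fun _ _ _ _ _ _ _ _ => Iff.rfl) hA
    rw [univ_inter, Measure.restrict_univ] at h
    exact h

/-! ### Invariant measures -/

/-- `π` is invariant for the chain with independent marks of law `ρ`. -/
def InvariantStep (step : S → M → S) (ρ : Measure M) (π : Measure S) : Prop :=
  ∀ f : S → ℝ≥0∞, Measurable f → ∫⁻ s, ∫⁻ m, f (step s m) ∂ρ ∂π = ∫⁻ s, f s ∂π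

include hstep in
lemma InvariantStep.lintegral_between {π : Measure S} [SFinite π] (hπ : InvariantStep step ρ π)
    {A : Set S} (hA : MeasurableSet A) (n : ℕ) (t : ℝ) :
    ∫⁻ s, ∫⁻ w, (between n t).indicator (fun w => A.indicator 1 (chain step s w n)) w
        ∂seqLaw ((expMeasure 2).prod ρ) ∂π
      = seqLaw ((expMeasure 2).prod ρ) (between n t) * π A := by
  induction n generalizing t with
  | zero =>
    have h : ∀ s, ∫⁻ w, (between 0 t).indicator (fun w => A.indicator 1 (chain step s w 0)) w
        ∂seqLaw ((expMeasure 2).prod ρ)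
        = seqLaw ((expMeasure 2).prod ρ) (between 0 t) * A.indicator 1 s := by
      intro s
      rw [lintegral_indicator (measurableSet_between 0 t)]
      simp [chain, mul_comm]
    simp only [h]
    rw [lintegral_const_mul _ (measurable_one.indicator hA), lintegral_indicator_one hA]
  | succ n ih =>
    let K : ℝ → S → ℝ≥0∞ := fun g s => ∫⁻ w, (between n (t - g)).indicator
      (fun w => A.indicator 1 (chain step s w n)) w ∂seqLaw ((expMeasure 2).prod ρ)
    have hK : Measurable (Function.uncurry K) := by
      refine Measurable.lintegral_prod_right' (f := fun z : (ℝ × S) × (ℕ → ℝ × M) =>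
        (between n (t - z.1.1)).indicator (fun w => A.indicator 1 (chain step z.1.2 w n)) z.2) ?_
      refine Measurable.indicator (s := {z : (ℝ × S) × (ℕ → ℝ × M) | z.2 ∈ between n (t - z.1.1)})
        (f := fun z : (ℝ × S) × (ℕ → ℝ × M) => A.indicator 1 (chain step z.1.2 z.2 n)) ?_
        (measurableSet_between_prod n (by fun_prop) (by fun_prop))
      exact (measurable_one.indicator hA).comp ((measurable_chain hstep n).comp
        (by fun_prop : Measurable fun z : (ℝ × S) × (ℕ → ℝ × M) => (z.1.2, z.2)))
    have hind : ∀ (e : ℝ × M) (g : (ℕ → ℝ × M) → ℝ≥0∞) (w : ℕ → ℝ × M),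
        (between (n + 1) t).indicator g (cons e w)
          = (between n (t - e.1)).indicator (fun w => g (cons e w)) w := by
      intro e g w
      by_cases hw : w ∈ between n (t - e.1) <;> simp [indicator, cons_mem_between_succ, hw]
    have hb : seqLaw ((expMeasure 2).prod ρ) (between (n + 1) t)
        = ∫⁻ g, seqLaw ((expMeasure 2).prod ρ) (between n (t - g)) ∂expMeasure 2 := by
      rw [seqLaw_apply_eq_lintegral (measurableSet_between _ _)]
      simp only [cons_mem_between_succ]
      have hm : Measurable fun g : ℝ => seqLaw ((expMeasure 2).prod ρ) (between n (t - g)) :=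
        measurable_measure_prodMk_left (measurableSet_between_prod n
          (t := fun z : ℝ × (ℕ → ℝ × M) => t - z.1) (w := fun z => z.2) (by fun_prop) (by fun_prop))
      have := lintegral_waiting (ρ := ρ)
        (f := fun e => seqLaw ((expMeasure 2).prod ρ) (between n (t - e.1))) (hm.comp measurable_fst)
      simpa using this
    have h1 : ∀ s, ∫⁻ w, (between (n + 1) t).indicator
        (fun w => A.indicator 1 (chain step s w (n + 1))) w ∂seqLaw ((expMeasure 2).prod ρ)
        = ∫⁻ g, ∫⁻ m, K g (step s m) ∂ρ ∂expMeasure 2 := by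
      intro s
      have hm : Measurable fun w : ℕ → ℝ × M =>
          (A.indicator 1 (chain step s w (n + 1)) : ℝ≥0∞) :=
        (measurable_one.indicator hA).comp
          ((measurable_chain hstep (n + 1)).comp measurable_prodMk_left)
      rw [lintegral_seqLaw (hm.indicator (measurableSet_between _ _))]
      simp only [hind, chain_cons]
      exact lintegral_waiting (f := fun e : ℝ × M => K e.1 (step s e.2))
        (hK.comp (measurable_fst.prodMk (hstep.comp (measurable_const.prodMk measurable_snd))))
    simp only [h1]
    rw [lintegral_lintegral_swap, hb, ← lintegral_mul_const]
    · refine lintegral_congr fun g => ?_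
      rw [hπ (K g) (hK.comp measurable_prodMk_left)]
      exact ih (t - g)
    · exact measurable_measure_prodMk_left (measurableSet_between_prod n
        (t := fun z : ℝ × (ℕ → ℝ × M) => t - z.1) (w := fun z => z.2) (by fun_prop) (by fun_prop))
    · refine Measurable.aemeasurable ?_
      refine Measurable.lintegral_prod_right' (f := fun z : (S × ℝ) × M =>
        K z.1.2 (step z.1.1 z.2)) ?_
      exact hK.comp ((by fun_prop : Measurable fun z : (S × ℝ) × M => z.1.2).prodMk
        (hstep.comp (by fun_prop : Measurable fun z : (S × ℝ) × M => (z.1.1, z.2))))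

/-- A measure which is invariant for the chain is invariant for the continuous-time process. -/
lemma InvariantStep.invariant_transition {π : Measure S} [SFinite π] (hπ : InvariantStep step ρ π)
    {t : ℝ} (ht : 0 ≤ t) : (transition ρ hstep t).Invariant π := by
  refine Measure.ext fun A hA => ?_
  rw [Measure.bind_apply hA (transition ρ hstep t).aemeasurable]
  have h1 : ∀ s, transition ρ hstep t s A = ∑' n, ∫⁻ w, (between n t).indicator
      (fun w => A.indicator 1 (chain step s w n)) w ∂seqLaw ((expMeasure 2).prod ρ) := by
    intro s
    have hm : MeasurableSet {w : ℕ → ℝ × M | process step s w t ∈ A} :=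
      ((measurable_process hstep t).comp measurable_prodMk_left) hA
    rw [transition_apply hstep _ _ hA, ← lintegral_indicator_one hm,
      lintegral_eq_tsum_between ht (measurable_one.indicator hm)]
    refine tsum_congr fun n => lintegral_congr_ae ?_
    filter_upwards [ae_positive] with w hw
    by_cases hb : w ∈ between n t
    · simp only [indicator_of_mem hb]
      have h0 := hw.process_eq (step := step) (s := s) hb
      by_cases h : chain step s w n ∈ A <;> simp [indicator, h0, h]
    · simp [indicator, hb]
  have hmeas : ∀ n, Measurable fun s => ∫⁻ w, (between n t).indicator
      (fun w => A.indicator (1 : S → ℝ≥0∞) (chain step s w n)) w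
        ∂seqLaw ((expMeasure 2).prod ρ) := by
    intro n
    refine Measurable.lintegral_prod_right' (f := fun z : S × (ℕ → ℝ × M) =>
      (between n t).indicator (fun w => A.indicator 1 (chain step z.1 w n)) z.2) ?_
    exact Measurable.indicator (s := {z : S × (ℕ → ℝ × M) | z.2 ∈ between n t})
      (f := fun z : S × (ℕ → ℝ × M) => A.indicator 1 (chain step z.1 z.2 n))
      ((measurable_one.indicator hA).comp (measurable_chain hstep n))
      (measurable_snd (measurableSet_between n t))
  simp only [h1]
  rw [lintegral_tsum fun n => (hmeas n).aemeasurable]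
  simp only [hπ.lintegral_between hstep hA]
  rw [ENNReal.tsum_mul_right]
  have h2 := lintegral_eq_tsum_between (ρ := ρ) (M := M) ht (G := 1) measurable_one
  simp only [lintegral_indicator_one (measurableSet_between _ _)] at h2
  rw [← h2]
  simp

/-! ### An invariant measure from the excursions from an atom -/

/-- The probability that the chain started at `s` does not visit `o` in its first `n` steps. -/
noncomputable def survival (step : S → M → S) (ρ : Measure M) (o : S) : ℕ → S → ℝ≥0∞
  | 0 => 1
  | n + 1 => fun s => ∫⁻ m, ({o}ᶜ : Set S).indicator (survival step ρ o n) (step s m) ∂ρ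

/-- The law of the `n`-th state of the chain started at `o`, restricted to the event that the chain
has not returned to `o`. -/
noncomputable def tabooLaw (step : S → M → S) (ρ : Measure M) (o : S) : ℕ → Measure S
  | 0 => Measure.dirac o
  | n + 1 => (((tabooLaw step ρ o n).prod ρ).map (Function.uncurry step)).restrict {o}ᶜ

variable {o : S} (ho : MeasurableSet {o})

include hstep ho

omit [IsProbabilityMeasure ρ] in
lemma measurable_survival [SFinite ρ] (n : ℕ) : Measurable (survival step ρ o n) := by
  induction n with
  | zero => exact measurable_one
  | succ n ih =>
    exact Measurable.lintegral_prod_right' (f := fun z : S × M =>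
      ({o}ᶜ : Set S).indicator (survival step ρ o n) (step z.1 z.2))
      ((ih.indicator ho.compl).comp hstep)

lemma lintegral_tabooLaw_succ (n : ℕ) {f : S → ℝ≥0∞} (hf : Measurable f) :
    ∫⁻ s, f s ∂tabooLaw step ρ o (n + 1)
      = ∫⁻ s, ∫⁻ m, ({o}ᶜ : Set S).indicator f (step s m) ∂ρ ∂tabooLaw step ρ o n := by
  have hf' := hf.indicator ho.compl
  rw [tabooLaw, ← lintegral_indicator ho.compl, lintegral_map hf' hstep,
    lintegral_prod (fun z : S × M => ({o}ᶜ : Set S).indicator f (Function.uncurry step z))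
      (hf'.comp hstep).aemeasurable]
  rfl

lemma lintegral_survival_tabooLaw (n k : ℕ) :
    ∫⁻ s, survival step ρ o k s ∂tabooLaw step ρ o n = survival step ρ o (n + k) o := by
  induction n generalizing k with
  | zero => rw [tabooLaw, lintegral_dirac' _ (measurable_survival hstep ho k), zero_add]
  | succ n ih =>
    rw [lintegral_tabooLaw_succ hstep ho n (measurable_survival hstep ho k),
      show n + 1 + k = n + (k + 1) by omega, ← ih (k + 1)]
    rfl

lemma tabooLaw_univ (n : ℕ) : tabooLaw step ρ o n univ = survival step ρ o n o := by
  have := lintegral_survival_tabooLaw (ρ := ρ) hstep ho n 0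
  rw [add_zero] at this
  rw [← this]
  simp [survival]

/-- If the expected time of return to the atom `o` is finite, then the expected occupation measure of
an excursion from `o` is a finite invariant measure. -/
lemma exists_invariantStep (hfin : ∑' n, survival step ρ o n o ≠ ⊤) :
    ∃ π : Measure S, IsProbabilityMeasure π ∧ InvariantStep step ρ π := by
  let ν : Measure S := Measure.sum fun n => tabooLaw step ρ o n
  have hν : ν univ = ∑' n, survival step ρ o n o := by
    simp only [ν, Measure.sum_apply _ MeasurableSet.univ, tabooLaw_univ hstep ho]
  have : IsFiniteMeasure ν := ⟨by rw [hν]; exact hfin.lt_top⟩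
  let ν' : Measure S := (ν.prod ρ).map (Function.uncurry step)
  have hν' : ∀ f : S → ℝ≥0∞, Measurable f →
      ∫⁻ s, f s ∂ν' = ∫⁻ s, ∫⁻ m, f (step s m) ∂ρ ∂ν := by
    intro f hf
    rw [lintegral_map hf hstep, lintegral_prod (fun z : S × M => f (Function.uncurry step z))
      (hf.comp hstep).aemeasurable]
    rfl
  have huniv : ν' univ = ν univ := by
    rw [Measure.map_apply hstep MeasurableSet.univ, preimage_univ, ← univ_prod_univ,
      Measure.prod_prod, measure_univ (μ := ρ), mul_one]
  -- away from `o` the two measures agree since a step from the `n`-th taboo law leads to the next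
  have hoff : ∀ A, MeasurableSet A → o ∉ A → ν' A = ν A := by
    intro A hA hoA
    have hAo : ∀ s ∈ A, s ≠ o := fun s hs h => hoA (h ▸ hs)
    have hind : ({o}ᶜ : Set S).indicator (A.indicator 1) = A.indicator (1 : S → ℝ≥0∞) := by
      funext s
      by_cases hs : s ∈ A
      · simp [hs, hAo s hs]
      · by_cases h : s = o <;> simp [hs, h, hoA]
    have h0 : tabooLaw step ρ o 0 A = 0 := by
      rw [tabooLaw, Measure.dirac_apply' _ hA]; simp [hoA]
    have h1 : ∀ n, ∫⁻ s, ∫⁻ m, A.indicator (1 : S → ℝ≥0∞) (step s m) ∂ρ ∂tabooLaw step ρ o n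
        = tabooLaw step ρ o (n + 1) A := by
      intro n
      rw [← lintegral_indicator_one hA,
        lintegral_tabooLaw_succ hstep ho n (measurable_one.indicator hA), hind]
    rw [← lintegral_indicator_one hA, hν' _ (measurable_one.indicator hA)]
    simp only [ν]
    rw [lintegral_sum_measure, Measure.sum_apply _ hA,
      tsum_eq_zero_add' (f := fun n => tabooLaw step ρ o n A) ENNReal.summable, h0, zero_add]
    exact tsum_congr h1
  have : IsFiniteMeasure ν' := ⟨by rw [huniv]; exact measure_lt_top _ _⟩
  have heq : ν' = ν := by
    refine Measure.ext fun A hA => ?_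
    by_cases hoA : o ∈ A
    · have h := hoff Aᶜ hA.compl (fun h => h hoA)
      rw [← compl_compl A, measure_compl hA.compl (measure_ne_top _ _),
        measure_compl hA.compl (measure_ne_top _ _), h, huniv]
    · exact hoff A hA hoA
  have hne : ν univ ≠ 0 := by
    rw [hν, tsum_eq_zero_add' ENNReal.summable]
    simp [survival]
  refine ⟨(ν univ)⁻¹ • ν, ⟨?_⟩, fun f hf => ?_⟩
  · rw [Measure.smul_apply, smul_eq_mul, ENNReal.inv_mul_cancel hne (measure_ne_top _ _)]
  · rw [lintegral_smul_measure, lintegral_smul_measure, ← hν' f hf, heq]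

end Semigroup

/-! ### A zero-one law -/

section ZeroOne

variable {E : Type*} [MeasurableSpace E] {lam : Measure E} [IsProbabilityMeasure lam]

/-- An event which is almost surely not affected by prefixing a term to the sequence has probability
`0` or `1`: it is independent of every initial segment, hence of itself. -/
lemma ae_mem_of_cons_invariant {A : Set (ℕ → E)} (hA : MeasurableSet A)
    (h : ∀ e, ∀ᵐ w ∂seqLaw lam, cons e w ∈ A ↔ w ∈ A) (hpos : seqLaw lam A ≠ 0) :
    ∀ᵐ w ∂seqLaw lam, w ∈ A := by
  have hbox : ∀ k (t : ℕ → Set E), (∀ i, MeasurableSet (t i)) →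
      seqLaw lam (initialBox k t ∩ A) = (∏ i ∈ Finset.range k, lam (t i)) * seqLaw lam A := by
    intro k
    induction k with
    | zero => intro t _; simp [initialBox]
    | succ k ih =>
      intro t ht
      rw [seqLaw_apply_eq_lintegral ((measurableSet_initialBox (k + 1) ht).inter hA)]
      have hcond : ∀ e, seqLaw lam {w | cons e w ∈ initialBox (k + 1) t ∩ A}
          = (t 0).indicator (fun _ => (∏ i ∈ Finset.range k, lam (t (i + 1))) * seqLaw lam A) e := by
        intro e
        by_cases he : e ∈ t 0
        · rw [indicator_of_mem he, ← ih (fun i => t (i + 1)) fun i => ht (i + 1)]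
          refine measure_congr ?_
          filter_upwards [h e] with w hw
          refine propext ?_
          change (cons e w ∈ initialBox (k + 1) t ∧ cons e w ∈ A) ↔
            (w ∈ (initialBox k fun i => t (i + 1)) ∧ w ∈ A)
          rw [cons_mem_initialBox, hw]
          simp [he]
        · rw [indicator_of_notMem he]
          convert measure_empty (μ := seqLaw lam)
          ext w
          simp [cons_mem_initialBox, he]
      simp only [hcond]
      rw [lintegral_indicator_const (ht 0), Finset.prod_range_succ']
      ring
  have heq : (seqLaw lam A)⁻¹ • (seqLaw lam).restrict A = seqLaw lam := by
    refine eq_seqLaw fun k t ht => ?_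
    rw [Measure.smul_apply, Measure.restrict_apply (measurableSet_initialBox k ht), hbox k t ht,
      smul_eq_mul, mul_left_comm, ENNReal.inv_mul_cancel hpos (measure_ne_top _ _), mul_one]
  rw [ae_iff]
  change seqLaw lam Aᶜ = 0
  rw [← heq, Measure.smul_apply, Measure.restrict_apply hA.compl, compl_inter_self]
  simp

/-- By the strong law of large numbers, a random walk with negative drift is unbounded below. -/
lemma ae_exists_sum_lt {ξ : E → ℝ} (hξ : Measurable ξ) (hint : Integrable ξ lam)
    (hneg : ∫ e, ξ e ∂lam < 0) :
    ∀ᵐ w ∂seqLaw lam, ∀ c : ℝ, ∃ n, ∑ i ∈ Finset.range n, ξ (w i) < c := by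
  have hmp := fun i => measurePreserving_eval_seqLaw (lam := lam) i
  have hident : ∀ i, IdentDistrib (fun w : ℕ → E => ξ (w i)) (fun w => ξ (w 0)) (seqLaw lam)
      (seqLaw lam) := fun i =>
    (IdentDistrib.mk (hmp i).measurable.aemeasurable (hmp 0).measurable.aemeasurable
      ((hmp i).map_eq.trans (hmp 0).map_eq.symm)).comp hξ
  have hindep : iIndepFun (fun (i : ℕ) (w : ℕ → E) => ξ (w i)) (seqLaw lam) :=
    iIndepFun_infinitePi (P := fun _ : ℕ => lam) (X := fun _ => ξ) fun _ => hξ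
  have hslln := strong_law_ae_real (fun (i : ℕ) (w : ℕ → E) => ξ (w i))
    ((hmp 0).integrable_comp_of_integrable hint) (fun i j hij => hindep.indepFun hij) hident
  have hmean : ∫ w, ξ (w 0) ∂seqLaw lam = ∫ e, ξ e ∂lam := by
    have h := integral_map (μ := seqLaw lam) (f := ξ) (hmp 0).measurable.aemeasurable
      hξ.aestronglyMeasurable
    rw [(hmp 0).map_eq] at h
    exact h.symm
  filter_upwards [hslln] with w hw c
  rw [hmean] at hw
  have h1 := Filter.Tendsto.neg_mul_atTop hneg hw
    (tendsto_natCast_atTop_atTop (R := ℝ))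
  obtain ⟨n, hn, hn0⟩ := ((h1.eventually (Filter.eventually_lt_atBot c)).and
    (Filter.eventually_gt_atTop 0)).exists
  refine ⟨n, ?_⟩
  rwa [div_mul_cancel₀ _ (by exact_mod_cast hn0.ne')] at hn

end ZeroOne

/-! ### Reflected random walks -/

section Reflected

variable {M : Type*}

open Classical in
/-- One step of a random walk on `ℕ` reflected at `0`: up on `up`, down on `down`. -/
noncomputable def reflect (up down : Set M) (i : ℕ) (m : M) : ℕ :=
  if m ∈ up then i + 1 else if m ∈ down then i - 1 else i

lemma reflect_mono (up down : Set M) (m : M) : Monotone fun i => reflect up down i m := by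
  intro i j hij
  simp only [reflect]
  split_ifs <;> omega

/-- Two copies of a reflected random walk with the same increments, whose sums are
unbounded below, eventually coincide. -/
lemma exists_chain_reflect_eq {up down : Set M} (hdisj : Disjoint up down) {w : ℕ → ℝ × M}
    (hw : ∀ c : ℝ, ∃ n, ∑ i ∈ Finset.range n,
      (up.indicator (1 : M → ℝ) (w i).2 - down.indicator 1 (w i).2) < c) (i : ℕ) :
    ∃ N, ∀ n ≥ N, chain (reflect up down) i w n = chain (reflect up down) 0 w n := by
  have hmono : ∀ n, chain (reflect up down) 0 w n ≤ chain (reflect up down) i w n := by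
    intro n
    induction n with
    | zero => exact Nat.zero_le _
    | succ n ih => exact reflect_mono up down _ ih
  -- the larger walk reaches `0`, because up to then it equals the free walk
  have hzero : ∃ N, chain (reflect up down) i w N = 0 := by
    by_contra hne
    push Not at hne
    have hfree : ∀ n, ((chain (reflect up down) i w n : ℕ) : ℝ) = i + ∑ k ∈ Finset.range n,
        (up.indicator (1 : M → ℝ) (w k).2 - down.indicator 1 (w k).2) := by
      intro n
      induction n with
      | zero => simp [chain]
      | succ n ih =>
        rw [Finset.sum_range_succ, ← add_assoc, ← ih, chain, reflect]
        have h1 : 1 ≤ chain (reflect up down) i w n := Nat.one_le_iff_ne_zero.2 (hne n)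
        by_cases hu : (w n).2 ∈ up
        · have hd : (w n).2 ∉ down := Set.disjoint_left.1 hdisj hu
          simp [hu, hd]
        · by_cases hd : (w n).2 ∈ down
          · simp only [hu, hd, if_true, if_false, indicator_of_mem, indicator_of_notMem,
              not_false_eq_true, Pi.one_apply, Nat.cast_sub h1]
            push_cast; ring
          · simp [hu, hd]
    obtain ⟨n, hn⟩ := hw (-i)
    have := hfree n
    have h0 : (0 : ℝ) ≤ ((chain (reflect up down) i w n : ℕ) : ℝ) := Nat.cast_nonneg _
    linarith
  obtain ⟨N, hN⟩ := hzero
  refine ⟨N, fun n hn => ?_⟩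
  induction n, hn using Nat.le_induction with
  | base => rw [hN]; exact (Nat.le_zero.1 (hN ▸ hmono N)).symm
  | succ n _ ih => rw [chain, chain, ih]

end Reflected

/-! ### The bounding walk -/

section Walk

variable {x y : ℝ}

/-- The orders on which the first component of the bounding walk steps up. -/
def upBid (x y : ℝ) : Set (Side × ℝ) := {Side.bid} ×ˢ Ioo x y

/-- The orders on which the first component of the bounding walk steps down. -/
def downBid (x : ℝ) : Set (Side × ℝ) := {Side.ask} ×ˢ Iic x

/-- The orders on which the second component of the bounding walk steps up. -/
def upAsk (x y : ℝ) : Set (Side × ℝ) := {Side.ask} ×ˢ Ioo x y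

/-- The orders on which the second component of the bounding walk steps down. -/
def downAsk (y : ℝ) : Set (Side × ℝ) := {Side.bid} ×ˢ Ici y

lemma walkStep_eq_reflect (q : ℕ × ℕ) (m : Side × ℝ) :
    walkStep x y q m
      = (reflect (upBid x y) (downBid x) q.1 m, reflect (upAsk x y) (downAsk y) q.2 m) := by
  obtain ⟨s, p⟩ := m
  cases s
  · by_cases h1 : y ≤ p
    · simp [walkStep, reflect, upBid, downBid, upAsk, downAsk, h1, not_lt.2 h1]
    · by_cases h2 : x < p <;>
        simp [walkStep, reflect, upBid, downBid, upAsk, downAsk, h1, not_le.1 h1, h2]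
  · by_cases h1 : p ≤ x
    · simp [walkStep, reflect, upBid, downBid, upAsk, downAsk, h1, not_lt.2 h1]
    · by_cases h2 : p < y <;>
        simp [walkStep, reflect, upBid, downBid, upAsk, downAsk, h1, not_le.1 h1, h2]

lemma chain_walkStep (q : ℕ × ℕ) (w : ℕ → ℝ × Side × ℝ) (n : ℕ) :
    chain (walkStep x y) q w n = (chain (reflect (upBid x y) (downBid x)) q.1 w n,
      chain (reflect (upAsk x y) (downAsk y)) q.2 w n) := by
  induction n with
  | zero => rfl
  | succ n ih => rw [chain, ih, walkStep_eq_reflect]; rfl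

lemma chain_walkStep_mono (w : ℕ → ℝ × Side × ℝ) (n : ℕ) :
    Monotone fun q => chain (walkStep x y) q w n := by
  intro q q' h
  induction n with
  | zero => exact h
  | succ n ih =>
    simp only [chain, walkStep_eq_reflect]
    exact ⟨reflect_mono _ _ _ ih.1, reflect_mono _ _ _ ih.2⟩

lemma measurable_walkStep (x y : ℝ) : Measurable (Function.uncurry (walkStep x y)) := by
  refine measurable_from_prod_countable_right fun q => ?_
  refine measurable_from_prod_countable_right fun t => ?_
  cases t with
  | bid =>
    exact Measurable.ite (measurableSet_le measurable_const measurable_id)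
      (measurable_const (a := (q.1, q.2 - 1)))
      (Measurable.ite (measurableSet_lt measurable_const measurable_id)
        (measurable_const (a := (q.1 + 1, q.2)))
        measurable_const)
  | ask =>
    exact Measurable.ite (measurableSet_le measurable_id measurable_const)
      (measurable_const (a := (q.1 - 1, q.2)))
      (Measurable.ite (measurableSet_lt measurable_id measurable_const)
        (measurable_const (a := (q.1, q.2 + 1)))
        measurable_const)

variable {νb νa : Measure ℝ}

lemma lintegral_three_cases (hxy : x < y) (ν : Measure ℝ) (a b c : ℝ≥0∞) :
    ∫⁻ p, (if y ≤ p then a else if x < p then b else c) ∂ν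
      = a * ν (Ici y) + b * ν (Ioo x y) + c * ν (Iic x) := by
  have h : ∀ p, (if y ≤ p then a else if x < p then b else c)
      = (Ici y).indicator (fun _ => a) p + (Ioo x y).indicator (fun _ => b) p
        + (Iic x).indicator (fun _ => c) p := by
    intro p
    by_cases h1 : y ≤ p
    · have h2 : ¬ p ≤ x := not_le.2 (hxy.trans_le h1)
      simp [indicator, h1, not_lt.2 h1, h2]
    · by_cases h2 : x < p
      · simp [indicator, h1, h2, not_le.1 h1, not_le.2 h2]
      · simp [indicator, h1, h2, not_lt.1 h2]
  simp only [h]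
  rw [lintegral_add_right _ (measurable_const.indicator measurableSet_Iic),
    lintegral_add_right _ (measurable_const.indicator measurableSet_Ioo),
    lintegral_indicator_const measurableSet_Ici, lintegral_indicator_const measurableSet_Ioo,
    lintegral_indicator_const measurableSet_Iic]

lemma lintegral_walkStep [SFinite νb] [SFinite νa] (hxy : x < y) (q : ℕ × ℕ) (f : ℕ × ℕ → ℝ≥0∞) :
    ∫⁻ m, f (walkStep x y q m) ∂markLaw νb νa
      = 2⁻¹ * (f (q.1, q.2 - 1) * νb (Ici y) + f (q.1 + 1, q.2) * νb (Ioo x y) + f q * νb (Iic x))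
      + 2⁻¹ * (f q * νa (Ici y) + f (q.1, q.2 + 1) * νa (Ioo x y)
        + f (q.1 - 1, q.2) * νa (Iic x)) := by
  have hf : Measurable f := Measurable.of_discrete
  rw [lintegral_markLaw (f := fun m => f (walkStep x y q m))
    (hf.comp ((measurable_walkStep x y).comp measurable_prodMk_left)),
    ← lintegral_three_cases hxy νb, ← lintegral_three_cases hxy νa]
  congr 2
  · refine lintegral_congr fun p => ?_
    simp only [walkStep]
    split_ifs <;> rfl
  · refine lintegral_congr fun p => ?_
    simp only [walkStep]
    by_cases h1 : y ≤ p
    · simp [h1, not_lt.2 h1, not_le.2 (hxy.trans_le h1)]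
    · by_cases h2 : x < p
      · simp [h1, h2, not_le.1 h1, not_le.2 h2]
      · simp [h1, h2, not_lt.1 h2]

/-- The geometric weights are stationary for a random walk reflected at `0`. -/
lemma tsum_pow_mul_step {r U D : ℝ≥0∞} (h : U = r * D) (f : ℕ → ℝ≥0∞) :
    ∑' i, r ^ i * (f (i + 1) * U + f (i - 1) * D) = (U + D) * ∑' i, r ^ i * f i := by
  have h1 : ∑' i, r ^ i * (f (i + 1) * U) = D * ∑' i, r ^ (i + 1) * f (i + 1) := by
    rw [← ENNReal.tsum_mul_left]
    exact tsum_congr fun i => by rw [h]; ring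
  have h2 : ∑' i, r ^ i * (f (i - 1) * D) = D * f 0 + U * ∑' i, r ^ i * f i := by
    rw [tsum_eq_zero_add' ENNReal.summable, ← ENNReal.tsum_mul_left]
    congr 1
    · simp [mul_comm]
    · exact tsum_congr fun i => by rw [h, Nat.add_sub_cancel]; ring
  simp only [mul_add]
  rw [ENNReal.tsum_add, h1, h2, add_mul, add_comm (U * _), ← add_assoc, ← mul_add, add_comm _ (f 0)]
  congr 2
  rw [tsum_eq_zero_add' (f := fun i => r ^ i * f i) ENNReal.summable]
  simp

variable {r s : ℝ≥0∞} [IsProbabilityMeasure νb] [IsProbabilityMeasure νa]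

/-- The product of geometric weights is stationary for the bounding walk. -/
lemma tsum_weight_walkStep (hxy : x < y) (hr : νb (Ioo x y) = r * νa (Iic x))
    (hs : νa (Ioo x y) = s * νb (Ici y)) (f : ℕ × ℕ → ℝ≥0∞) :
    ∑' q : ℕ × ℕ, r ^ q.1 * s ^ q.2 * ∫⁻ m, f (walkStep x y q m) ∂markLaw νb νa
      = ∑' q : ℕ × ℕ, r ^ q.1 * s ^ q.2 * f q := by
  have hb : νb (Ici y) + νb (Ioo x y) + νb (Iic x) = 1 := by
    simpa using (lintegral_three_cases hxy νb 1 1 1).symm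
  have ha : νa (Ici y) + νa (Ioo x y) + νa (Iic x) = 1 := by
    simpa using (lintegral_three_cases hxy νa 1 1 1).symm
  have hfirst : ∑' q : ℕ × ℕ, r ^ q.1 * s ^ q.2 *
        (f (q.1 + 1, q.2) * νb (Ioo x y) + f (q.1 - 1, q.2) * νa (Iic x))
      = (νb (Ioo x y) + νa (Iic x)) * ∑' q : ℕ × ℕ, r ^ q.1 * s ^ q.2 * f q := by
    rw [ENNReal.tsum_prod' (f := fun q : ℕ × ℕ => r ^ q.1 * s ^ q.2 *
        (f (q.1 + 1, q.2) * νb (Ioo x y) + f (q.1 - 1, q.2) * νa (Iic x))),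
      ENNReal.tsum_prod' (f := fun q : ℕ × ℕ => r ^ q.1 * s ^ q.2 * f q), ENNReal.tsum_comm,
      ENNReal.tsum_comm (f := fun i j => r ^ i * s ^ j * f (i, j)), ← ENNReal.tsum_mul_left]
    refine tsum_congr fun j => ?_
    have := tsum_pow_mul_step hr fun i => f (i, j)
    have h1 : ∑' i, r ^ i * s ^ j * f (i, j) = s ^ j * ∑' i, r ^ i * f (i, j) := by
      rw [← ENNReal.tsum_mul_left]; exact tsum_congr fun i => by ring
    rw [h1, mul_left_comm, ← this, ← ENNReal.tsum_mul_left]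
    exact tsum_congr fun i => by ring
  have hsecond : ∑' q : ℕ × ℕ, r ^ q.1 * s ^ q.2 *
        (f (q.1, q.2 + 1) * νa (Ioo x y) + f (q.1, q.2 - 1) * νb (Ici y))
      = (νa (Ioo x y) + νb (Ici y)) * ∑' q : ℕ × ℕ, r ^ q.1 * s ^ q.2 * f q := by
    rw [ENNReal.tsum_prod' (f := fun q : ℕ × ℕ => r ^ q.1 * s ^ q.2 *
        (f (q.1, q.2 + 1) * νa (Ioo x y) + f (q.1, q.2 - 1) * νb (Ici y))),
      ENNReal.tsum_prod' (f := fun q : ℕ × ℕ => r ^ q.1 * s ^ q.2 * f q), ← ENNReal.tsum_mul_left]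
    refine tsum_congr fun i => ?_
    have := tsum_pow_mul_step hs fun j => f (i, j)
    have h1 : ∑' j, r ^ i * s ^ j * f (i, j) = r ^ i * ∑' j, s ^ j * f (i, j) := by
      rw [← ENNReal.tsum_mul_left]; exact tsum_congr fun j => by ring
    rw [h1, mul_left_comm, ← this, ← ENNReal.tsum_mul_left]
    exact tsum_congr fun j => by ring
  have hsplit : ∀ q : ℕ × ℕ, r ^ q.1 * s ^ q.2 * ∫⁻ m, f (walkStep x y q m) ∂markLaw νb νa
      = 2⁻¹ * (r ^ q.1 * s ^ q.2 *
          (f (q.1 + 1, q.2) * νb (Ioo x y) + f (q.1 - 1, q.2) * νa (Iic x))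
        + r ^ q.1 * s ^ q.2 *
          (f (q.1, q.2 + 1) * νa (Ioo x y) + f (q.1, q.2 - 1) * νb (Ici y))
        + (νb (Iic x) + νa (Ici y)) * (r ^ q.1 * s ^ q.2 * f q)) := by
    intro q
    rw [lintegral_walkStep hxy]
    ring
  simp only [hsplit]
  rw [ENNReal.tsum_mul_left, ENNReal.tsum_add, ENNReal.tsum_add, hfirst, hsecond,
    ENNReal.tsum_mul_left, ← add_mul, ← add_mul, ← mul_assoc]
  have htot : νb (Ioo x y) + νa (Iic x) + (νa (Ioo x y) + νb (Ici y)) + (νb (Iic x) + νa (Ici y))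
      = 2 := by
    rw [← one_add_one_eq_two]
    nth_rewrite 1 [← hb]
    rw [← ha]
    ring
  rw [htot, ENNReal.inv_mul_cancel two_ne_zero ENNReal.ofNat_ne_top, one_mul]

/-- The expected time of return of the bounding walk to `(0, 0)` is finite. -/
lemma tsum_survival_walkStep_le (hxy : x < y) (hr : νb (Ioo x y) = r * νa (Iic x))
    (hs : νa (Ioo x y) = s * νb (Ici y)) :
    ∑' n, survival (walkStep x y) (markLaw νb νa) (0, 0) n (0, 0)
      ≤ 1 + ∑' q : ℕ × ℕ, r ^ q.1 * s ^ q.2 := by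
  let γ : ℕ → ℕ × ℕ → ℝ≥0∞ := survival (walkStep x y) (markLaw νb νa) (0, 0)
  let c : ℕ → ℝ≥0∞ := fun n =>
    ∑' q : ℕ × ℕ, r ^ q.1 * s ^ q.2 * ({(0, 0)}ᶜ : Set (ℕ × ℕ)).indicator (γ n) q
  -- stationarity of the weights turns the return probabilities into the decrements of `c`
  have hstep : ∀ n, γ (n + 1) (0, 0) + c (n + 1) = c n := by
    intro n
    have h1 : ∑' q : ℕ × ℕ, r ^ q.1 * s ^ q.2 * γ (n + 1) q = c n :=
      tsum_weight_walkStep hxy hr hs _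
    have h2 : ∀ q : ℕ × ℕ, r ^ q.1 * s ^ q.2 * γ (n + 1) q
        = (if q = (0, 0) then γ (n + 1) (0, 0) else 0)
          + r ^ q.1 * s ^ q.2 * ({(0, 0)}ᶜ : Set (ℕ × ℕ)).indicator (γ (n + 1)) q := by
      intro q
      by_cases hq : q = (0, 0)
      · simp [hq]
      · simp [hq]
    rw [← h1]
    simp only [h2]
    rw [ENNReal.tsum_add, tsum_ite_eq]
  have hsum : ∀ n, ∑ k ∈ Finset.range n, γ (k + 1) (0, 0) + c n = c 0 := by
    intro n
    induction n with
    | zero => simp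
    | succ n ih => rw [Finset.sum_range_succ, add_assoc, hstep, ih]
  have hc0 : c 0 ≤ ∑' q : ℕ × ℕ, r ^ q.1 * s ^ q.2 := by
    refine ENNReal.tsum_le_tsum fun q => ?_
    refine (mul_le_mul_right (b := _) (c := 1) ?_ _).trans_eq (mul_one _)
    by_cases hq : q = (0, 0) <;> simp [hq, γ, survival]
  rw [tsum_eq_zero_add' ENNReal.summable]
  refine add_le_add (by simp [survival]) ?_
  refine ENNReal.tsum_le_of_sum_range_le fun n => ?_
  exact (le_self_add.trans_eq (hsum n)).trans hc0

end Walk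

/-! ### Recurrence of the bounding walk -/

lemma le_measure_frequently {α : Type*} [MeasurableSpace α] {P : Measure α} [IsFiniteMeasure P]
    {A : ℕ → Set α} (hA : ∀ n, MeasurableSet (A n)) {c : ℝ≥0∞} (h : ∀ n, c ≤ P (A n)) :
    c ≤ P {a | ∃ᶠ n in Filter.atTop, a ∈ A n} := by
  have heq : {a | ∃ᶠ n in Filter.atTop, a ∈ A n} = ⋂ N, ⋃ n ≥ N, A n := by
    ext a
    simp [Filter.frequently_atTop]
  have hanti : Antitone fun N => ⋃ n ≥ N, A n := fun N N' hN =>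
    biUnion_subset_biUnion_left fun n hn => hN.trans hn
  rw [heq, hanti.measure_iInter
    (fun N => (MeasurableSet.iUnion fun n => MeasurableSet.iUnion fun _ => hA n).nullMeasurableSet)
    ⟨0, measure_ne_top _ _⟩]
  exact le_iInf fun N => (h N).trans
    (measure_mono (subset_biUnion_of_mem (u := A) (show N ≥ N from le_rfl)))

lemma ae_exists_sum_indicator_lt {M : Type*} [MeasurableSpace M] {ρ : Measure M}
    [IsProbabilityMeasure ρ] {up down : Set M} (hup : MeasurableSet up)
    (hdown : MeasurableSet down) (h : ρ up < ρ down) :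
    ∀ᵐ w ∂seqLaw ((expMeasure 2).prod ρ), ∀ c : ℝ, ∃ n, ∑ i ∈ Finset.range n,
      (up.indicator (1 : M → ℝ) (w i).2 - down.indicator 1 (w i).2) < c := by
  have hi : ∀ {B : Set M}, MeasurableSet B → Integrable (B.indicator (1 : M → ℝ)) ρ := fun hB =>
    (integrable_const 1).indicator hB
  have hm : ∀ {B : Set M}, MeasurableSet B → Measurable (B.indicator (1 : M → ℝ)) := fun hB =>
    measurable_one.indicator hB
  let g : M → ℝ := up.indicator 1 - down.indicator 1
  have hg : Measurable g := (hm hup).sub (hm hdown)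
  have hint : Integrable g ρ := (hi hup).sub (hi hdown)
  have hmp : MeasurePreserving Prod.snd ((expMeasure 2).prod ρ) ρ := measurePreserving_snd
  have hneg : ∫ e, g e.2 ∂(expMeasure 2).prod ρ < 0 := by
    have h1 : ∫ m, g m ∂ρ = ∫ e, g e.2 ∂(expMeasure 2).prod ρ := by
      have h2 := integral_map (μ := (expMeasure 2).prod ρ) (f := g) measurable_snd.aemeasurable
        hg.aestronglyMeasurable
      rwa [hmp.map_eq] at h2
    have h3 : ∫ m, g m ∂ρ = ρ.real up - ρ.real down := by
      rw [← integral_indicator_one hup, ← integral_indicator_one hdown]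
      exact integral_sub (hi hup) (hi hdown)
    rw [← h1, h3, sub_neg]
    exact ENNReal.toReal_strict_mono (measure_ne_top _ _) h
  exact ae_exists_sum_lt (hg.comp measurable_snd) (hmp.integrable_comp_of_integrable hint) hneg

section Recurrence

variable {x y : ℝ}

/-- The bounding walk is at `(0, 0)` after `n` steps and stays there for a time greater than `1`. -/
def longVisit (x y : ℝ) (q : ℕ × ℕ) (n : ℕ) : Set (ℕ → ℝ × Side × ℝ) :=
  {w | chain (walkStep x y) q w n = (0, 0) ∧ 1 < (w n).1}

lemma measurableSet_longVisit (q : ℕ × ℕ) (n : ℕ) : MeasurableSet (longVisit x y q n) := by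
  have h : Measurable fun w : ℕ → ℝ × Side × ℝ => chain (walkStep x y) q w n :=
    (measurable_chain (measurable_walkStep x y) n).comp measurable_prodMk_left
  have h' : MeasurableSet {w : ℕ → ℝ × Side × ℝ | 1 < (w n).1} :=
    measurableSet_lt measurable_const (by fun_prop)
  exact (h (measurableSet_singleton (0, 0))).inter h'

lemma cons_mem_longVisit {q : ℕ × ℕ} {n : ℕ} {e : ℝ × Side × ℝ} {w : ℕ → ℝ × Side × ℝ} :
    cons e w ∈ longVisit x y q (n + 1) ↔ w ∈ longVisit x y (walkStep x y q e.2) n := by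
  simp only [longVisit, mem_ofPred_eq, chain_cons, cons_succ]

lemma longVisit_subset (q : ℕ × ℕ) (n : ℕ) : longVisit x y q n ⊆ longVisit x y (0, 0) n := by
  rintro w ⟨h1, h2⟩
  refine ⟨le_antisymm ?_ (Prod.le_def.2 ⟨Nat.zero_le _, Nat.zero_le _⟩), h2⟩
  have hq : (0, 0) ≤ q := Prod.le_def.2 ⟨Nat.zero_le _, Nat.zero_le _⟩
  exact (chain_walkStep_mono w n hq).trans_eq h1

/-- The bounding walk makes infinitely many long visits to `(0, 0)`. -/
def recurs (x y : ℝ) (q : ℕ × ℕ) : Set (ℕ → ℝ × Side × ℝ) :=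
  {w | ∃ᶠ n in Filter.atTop, w ∈ longVisit x y q n}

lemma measurableSet_recurs (q : ℕ × ℕ) : MeasurableSet (recurs x y q) := by
  have : recurs x y q = ⋂ N, ⋃ n ≥ N, longVisit x y q n := by
    ext w
    simp [recurs, Filter.frequently_atTop]
  rw [this]
  exact MeasurableSet.iInter fun N => MeasurableSet.iUnion fun n => MeasurableSet.iUnion fun _ =>
    measurableSet_longVisit q n

lemma cons_mem_recurs {q : ℕ × ℕ} {e : ℝ × Side × ℝ} {w : ℕ → ℝ × Side × ℝ} :
    cons e w ∈ recurs x y q ↔ w ∈ recurs x y (walkStep x y q e.2) := by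
  simp only [recurs, mem_ofPred_eq, ← cons_mem_longVisit]
  conv_lhs => rw [← Filter.map_add_atTop_eq_nat 1, Filter.frequently_map]

variable {νb νa : Measure ℝ} [IsProbabilityMeasure νb] [IsProbabilityMeasure νa]

omit [IsProbabilityMeasure νb] [IsProbabilityMeasure νa] in
lemma markLaw_bid {B : Set ℝ} (hB : MeasurableSet B) :
    markLaw νb νa ({Side.bid} ×ˢ B) = 2⁻¹ * νb B := by
  have hm : MeasurableSet ({Side.bid} ×ˢ B) := (measurableSet_singleton _).prod hB
  rw [← lintegral_indicator_one hm, lintegral_markLaw (measurable_one.indicator hm),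
    ← lintegral_indicator_one hB]
  have h1 : ∀ p, ({Side.bid} ×ˢ B).indicator (1 : Side × ℝ → ℝ≥0∞) (.bid, p) = B.indicator 1 p :=
    fun p => by by_cases hp : p ∈ B <;> simp [hp]
  have h2 : ∀ p, ({Side.bid} ×ˢ B).indicator (1 : Side × ℝ → ℝ≥0∞) (.ask, p) = 0 :=
    fun p => by simp
  simp only [h1, h2, lintegral_zero, mul_zero, add_zero]

omit [IsProbabilityMeasure νb] [IsProbabilityMeasure νa] in
lemma markLaw_ask {B : Set ℝ} (hB : MeasurableSet B) :
    markLaw νb νa ({Side.ask} ×ˢ B) = 2⁻¹ * νa B := by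
  have hm : MeasurableSet ({Side.ask} ×ˢ B) := (measurableSet_singleton _).prod hB
  rw [← lintegral_indicator_one hm, lintegral_markLaw (measurable_one.indicator hm),
    ← lintegral_indicator_one hB]
  have h1 : ∀ p, ({Side.ask} ×ˢ B).indicator (1 : Side × ℝ → ℝ≥0∞) (.ask, p) = B.indicator 1 p :=
    fun p => by by_cases hp : p ∈ B <;> simp [hp]
  have h2 : ∀ p, ({Side.ask} ×ˢ B).indicator (1 : Side × ℝ → ℝ≥0∞) (.bid, p) = 0 :=
    fun p => by simp
  simp only [h1, h2, lintegral_zero, mul_zero, zero_add]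

/-- Bounding walks from different starting points almost surely merge, so that the event of
recurrence does not depend on the starting point. -/
lemma ae_mem_recurs_iff (hb : νb (Ioo x y) < νa (Iic x)) (ha : νa (Ioo x y) < νb (Ici y)) :
    ∀ᵐ w ∂seqLaw ((expMeasure 2).prod (markLaw νb νa)),
      ∀ q, w ∈ recurs x y q ↔ w ∈ recurs x y (0, 0) := by
  have hhalf : ∀ {a b : ℝ≥0∞}, a < b → 2⁻¹ * a < 2⁻¹ * b := fun h =>
    ENNReal.mul_lt_mul_right (ENNReal.inv_ne_zero.2 ENNReal.ofNat_ne_top)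
      (ENNReal.inv_ne_top.2 two_ne_zero) h
  have h1 := ae_exists_sum_indicator_lt (ρ := markLaw νb νa) (up := upBid x y) (down := downBid x)
    ((measurableSet_singleton _).prod measurableSet_Ioo)
    ((measurableSet_singleton _).prod measurableSet_Iic) (by
      rw [upBid, downBid, markLaw_bid measurableSet_Ioo, markLaw_ask measurableSet_Iic]
      exact hhalf hb)
  have h2 := ae_exists_sum_indicator_lt (ρ := markLaw νb νa) (up := upAsk x y) (down := downAsk y)
    ((measurableSet_singleton _).prod measurableSet_Ioo)
    ((measurableSet_singleton _).prod measurableSet_Ici) (by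
      rw [upAsk, downAsk, markLaw_ask measurableSet_Ioo, markLaw_bid measurableSet_Ici]
      exact hhalf ha)
  have hd1 : Disjoint (upBid x y) (downBid x) :=
    disjoint_left.2 fun m h h' => by simp_all [downBid, upBid]
  have hd2 : Disjoint (upAsk x y) (downAsk y) :=
    disjoint_left.2 fun m h h' => by simp_all [downAsk, upAsk]
  filter_upwards [h1, h2] with w hw1 hw2 q
  obtain ⟨N1, hN1⟩ := exists_chain_reflect_eq hd1 hw1 q.1
  obtain ⟨N2, hN2⟩ := exists_chain_reflect_eq hd2 hw2 q.2
  have hev : ∀ᶠ n in Filter.atTop, (w ∈ longVisit x y q n ↔ w ∈ longVisit x y (0, 0) n) := by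
    filter_upwards [Filter.eventually_ge_atTop (max N1 N2)] with n hn
    simp only [longVisit, mem_ofPred_eq, chain_walkStep, hN1 n ((le_max_left _ _).trans hn),
      hN2 n ((le_max_right _ _).trans hn)]
  exact Filter.frequently_congr hev

variable {r s : ℝ≥0∞}

lemma seqLaw_longVisit_succ (q : ℕ × ℕ) (n : ℕ) :
    seqLaw ((expMeasure 2).prod (markLaw νb νa)) (longVisit x y q (n + 1))
      = ∫⁻ m, seqLaw ((expMeasure 2).prod (markLaw νb νa)) (longVisit x y (walkStep x y q m) n)
        ∂markLaw νb νa := by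
  rw [seqLaw_apply_eq_lintegral (measurableSet_longVisit q (n + 1))]
  simp only [cons_mem_longVisit, ofPred_mem_eq]
  have hm : Measurable fun m => seqLaw ((expMeasure 2).prod (markLaw νb νa))
      (longVisit x y (walkStep x y q m) n) :=
    (Measurable.of_discrete (f := fun q => seqLaw ((expMeasure 2).prod (markLaw νb νa))
      (longVisit x y q n))).comp ((measurable_walkStep x y).comp measurable_prodMk_left)
  refine (lintegral_waiting (hm.comp measurable_snd)).trans ?_
  simp

/-- By stationarity of the weights, and since a walk started at `(0, 0)` is the most likely to be
there, the probabilities of long visits are bounded from below. -/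
lemma le_tsum_mul_seqLaw_longVisit (hxy : x < y) (hr : νb (Ioo x y) = r * νa (Iic x))
    (hs : νa (Ioo x y) = s * νb (Ici y)) (n : ℕ) :
    expMeasure 2 (Ioi 1) ≤ (∑' q : ℕ × ℕ, r ^ q.1 * s ^ q.2) *
      seqLaw ((expMeasure 2).prod (markLaw νb νa)) (longVisit x y (0, 0) n) := by
  let P := seqLaw ((expMeasure 2).prod (markLaw νb νa))
  have h : ∀ n, expMeasure 2 (Ioi 1)
      ≤ ∑' q : ℕ × ℕ, r ^ q.1 * s ^ q.2 * P (longVisit x y q n) := by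
    intro n
    induction n with
    | zero =>
      refine le_trans ?_ (ENNReal.le_tsum (0, 0))
      have h0 : longVisit x y (0, 0) 0
          = (fun w : ℕ → ℝ × Side × ℝ => w 0) ⁻¹' (Ioi 1 ×ˢ univ) := by
        ext w; simp [longVisit, chain]
      rw [h0, (measurePreserving_eval_seqLaw 0).measure_preimage
        (measurableSet_Ioi.prod MeasurableSet.univ).nullMeasurableSet, Measure.prod_prod]
      simp
    | succ n ih =>
      refine ih.trans_eq ?_
      rw [← tsum_weight_walkStep hxy hr hs fun q => P (longVisit x y q n)]
      exact tsum_congr fun q => by rw [← seqLaw_longVisit_succ]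
  refine (h n).trans ?_
  rw [← ENNReal.tsum_mul_right]
  exact ENNReal.tsum_le_tsum fun q => mul_le_mul_right (measure_mono (longVisit_subset q n)) _

/-- The bounding walk is recurrent: recurrence has positive probability since long visits do not
become unlikely, and it is subject to a zero-one law. -/
lemma ae_mem_recurs (hxy : x < y) (hr : νb (Ioo x y) = r * νa (Iic x))
    (hs : νa (Ioo x y) = s * νb (Ici y)) (hfin : ∑' q : ℕ × ℕ, r ^ q.1 * s ^ q.2 ≠ ⊤)
    (hb : νb (Ioo x y) < νa (Iic x)) (ha : νa (Ioo x y) < νb (Ici y)) (q : ℕ × ℕ) :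
    ∀ᵐ w ∂seqLaw ((expMeasure 2).prod (markLaw νb νa)), w ∈ recurs x y q := by
  have h0 : ∀ᵐ w ∂seqLaw ((expMeasure 2).prod (markLaw νb νa)), w ∈ recurs x y (0, 0) := by
    refine ae_mem_of_cons_invariant (measurableSet_recurs _) (fun e => ?_) ?_
    · filter_upwards [ae_mem_recurs_iff hb ha] with w hw
      rw [cons_mem_recurs, hw]
    · have hpos : expMeasure 2 (Ioi 1) ≠ 0 := by
        rw [expMeasure_Ioi two_pos zero_le_one]
        simp [Real.exp_pos]
      have hle := le_measure_frequently (P := seqLaw ((expMeasure 2).prod (markLaw νb νa)))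
        (A := longVisit x y (0, 0)) (measurableSet_longVisit _)
        (c := expMeasure 2 (Ioi 1) / ∑' q : ℕ × ℕ, r ^ q.1 * s ^ q.2) fun n =>
          ENNReal.div_le_of_le_mul' (le_tsum_mul_seqLaw_longVisit hxy hr hs n)
      exact (lt_of_lt_of_le (ENNReal.div_pos hpos hfin) hle).ne'
  filter_upwards [h0, ae_mem_recurs_iff hb ha] with w hw hw'
  exact (hw' q).2 hw

end Recurrence

section Comparison

variable {x y : ℝ} {hxy : x < y}

lemma Book.Dominated.state_step {s : State x y} {q : ℕ × ℕ} (h : s.1.Dominated q) (m : Side × ℝ) :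
    (s.step hxy m).1.Dominated (walkStep x y q m) :=
  Book.Dominated.innerStep s.2 hxy h m

lemma Book.Dominated.state_chain {s : State x y} {q : ℕ × ℕ} (h : s.1.Dominated q)
    (w : ℕ → ℝ × Side × ℝ) (n : ℕ) :
    (chain (State.step hxy) s w n).1.Dominated (chain (walkStep x y) q w n) := by
  induction n with
  | zero => exact h
  | succ n ih => exact Book.Dominated.state_step ih _

/-- The book returns to the empty state no later than the bounding walk returns to `(0, 0)`. -/
lemma survival_step_le {ρ : Measure (Side × ℝ)} {s : State x y} {q : ℕ × ℕ}
    (h : s.1.Dominated q) (n : ℕ) :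
    survival (State.step hxy) ρ (State.empty x y) n s
      ≤ survival (walkStep x y) ρ (0, 0) n q := by
  induction n generalizing s q with
  | zero => exact le_rfl
  | succ n ih =>
    refine lintegral_mono fun m => ?_
    have hd := Book.Dominated.state_step (hxy := hxy) h m
    by_cases h0 : s.step hxy m = State.empty x y
    · simp [h0]
    · have h1 : walkStep x y q m ≠ (0, 0) := fun h1 =>
        h0 (State.eq_empty_of_dominated (h1 ▸ hd))
      simpa [h0, h1] using ih hd

end Comparison

/-! ### From the driving sequence to the process -/

section Path

variable {S M : Type*} {step : S → M → S} {s : S} {w : ℕ → ℝ × M}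

lemma Positive.volume_occupation_eq_top (hw : Positive w) {A : Set S}
    (h : ∃ᶠ n in Filter.atTop, chain step s w n ∈ A ∧ 1 < (w n).1) :
    volume ((fun t : ℝ≥0 => (t : ℝ)) '' {t | process step s w t ∈ A}) = ⊤ := by
  let N : Set ℕ := {n | chain step s w n ∈ A ∧ 1 < (w n).1}
  have hN : Infinite N := (Nat.frequently_atTop_iff_infinite.1 h).to_subtype
  have hsub : ⋃ n ∈ N, Ico (jumpTime w n) (jumpTime w (n + 1))
      ⊆ (fun t : ℝ≥0 => (t : ℝ)) '' {t | process step s w t ∈ A} := by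
    refine iUnion₂_subset fun n hn t ht => ?_
    have h0 : 0 ≤ t := (hw.strictMono_jumpTime.monotone (Nat.zero_le n)).trans ht.1
    refine ⟨⟨t, h0⟩, ?_, rfl⟩
    change process step s w t ∈ A
    rw [hw.process_eq ht]
    exact hn.1
  have hdisj : N.PairwiseDisjoint fun n => Ico (jumpTime w n) (jumpTime w (n + 1)) :=
    fun n _ m _ hnm => disjoint_left.2 fun t ht ht' => hnm (hw.eq_of_mem_between ht ht')
  refine top_le_iff.1 (le_trans ?_ (measure_mono hsub))
  rw [measure_biUnion N.to_countable hdisj fun n _ => measurableSet_Ico]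
  refine (ENNReal.tsum_const_eq_top_of_ne_zero (α := N) one_ne_zero).ge.trans
    (ENNReal.tsum_le_tsum fun n => ?_)
  rw [Real.volume_Ico, jumpTime_succ, add_sub_cancel_left, ENNReal.one_le_ofReal]
  exact n.2.2.le

lemma Positive.process_congr {w' : ℕ → ℝ × M} {n : ℕ} {r t : ℝ} (hw : Positive w)
    (hw' : Positive w') (hb : w ∈ between n t) (hb' : w' ∈ between n t)
    (h : ∀ i < n, w i = w' i) (hr : r ≤ t) :
    process step s w r = process step s w' r := by
  have hlt : ∀ {v : ℕ → ℝ × M}, Positive v → v ∈ between n t → ∀ k, jumpTime v (k + 1) ≤ r →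
      k < n := by
    intro v hv hvb k hk
    have := hv.strictMono_jumpTime.lt_iff_lt.1 ((hk.trans hr).trans_lt hvb.2)
    omega
  have hset : {k : ℕ | jumpTime w (k + 1) ≤ r} = {k | jumpTime w' (k + 1) ≤ r} := by
    ext k
    have hk : k < n → jumpTime w (k + 1) = jumpTime w' (k + 1) := fun hk =>
      jumpTime_congr fun i hi => h i (by omega)
    constructor
    · intro h1
      have := hk (hlt hw hb k h1)
      simpa [← this] using h1
    · intro h1
      have := hk (hlt hw' hb' k h1)
      simpa [this] using h1
  have hle : numJumps w r ≤ n := by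
    have := Set.ncard_le_ncard (s := {k : ℕ | jumpTime w (k + 1) ≤ r}) (t := Iio n)
      (fun k hk => hlt hw hb k hk) (finite_Iio n)
    rwa [Set.ncard_eq_toFinset_card' (Iio n), toFinset_Iio, Nat.card_Iio] at this
  have hnum : numJumps w r = numJumps w' r := by rw [numJumps, hset, numJumps]
  rw [process, process, ← hnum]
  exact chain_congr fun i hi => h i (hi.trans_le hle)

variable [MeasurableSpace S] [MeasurableSpace M] {ρ : Measure M} [IsProbabilityMeasure ρ]

/-- The σ-algebra of the events which are decided by what happens up to time `t`. -/
@[reducible] def history (t : ℝ) : MeasurableSpace (ℕ → ℝ × M) where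
  MeasurableSet' F := MeasurableSet F ∧ DeterminedBy t F
  measurableSet_empty := ⟨MeasurableSet.empty, fun _ _ _ _ _ _ _ _ => Iff.rfl⟩
  measurableSet_compl F hF := ⟨hF.1.compl, fun n w w' hw hw' hb hb' h =>
    not_congr (hF.2 n w w' hw hw' hb hb' h)⟩
  measurableSet_iUnion F hF := ⟨MeasurableSet.iUnion fun i => (hF i).1,
    fun n w w' hw hw' hb hb' h => by
      simp only [mem_iUnion]
      exact exists_congr fun i => (hF i).2 n w w' hw hw' hb hb' h⟩

lemma past_process_le {Ω : Type*} (hstep : Measurable (Function.uncurry step)) (s : S)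
    (Z : Ω → ℕ → ℝ × M) (t : ℝ≥0) :
    past (fun (t : ℝ≥0) ω => process step s (Z ω) t) t ≤ (history (t : ℝ)).comap Z := by
  refine iSup_le fun r => ?_
  rintro _ ⟨A, hA, rfl⟩
  refine ⟨{w | process step s w r.1 ∈ A}, ⟨?_, ?_⟩, rfl⟩
  · exact ((measurable_process hstep _).comp measurable_prodMk_left) hA
  · intro n w w' hw hw' hb hb' h
    have := hw.process_congr (step := step) (s := s) hw' hb hb' h (NNReal.coe_le_coe.2 r.2)
    simp only [mem_ofPred_eq, this]

/-- A chain driven by a marked Poisson process is a Markov process in continuous time. -/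
lemma isMarkovProcess_process {Ω : Type*} [MeasurableSpace Ω] {μ : Measure Ω}
    [IsProbabilityMeasure μ] (hstep : Measurable (Function.uncurry step)) (s : S)
    {Z : Ω → ℕ → ℝ × M} (hZ : Measurable Z) (hlaw : μ.map Z = seqLaw ((expMeasure 2).prod ρ)) :
    IsMarkovProcess μ (fun t : ℝ≥0 => transition ρ hstep t) s
      fun t ω => process step s (Z ω) t := by
  have hproc : ∀ t, Measurable fun w : ℕ → ℝ × M => process step s w t := fun t =>
    (measurable_process hstep t).comp measurable_prodMk_left
  have hX : ∀ t : ℝ≥0, Measurable fun ω => process step s (Z ω) t := fun t => (hproc t).comp hZ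
  refine ⟨hX, ?_, fun t u A hA => ?_⟩
  · refine ae_of_ae_map (p := fun w => process step s w ((0 : ℝ≥0) : ℝ) = s) hZ.aemeasurable ?_
    rw [hlaw]
    filter_upwards [ae_positive] with w hw
    rw [NNReal.coe_zero, hw.process_eq (n := 0) (mem_between_zero.2 ⟨le_rfl, hw 0⟩)]
    rfl
  · have hle : past (fun (t : ℝ≥0) ω => process step s (Z ω) t) t ≤ ‹MeasurableSpace Ω› :=
      iSup_le fun r => (hX r.1).comap_le
    have hK : Measurable fun s' => transition ρ hstep u s' A :=
      (transition ρ hstep u).measurable_coe hA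
    have hXt : Measurable[past (fun (t : ℝ≥0) ω => process step s (Z ω) t) t]
        fun ω => process step s (Z ω) t :=
      Measurable.mono (comap_measurable _) (le_iSup (fun r : {r : ℝ≥0 // r ≤ t} =>
        MeasurableSpace.comap (fun ω => process step s (Z ω) r.1) inferInstance) ⟨t, le_rfl⟩) le_rfl
    have hmarkov := (isTransitionSemigroup_transition (ρ := ρ) hstep).markov u
    have hle1 : ∀ s', transition ρ hstep u s' A ≤ 1 := fun s' => prob_le_one
    have hgm : Measurable fun ω => (transition ρ hstep u (process step s (Z ω) t)).real A :=
      (hK.comp (hX t)).ennreal_toReal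
    have hAu : MeasurableSet ((fun ω => process step s (Z ω) ((t + u : ℝ≥0) : ℝ)) ⁻¹' A) :=
      hX (t + u) hA
    refine (ae_eq_condExp_of_forall_setIntegral_eq hle ?_ ?_ ?_ ?_).symm
    · exact (integrable_const (1 : ℝ)).indicator hAu
    · intro B _ _
      refine (Integrable.of_bound hgm.aestronglyMeasurable 1
        (Filter.Eventually.of_forall fun ω => ?_)).integrableOn
      rw [Real.norm_of_nonneg measureReal_nonneg]
      exact ENNReal.toReal_le_of_le_ofReal zero_le_one (by simpa using hle1 _)
    · intro B hB _
      obtain ⟨F, hF, rfl⟩ := past_process_le hstep s Z t B hB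
      have h1 := measure_inter_process (ρ := ρ) hstep s t.coe_nonneg u.coe_nonneg hF.1 hF.2 hA
      have hKt : Measurable fun w : ℕ → ℝ × M => transition ρ hstep u (process step s w t) A :=
        hK.comp (hproc t)
      rw [integral_indicator_const _ hAu, measureReal_restrict_apply hAu, smul_eq_mul, mul_one]
      have h2 : ∫ ω in Z ⁻¹' F, (transition ρ hstep u (process step s (Z ω) t)).real A ∂μ
          = (∫⁻ ω in Z ⁻¹' F, transition ρ hstep u (process step s (Z ω) t) A ∂μ).toReal :=
        integral_toReal (hKt.comp hZ).aemeasurable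
          (Filter.Eventually.of_forall fun ω => (hle1 _).trans_lt ENNReal.one_lt_top)
      rw [h2, ← setLIntegral_map hF.1 hKt hZ, hlaw]
      refine congrArg ENNReal.toReal (h1.symm.trans ?_)
      have hset : MeasurableSet {w : ℕ → ℝ × M | process step s w (t + u) ∈ A} := hproc _ hA
      rw [← hlaw, Measure.map_apply hZ (hF.1.inter hset), inter_comm]
      rfl
    · exact ((hK.comp hXt).ennreal_toReal).aestronglyMeasurable

end Path

section Book

variable {x y : ℝ}

lemma state_bookAfter (hxy : x < y) (a : Arrivals) (L : AnchoredBook x y) (k : ℕ) :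
    (bookAfter a L k).state = chain (State.step hxy) L.state (merged a) k := by
  induction k with
  | zero => rfl
  | succ k ih => rw [bookAfter_succ_state hxy, ih]; rfl

lemma state_bookAt (hxy : x < y) (a : Arrivals) (L : AnchoredBook x y) (t : ℝ≥0) :
    (bookAt a L t).state = process (State.step hxy) L.state (merged a) t := by
  have h : numOrders a t = numJumps (merged a) t := by
    simp only [numOrders, orderTime_eq_sum]
    rfl
  rw [bookAt, state_bookAfter hxy, h, process]

/-! ### Consequences of the two inequalities -/

lemma measureReal_Ioo_le_cdf_sub (ν : Measure ℝ) [IsProbabilityMeasure ν] (hxy : x < y) :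
    ν.real (Ioo x y) ≤ cdf ν y - cdf ν x := by
  have h : ν.real (Iic y) = ν.real (Iic x) + ν.real (Ioc x y) := by
    rw [← Iic_union_Ioc_eq_Iic hxy.le, measureReal_union (Iic_disjoint_Ioc le_rfl) measurableSet_Ioc]
  rw [cdf_eq_real, cdf_eq_real, h, add_sub_cancel_left]
  exact measureReal_mono Ioo_subset_Ioc_self

lemma one_sub_cdf_le (ν : Measure ℝ) [IsProbabilityMeasure ν] (y : ℝ) :
    1 - cdf ν y ≤ ν.real (Ici y) := by
  rw [cdf_eq_real, ← probReal_compl_eq_one_sub measurableSet_Iic, compl_Iic]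
  exact measureReal_mono Ioi_subset_Ici_self

lemma exists_weight {a b : ℝ≥0∞} (h : a < b) (hb : b ≠ ⊤) : ∃ r < 1, a = r * b :=
  have h0 : b ≠ 0 := (bot_le.trans_lt h).ne'
  ⟨a / b, (ENNReal.div_lt_iff (Or.inl h0) (Or.inl hb)).2 (by simpa using h),
    (ENNReal.div_mul_cancel h0 hb).symm⟩

lemma tsum_weight_ne_top {r s : ℝ≥0∞} (hr : r < 1) (hs : s < 1) :
    ∑' q : ℕ × ℕ, r ^ q.1 * s ^ q.2 ≠ ⊤ := by
  rw [ENNReal.tsum_prod' (f := fun q : ℕ × ℕ => r ^ q.1 * s ^ q.2)]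
  simp only [ENNReal.tsum_mul_left, ENNReal.tsum_mul_right, ENNReal.tsum_geometric]
  exact ENNReal.mul_ne_top (ENNReal.inv_ne_top.2 (tsub_pos_of_lt hr).ne')
    (ENNReal.inv_ne_top.2 (tsub_pos_of_lt hs).ne')

end Book

end LimitOrderBook

theorem mainTheorem5 {Ω : Type*} [MeasurableSpace Ω] (μ : Measure Ω) [IsProbabilityMeasure μ]
    (νb νa : Measure ℝ) [IsProbabilityMeasure νb] [IsProbabilityMeasure νa]
    (hνb : νb ≪ volume) (hνa : νa ≪ volume)
    (a : Ω → LimitOrderBook.Arrivals)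
    (ha : LimitOrderBook.IsPoissonArrivals μ νb νa a)
    (x y : ℝ) (hxy : x < y)
    (h₁ : cdf νb y < cdf νb x + cdf νa x)
    (h₂ : cdf νa y < cdf νa x + (1 - cdf νb y)) :
    LimitOrderBook.IsPositiveHarrisRecurrent μ
      (fun L₀ : LimitOrderBook.AnchoredBook x y => L₀.state)
      (fun L₀ t ω => (LimitOrderBook.bookAt (a ω) L₀ t).state) := by
  open LimitOrderBook in
  have hstep : Measurable (Function.uncurry (State.step hxy)) := State.measurable_step hxy
  have hZ := ha.measurable_merged
  have hlaw : μ.map (fun ω => merged (a ω)) = seqLaw ((expMeasure 2).prod (markLaw νb νa)) :=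
    ha.map_merged
  -- the drift of each component of the bounding walk is negative
  have hdb : νb (Ioo x y) < νa (Iic x) := by
    refine (ENNReal.toReal_lt_toReal (measure_ne_top _ _) (measure_ne_top _ _)).1 ?_
    have h := measureReal_Ioo_le_cdf_sub νb hxy
    rw [cdf_eq_real νa] at h₁
    change νb.real _ < νa.real _
    linarith
  have hda : νa (Ioo x y) < νb (Ici y) := by
    refine (ENNReal.toReal_lt_toReal (measure_ne_top _ _) (measure_ne_top _ _)).1 ?_
    have h := measureReal_Ioo_le_cdf_sub νa hxy
    have h' := one_sub_cdf_le νb y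
    change νa.real _ < νb.real _
    linarith
  obtain ⟨r, hr1, hr⟩ := exists_weight hdb (measure_ne_top _ _)
  obtain ⟨s, hs1, hs⟩ := exists_weight hda (measure_ne_top _ _)
  have hfin := tsum_weight_ne_top hr1 hs1
  refine ⟨AnchoredBook.state_surjective hxy, fun t => transition (markLaw νb νa) hstep t,
    isTransitionSemigroup_transition hstep, fun L => ?_,
    ⟨Measure.dirac (State.empty x y), inferInstance, IsProbabilityMeasure.ne_zero _,
      fun A hA hpos L => ?_⟩, ?_⟩
  · simp only [state_bookAt hxy]
    exact isMarkovProcess_process hstep L.state hZ hlaw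
  · have hmem : State.empty x y ∈ A := by
      by_contra hA'
      rw [Measure.dirac_apply' _ hA, indicator_of_notMem hA'] at hpos
      exact lt_irrefl _ hpos
    obtain ⟨q, hq⟩ := L.state.exists_dominated
    simp only [state_bookAt hxy]
    refine ae_of_ae_map (p := fun w => volume ((fun t : ℝ≥0 => (t : ℝ)) ''
      {t | process (State.step hxy) L.state w t ∈ A}) = ⊤) hZ.aemeasurable ?_
    rw [hlaw]
    filter_upwards [ae_mem_recurs hxy hr hs hfin hdb hda q, ae_positive] with w hw hpos
    refine hpos.volume_occupation_eq_top (hw.mono fun n hn => ⟨?_, hn.2⟩)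
    have hd := Book.Dominated.state_chain (hxy := hxy) hq w n
    rw [hn.1] at hd
    rwa [State.eq_empty_of_dominated hd]
  · have hret : ∑' n, survival (State.step hxy) (markLaw νb νa) (State.empty x y) n
        (State.empty x y) ≠ ⊤ :=
      ne_top_of_le_ne_top (ENNReal.add_ne_top.2 ⟨ENNReal.one_ne_top, hfin⟩)
        ((ENNReal.tsum_le_tsum fun n => survival_step_le (State.empty_dominated (0, 0)) n).trans
          (tsum_survival_walkStep_le hxy hr hs))
    obtain ⟨π, hπ, hinv⟩ := exists_invariantStep hstep measurableSet_empty_state hret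
    exact ⟨π, hπ, fun t => hinv.invariant_transition hstep t.coe_nonneg⟩
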